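/- Let $p > q \ge 0$ be coprime integers with $(p,q) \neq (1,0)$, and let $M = Y^{p,q}$ be the Gauntlett--Martelli--Sparks--Waldram Sasaki--Einstein $5$-manifold with its contact metric structure $(\xi,\eta,\Phi,g)$, normalized so that $d\eta(X,Y) = g(X,\Phi Y)$. Explicitly, $M$ is the quotient of $S^3 \times S^3 \subset \mathbb{C}^2 \times \mathbb{C}^2$ by the free circle action with weights $(p,p,-(p-q),-(p+q))$. Put $a = \frac12 - \frac{p^2-3q^2}{4p^3}\sqrt{4p^2-3q^2}$, let $y_1 < 0 < y_2 < 1$ be the two smaller roots of $a - 3y^2 + 2y^3$, and let $y = y_1|z_3|^2 + y_2|z_2|^2$. On the dense open set where all $z_k = |z_k| e^{i\theta_k}$ are non-zero put $|z_0| = \sin(\theta/2)$, $|z_1| = \cos(\theta/2)$, $\phi = \theta_0 - \theta_1$, $\psi = \theta_0+\theta_1+\theta_2+\theta_3$, $\beta = -\theta_0-\theta_1-\theta_2/y_1-\theta_3/y_2$. Then $\eta$ and $g$ are the smooth tensors on $M$ given on this set by $$\tfrac12\eta = \tfrac13\big[d\psi - \cos\theta\, d\phi + y(d\beta + \cos\theta\,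 d\phi)\big],$$ $$\tfrac14 g = \tfrac{1-y}{6}(d\theta^2 + \sin^2\theta\, d\phi^2) + \tfrac{dy^2}{k(y)} + \tfrac{k(y)}{36}(d\beta + \cos\theta\, d\phi)^2 + \tfrac14\eta^2, \qquad k(y) = \tfrac{2(a-3y^2+2y^3)}{1-y},$$ and $\xi$ is the Reeb vector field of $\eta$. Let $H = \ker\eta$, oriented by $d\eta \wedge d\eta$, and let $\wedge^- H^*$ be the bundle of anti-self-dual transverse $2$-forms (forms $\alpha$ with $i_\xi\alpha = 0$ and anti-self-dual on $H$), an $SO(3)$-vector bundle of rank $3$. The transverse Levi-Civita connection $\overline\nabla$ on $H$ is defined, for sections $Y$ of $H$, by letting $\overline\nabla_X Y$ be the $H$-component of $\nabla_X Y$ for $X \in H$ ($\nabla$ the Levi-Civita connection of $g$) and $\overline\nabla_\xi Y$ the $H$-component of $[\xi,Y]$; it induces a connection on $\wedge^- H^*$. Then the transverse Levi-Civita connection on $\wedge^- H^*$ is irreducible: the group of gauge transformations (smooth bundle automorphisms of $\wedge^- H^*$ that are fibrewise in $SO(3)$) which are covariantly constant with respect to $\overline\nabla$ equals the centre of $SO(3)$,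 i.e. it consists of the identity only. -/

import Mathlib

open Set Topology
open scoped Manifold ContDiff ComplexConjugate

noncomputable section

/-! ## The manifold `Y^{p,q}`: the quotient of `S³ × S³` by a free circle action -/

/-- Admissible parameters: coprime natural numbers `q < p`. -/
structure YParam where
  p : ℕ
  q : ℕ
  lt : q < p
  coprime : Nat.Coprime p q

/-- `ℂ⁴`, written as `ℂ² × ℂ²`; the coordinates are `z₀, z₁` and `z₂, z₃`. -/
abbrev C4 : Type := (Fin 2 → ℂ) × (Fin 2 → ℂ)

/-- The model space `ℂ × ℂ × ℝ ≅ ℝ⁵` of the manifold. -/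
abbrev E5 : Type := ℂ × ℂ × ℝ

namespace YParam

variable (P : YParam)

/-- The circle acts on `z₀, z₁` with weight `p` and on `z₂, z₃` with weights `-(p - q)`, `-(p + q)`.
These are the absolute values of the last two weights. -/
def wt : Fin 2 → ℕ := ![P.p - P.q, P.p + P.q]

/-- The circle action on `ℂ⁴` with weights `(p, p, -(p - q), -(p + q))`. -/
def act (ζ : Circle) (z : C4) : C4 :=
  (fun i => (ζ : ℂ) ^ (P.p : ℤ) * z.1 i, fun j => (ζ : ℂ) ^ (-(P.wt j : ℤ)) * z.2 j)

/-- `S³ × S³` in `ℂ² × ℂ²`. -/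
def S3S3 : Type := {z : C4 // ‖z.1 0‖ ^ 2 + ‖z.1 1‖ ^ 2 = 1 ∧ ‖z.2 0‖ ^ 2 + ‖z.2 1‖ ^ 2 = 1}

instance : TopologicalSpace S3S3 := inferInstanceAs (TopologicalSpace (Subtype _))

/-- Two points of `S³ × S³` are equivalent if they lie on the same orbit of the circle. -/
def orbitSetoid : Setoid S3S3 where
  r z z' := ∃ ζ : Circle, P.act ζ z.1 = z'.1
  iseqv := by
    refine ⟨fun z => ⟨1, ?_⟩, ?_, ?_⟩
    · simp [act]
    · rintro z z' ⟨ζ, h⟩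
      refine ⟨ζ⁻¹, ?_⟩
      rw [← h]
      ext k <;> simp [act, ζ.coe_ne_zero]
    · rintro z z' z'' ⟨ζ, h⟩ ⟨ζ', h'⟩
      refine ⟨ζ' * ζ, ?_⟩
      rw [← h', ← h]
      ext k <;> simp only [act, Circle.coe_mul, mul_zpow, mul_assoc]

/-- The underlying space of `Y^{p,q}`. -/
def Y : Type := Quotient P.orbitSetoid

instance : TopologicalSpace P.Y := inferInstanceAs (TopologicalSpace (Quotient _))

/-! ### Charts -/

/-- The phase of a complex number. -/
def ph (a : ℂ) : ℂ := a / (‖a‖ : ℂ)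

/-- A chart is labelled by an index `i` with `zᵢ ≠ 0`, an index `j` with `z_{2+j} ≠ 0`, and one
of two angular sectors. -/
structure ChartIndex where
  i : Fin 2
  j : Fin 2
  half : Bool

/-- The sign of an angular sector. -/
def ChartIndex.sgn (κ : ChartIndex) : ℂ := if κ.half then -1 else 1

/-- The centre of an angular sector. -/
def centre (κ : ChartIndex) : ℝ := if κ.half then Real.pi / P.p else 0

/-- The phase of `z_{2+j}` in terms of the angular coordinate. -/
def angle (κ : ChartIndex) (t : ℝ) : ℂ :=
  Complex.exp (((t / P.p + P.centre κ : ℝ) : ℂ) * Complex.I)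

/-- The smooth slice `(u, v, t) ↦ z` in `S³ × S³` that gives the local parametrization with
label `κ`: up to normalization `zᵢ = 1`, `z_{1-i} = u`, `z_{2+j} = exp(i(t/p + const))` and
`z_{2+(1-j)} = v`. -/
def slice (κ : ChartIndex) (x : E5) : C4 :=
  (fun k => (if k = κ.i then 1 else x.1) / (√(1 + ‖x.1‖ ^ 2) : ℂ),
   fun k => (if k = κ.j then P.angle κ x.2.2 else x.2.1) / (√(1 + ‖x.2.1‖ ^ 2) : ℂ))

/-- The invariant phase whose argument is the angular coordinate. -/
def inv (κ : ChartIndex) (z : C4) : ℂ :=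
  κ.sgn * (ph (z.2 κ.j) ^ P.p * ph (z.1 κ.i) ^ P.wt κ.j)

/-- The circle element that moves `z` into the slice. -/
def rot (κ : ChartIndex) (z : C4) : ℂ :=
  ph (z.1 κ.i) ^ (-Nat.gcdA P.p (P.wt κ.j)) *
    (ph (z.2 κ.j) / P.angle κ (P.inv κ z).arg) ^ Nat.gcdB P.p (P.wt κ.j)

/-- The coordinates, as a function on `ℂ⁴`. -/
def coord (κ : ChartIndex) (z : C4) : E5 :=
  (z.1 (κ.i + 1) / z.1 κ.i,
   P.rot κ z ^ (-(P.wt (κ.j + 1) : ℤ)) * z.2 (κ.j + 1) / (‖z.2 κ.j‖ : ℂ),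
   (P.inv κ z).arg)

/-- The points of `ℂ⁴` where the coordinates are used. -/
def dom (κ : ChartIndex) : Set C4 :=
  {z | z.1 κ.i ≠ 0 ∧ z.2 κ.j ≠ 0 ∧ P.inv κ z ∈ Complex.slitPlane}

lemma p_pos : 0 < P.p := lt_of_le_of_lt (Nat.zero_le _) P.lt

lemma coprime_wt (j : Fin 2) : Nat.Coprime P.p (P.wt j) := by
  have h := P.coprime
  have hl := P.lt.le
  fin_cases j
  · simpa [wt, Nat.coprime_self_sub_right hl] using h
  · simpa [wt] using h

lemma bezout (j : Fin 2) :
    (P.p : ℤ) * Nat.gcdA P.p (P.wt j) + (P.wt j : ℤ) * Nat.gcdB P.p (P.wt j) = 1 := by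
  rw [← Nat.gcd_eq_gcd_ab, (P.coprime_wt j).gcd_eq_one]; rfl

lemma norm_ph {a : ℂ} (h : a ≠ 0) : ‖ph a‖ = 1 := by
  simp [ph, h]

lemma ph_ne {a : ℂ} (h : a ≠ 0) : ph a ≠ 0 := by
  simp [ph, h]

lemma ph_mul_norm {a : ℂ} (h : a ≠ 0) : ph a * (‖a‖ : ℂ) = a := by
  simp [ph, h]

lemma ph_mul (a b : ℂ) : ph (a * b) = ph a * ph b := by
  simp [ph, mul_div_mul_comm]

lemma ph_unit {a : ℂ} (h : ‖a‖ = 1) : ph a = a := by simp [ph, h]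

lemma ph_real {r : ℝ} (h : 0 < r) : ph (r : ℂ) = 1 := by
  simp [ph, abs_of_pos h, h.ne']

lemma sgn_mul_self (κ : ChartIndex) : κ.sgn * κ.sgn = 1 := by
  unfold ChartIndex.sgn; split_ifs <;> simp

lemma norm_sgn (κ : ChartIndex) : ‖κ.sgn‖ = 1 := by
  unfold ChartIndex.sgn; split_ifs <;> simp

lemma norm_angle (κ : ChartIndex) (t : ℝ) : ‖P.angle κ t‖ = 1 := by
  rw [angle, Complex.norm_exp_ofReal_mul_I]

lemma angle_ne (κ : ChartIndex) (t : ℝ) : P.angle κ t ≠ 0 := Complex.exp_ne_zero _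

lemma angle_pow (κ : ChartIndex) (t : ℝ) :
    P.angle κ t ^ P.p = κ.sgn * Complex.exp (t * Complex.I) := by
  have hp : (P.p : ℂ) ≠ 0 := by exact_mod_cast P.p_pos.ne'
  rw [angle, ← Complex.exp_nat_mul]
  have : (P.p : ℂ) * (((t / P.p + P.centre κ : ℝ) : ℂ) * Complex.I)
      = t * Complex.I + (P.p : ℂ) * P.centre κ * Complex.I := by
    push_cast; field_simp
  rw [this, Complex.exp_add, mul_comm]
  congr 1
  unfold centre ChartIndex.sgn
  split_ifs
  · have : (P.p : ℂ) * ((Real.pi / P.p : ℝ) : ℂ) * Complex.I = Real.pi * Complex.I := by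
      push_cast; field_simp
    rw [this, Complex.exp_pi_mul_I]
  · simp

lemma norm_inv {κ : ChartIndex} {z : C4} (h1 : z.1 κ.i ≠ 0) (h2 : z.2 κ.j ≠ 0) :
    ‖P.inv κ z‖ = 1 := by
  simp [inv, norm_sgn, norm_ph h1, norm_ph h2]

lemma exp_arg_inv {κ : ChartIndex} {z : C4} (h1 : z.1 κ.i ≠ 0) (h2 : z.2 κ.j ≠ 0) :
    Complex.exp ((P.inv κ z).arg * Complex.I) = P.inv κ z := by
  have := Complex.norm_mul_exp_arg_mul_I (P.inv κ z)
  rwa [P.norm_inv h1 h2, Complex.ofReal_one, one_mul] at this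

lemma quot_pow {κ : ChartIndex} {z : C4} (h1 : z.1 κ.i ≠ 0) (h2 : z.2 κ.j ≠ 0) :
    (ph (z.2 κ.j) / P.angle κ (P.inv κ z).arg) ^ (P.p : ℤ)
      = ph (z.1 κ.i) ^ (-(P.wt κ.j : ℤ)) := by
  rw [zpow_natCast, div_pow, angle_pow, P.exp_arg_inv h1 h2, inv, ← mul_assoc, sgn_mul_self,
    one_mul, zpow_neg, zpow_natCast]
  have := pow_ne_zero P.p (ph_ne h2)
  have := pow_ne_zero (P.wt κ.j) (ph_ne h1)
  field_simp

lemma rot_pow_p {κ : ChartIndex} {z : C4} (h1 : z.1 κ.i ≠ 0) (h2 : z.2 κ.j ≠ 0) :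
    P.rot κ z ^ (P.p : ℤ) = (ph (z.1 κ.i))⁻¹ := by
  rw [rot, mul_zpow, ← zpow_mul (ph (z.2 κ.j) / _), mul_comm (Nat.gcdB _ _),
    zpow_mul (ph (z.2 κ.j) / _), P.quot_pow h1 h2, ← zpow_mul, ← zpow_mul,
    ← zpow_add₀ (ph_ne h1), ← zpow_neg_one]
  congr 1
  linear_combination -P.bezout κ.j

lemma rot_pow_wt {κ : ChartIndex} {z : C4} (h1 : z.1 κ.i ≠ 0) (h2 : z.2 κ.j ≠ 0) :
    P.rot κ z ^ (P.wt κ.j : ℤ) = ph (z.2 κ.j) / P.angle κ (P.inv κ z).arg := by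
  have hX : ph (z.2 κ.j) / P.angle κ (P.inv κ z).arg ≠ 0 :=
    div_ne_zero (ph_ne h2) (P.angle_ne _ _)
  have hb := P.bezout κ.j
  rw [rot, mul_zpow, ← zpow_mul, neg_mul_comm, mul_comm (Nat.gcdA _ _), zpow_mul,
    ← P.quot_pow h1 h2, ← zpow_mul, ← zpow_mul, ← zpow_add₀ hX]
  conv_rhs => rw [← zpow_one (ph (z.2 κ.j) / P.angle κ (P.inv κ z).arg)]
  congr 1
  linear_combination hb

lemma norm_rot {κ : ChartIndex} {z : C4} (h1 : z.1 κ.i ≠ 0) (h2 : z.2 κ.j ≠ 0) :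
    ‖P.rot κ z‖ = 1 := by
  simp [rot, norm_ph h1, norm_ph h2, norm_angle]

lemma ph_circle_zpow (ζ : Circle) (n : ℤ) : ph ((ζ : ℂ) ^ n) = (ζ : ℂ) ^ n :=
  ph_unit (by rw [norm_zpow, Circle.norm_coe, one_zpow])

lemma inv_act (κ : ChartIndex) (ζ : Circle) (z : C4) : P.inv κ (P.act ζ z) = P.inv κ z := by
  have hz := ζ.coe_ne_zero
  simp only [inv, act, ph_mul, ph_circle_zpow, mul_pow]
  have : ((ζ : ℂ) ^ (-(P.wt κ.j : ℤ))) ^ P.p * ((ζ : ℂ) ^ (P.p : ℤ)) ^ P.wt κ.j = 1 := by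
    rw [← zpow_natCast, ← zpow_natCast, ← zpow_mul, ← zpow_mul, ← zpow_add₀ hz]
    convert zpow_zero _ using 2
    ring
  linear_combination (κ.sgn * (ph (z.2 κ.j) ^ P.p * ph (z.1 κ.i) ^ P.wt κ.j)) * this

lemma rot_act (κ : ChartIndex) (ζ : Circle) (z : C4) :
    P.rot κ (P.act ζ z) = (ζ : ℂ)⁻¹ * P.rot κ z := by
  have hz := ζ.coe_ne_zero
  simp only [rot, inv_act]
  simp only [act, ph_mul, ph_circle_zpow, mul_zpow, mul_div_assoc]
  have : ((ζ : ℂ) ^ (P.p : ℤ)) ^ (-Nat.gcdA P.p (P.wt κ.j)) *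
      ((ζ : ℂ) ^ (-(P.wt κ.j : ℤ))) ^ Nat.gcdB P.p (P.wt κ.j) = (ζ : ℂ)⁻¹ := by
    rw [← zpow_mul, ← zpow_mul, ← zpow_add₀ hz, ← zpow_neg_one]
    congr 1
    linear_combination -P.bezout κ.j
  rw [← this]; ring

lemma coord_act (κ : ChartIndex) (ζ : Circle) (z : C4) :
    P.coord κ (P.act ζ z) = P.coord κ z := by
  have hz := ζ.coe_ne_zero
  simp only [coord, inv_act, rot_act]
  refine Prod.ext ?_ (Prod.ext ?_ rfl)
  · simp only [act]
    rw [mul_div_mul_left _ _ (zpow_ne_zero _ hz)]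
  · simp only [act, norm_mul, norm_zpow, Circle.norm_coe, one_zpow, one_mul, mul_zpow]
    rw [inv_zpow', neg_neg, zpow_neg (ζ : ℂ)]
    field_simp

lemma dom_act {κ : ChartIndex} {ζ : Circle} {z : C4} : P.act ζ z ∈ P.dom κ ↔ z ∈ P.dom κ := by
  have hz := ζ.coe_ne_zero
  simp only [dom, Set.mem_ofPred_eq, inv_act]
  simp [act, hz]

lemma fin2_eq {i k : Fin 2} (h : k ≠ i) : k = i + 1 := by
  revert i k; decide

lemma fin2_ne (i : Fin 2) : i + 1 ≠ i := by
  revert i; decide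

lemma slice_mem (κ : ChartIndex) (x : E5) :
    ‖(P.slice κ x).1 0‖ ^ 2 + ‖(P.slice κ x).1 1‖ ^ 2 = 1 ∧
      ‖(P.slice κ x).2 0‖ ^ 2 + ‖(P.slice κ x).2 1‖ ^ 2 = 1 := by
  have key : ∀ (i : Fin 2) (a b : ℂ), ‖a‖ = 1 →
      ‖(if (0 : Fin 2) = i then a else b) / (√(1 + ‖b‖ ^ 2) : ℂ)‖ ^ 2 +
      ‖(if (1 : Fin 2) = i then a else b) / (√(1 + ‖b‖ ^ 2) : ℂ)‖ ^ 2 = 1 := by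
    intro i a b ha
    have hp : 0 < 1 + ‖b‖ ^ 2 := by positivity
    have hs := Real.sq_sqrt hp.le
    fin_cases i <;>
    · simp only [norm_div, div_pow, Complex.norm_real, Real.norm_eq_abs, sq_abs, hs]
      simp [ha]
      field_simp
      try ring
  exact ⟨key _ _ _ (by simp), key _ _ _ (P.norm_angle _ _)⟩

/-- The point of `S³ × S³` with given coordinates. -/
def sliceS (κ : ChartIndex) (x : E5) : S3S3 := ⟨P.slice κ x, P.slice_mem κ x⟩

/-- The range of the coordinates. -/
def tgt : Set E5 := Set.univ ×ˢ (Set.univ ×ˢ Set.Ioo (-Real.pi) Real.pi)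


lemma isOpen_tgt : IsOpen tgt :=
  isOpen_univ.prod (isOpen_univ.prod isOpen_Ioo)

lemma sqrt_pos' (b : ℂ) : 0 < √(1 + ‖b‖ ^ 2) := Real.sqrt_pos.mpr (by positivity)

lemma ph_slice_fst (κ : ChartIndex) (x : E5) : ph ((P.slice κ x).1 κ.i) = 1 := by
  simp only [slice, if_true]
  rw [← Complex.ofReal_one, ← Complex.ofReal_div]
  exact ph_real (div_pos one_pos (sqrt_pos' _))

lemma ph_slice_snd (κ : ChartIndex) (x : E5) :
    ph ((P.slice κ x).2 κ.j) = P.angle κ x.2.2 := by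
  simp only [slice, if_true]
  rw [div_eq_mul_inv, ph_mul, ph_unit (P.norm_angle _ _), ← Complex.ofReal_inv,
    ph_real (inv_pos.mpr (sqrt_pos' _)), mul_one]

lemma inv_slice (κ : ChartIndex) (x : E5) :
    P.inv κ (P.slice κ x) = Complex.exp (x.2.2 * Complex.I) := by
  rw [inv, ph_slice_fst, ph_slice_snd, angle_pow, one_pow, mul_one, ← mul_assoc, sgn_mul_self,
    one_mul]

lemma arg_inv_slice (κ : ChartIndex) {x : E5} (hx : x ∈ tgt) :
    (P.inv κ (P.slice κ x)).arg = x.2.2 := by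
  rw [inv_slice, Complex.arg_exp_mul_I]
  exact (toIocMod_eq_self _).mpr ⟨hx.2.2.1, by linarith [hx.2.2.2]⟩

lemma slice_dom (κ : ChartIndex) {x : E5} (hx : x ∈ tgt) : P.slice κ x ∈ P.dom κ := by
  have h1 := sqrt_pos' x.1
  have h2 := sqrt_pos' x.2.1
  refine ⟨?_, ?_, ?_⟩
  · simp only [slice, if_true]
    exact div_ne_zero one_ne_zero (by exact_mod_cast h1.ne')
  · simp only [slice, if_true]
    exact div_ne_zero (P.angle_ne _ _) (by exact_mod_cast h2.ne')
  · rw [Complex.mem_slitPlane_iff_arg, P.arg_inv_slice κ hx, inv_slice]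
    exact ⟨hx.2.2.2.ne, Complex.exp_ne_zero _⟩

lemma coord_slice (κ : ChartIndex) {x : E5} (hx : x ∈ tgt) : P.coord κ (P.slice κ x) = x := by
  have h1 : ((√(1 + ‖x.1‖ ^ 2) : ℝ) : ℂ) ≠ 0 := by exact_mod_cast (sqrt_pos' x.1).ne'
  have h2 : ((√(1 + ‖x.2.1‖ ^ 2) : ℝ) : ℂ) ≠ 0 := by exact_mod_cast (sqrt_pos' x.2.1).ne'
  have hrot : P.rot κ (P.slice κ x) = 1 := by
    rw [rot, ph_slice_fst, ph_slice_snd, P.arg_inv_slice κ hx, div_self (P.angle_ne _ _)]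
    simp
  refine Prod.ext ?_ (Prod.ext ?_ (P.arg_inv_slice κ hx))
  · simp only [coord, slice, if_true, fin2_ne, if_false]
    field_simp
  · simp only [coord, hrot]
    simp only [slice, if_true, fin2_ne, if_false, norm_div, norm_angle,
      Complex.norm_real, Real.norm_eq_abs, abs_of_pos (sqrt_pos' x.2.1)]
    push_cast
    simp [h2]

lemma norm_sqrt {a b : ℂ} (ha : a ≠ 0) (h : ‖a‖ ^ 2 + ‖b‖ ^ 2 = 1) :
    √(1 + (‖b‖ / ‖a‖) ^ 2) = ‖a‖⁻¹ := by
  have ha' : 0 < ‖a‖ := norm_pos_iff.mpr ha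
  rw [Real.sqrt_eq_iff_mul_self_eq (by positivity) (by positivity)]
  field_simp
  linarith

lemma norm_add_one {w : Fin 2 → ℂ} (i : Fin 2) (h : ‖w 0‖ ^ 2 + ‖w 1‖ ^ 2 = 1) :
    ‖w i‖ ^ 2 + ‖w (i + 1)‖ ^ 2 = 1 := by
  fin_cases i
  · simpa using h
  · simpa [add_comm] using h

lemma slice_coord {κ : ChartIndex} {z : S3S3} (hz : z.1 ∈ P.dom κ) :
    ∃ ζ : Circle, P.act ζ z.1 = P.slice κ (P.coord κ z.1) := by
  obtain ⟨h1, h2, -⟩ := hz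
  obtain ⟨z, hz1, hz2⟩ := z
  simp only at h1 h2 ⊢
  have n1 : ((‖z.1 κ.i‖ : ℝ) : ℂ) ≠ 0 := by exact_mod_cast norm_ne_zero_iff.mpr h1
  have n2 : ((‖z.2 κ.j‖ : ℝ) : ℂ) ≠ 0 := by exact_mod_cast norm_ne_zero_iff.mpr h2
  have hr := P.norm_rot h1 h2
  have hr0 : P.rot κ z ≠ 0 := norm_ne_zero_iff.mp (by rw [hr]; exact one_ne_zero)
  refine ⟨⟨P.rot κ z, mem_sphere_zero_iff_norm.mpr hr⟩, ?_⟩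
  refine Prod.ext ?_ ?_
  · funext k
    have e : √(1 + ‖(P.coord κ z).1‖ ^ 2) = ‖z.1 κ.i‖⁻¹ := by
      simp only [coord, norm_div]
      exact norm_sqrt h1 (norm_add_one κ.i hz1)
    simp only [slice, e, act]
    rw [P.rot_pow_p h1 h2]
    push_cast
    rw [div_inv_eq_mul]
    have hp := ph_mul_norm h1
    have hp0 := ph_ne h1
    by_cases hk : k = κ.i
    · subst hk
      simp only [if_true, one_mul]
      field_simp
      exact hp.symm
    · simp only [hk, if_false, coord]
      rw [fin2_eq hk]
      field_simp
      linear_combination -z.1 (κ.i + 1) * hp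
  · funext k
    have e : √(1 + ‖(P.coord κ z).2.1‖ ^ 2) = ‖z.2 κ.j‖⁻¹ := by
      simp only [coord, norm_div, norm_mul, norm_zpow, hr, one_zpow, one_mul, Complex.norm_real,
        norm_norm]
      exact norm_sqrt h2 (norm_add_one κ.j hz2)
    simp only [slice, e, act]
    push_cast
    rw [div_inv_eq_mul]
    by_cases hk : k = κ.j
    · subst hk
      simp only [if_true]
      rw [zpow_neg, P.rot_pow_wt h1 h2, coord]
      have hp := ph_mul_norm h2
      have hp0 := ph_ne h2
      have ha := P.angle_ne κ (P.inv κ z).arg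
      field_simp
      exact hp.symm
    · simp only [hk, if_false, coord]
      rw [fin2_eq hk]
      field_simp

/-! ### Smoothness of the coordinates -/

lemma contDiffAt_zpow' {F : Type*} [NormedAddCommGroup F] [NormedSpace ℝ F] {f : F → ℂ} {x : F}
    (hf : ContDiffAt ℝ ∞ f x) (h0 : f x ≠ 0) (n : ℤ) : ContDiffAt ℝ ∞ (fun y => f y ^ n) x := by
  cases n with
  | ofNat n => simpa using hf.pow n
  | negSucc n =>
    simp only [zpow_negSucc]
    exact (hf.pow (n + 1)).inv (pow_ne_zero _ h0)

lemma contDiffAt_div' {F : Type*} [NormedAddCommGroup F] [NormedSpace ℝ F] {f g : F → ℂ} {x : F}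
    (hf : ContDiffAt ℝ ∞ f x) (hg : ContDiffAt ℝ ∞ g x) (h0 : g x ≠ 0) :
    ContDiffAt ℝ ∞ (fun y => f y / g y) x := by
  simp only [div_eq_mul_inv]
  exact hf.mul (hg.inv h0)

lemma contDiffAt_ofReal {F : Type*} [NormedAddCommGroup F] [NormedSpace ℝ F] {f : F → ℝ} {x : F}
    (hf : ContDiffAt ℝ ∞ f x) : ContDiffAt ℝ ∞ (fun y => (f y : ℂ)) x :=
  Complex.ofRealCLM.contDiff.contDiffAt.comp x hf

lemma contDiffAt_ph {F : Type*} [NormedAddCommGroup F] [NormedSpace ℝ F] {f : F → ℂ} {x : F}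
    (hf : ContDiffAt ℝ ∞ f x) (h0 : f x ≠ 0) : ContDiffAt ℝ ∞ (fun y => ph (f y)) x := by
  unfold ph
  exact contDiffAt_div' hf (contDiffAt_ofReal (hf.norm ℝ h0))
    (by exact_mod_cast norm_ne_zero_iff.mpr h0)

lemma contDiff_angle (κ : ChartIndex) : ContDiff ℝ ∞ (P.angle κ) := by
  unfold angle
  refine Complex.contDiff_exp.comp ?_
  refine ContDiff.mul (Complex.ofRealCLM.contDiff.comp ?_) contDiff_const
  exact (contDiff_id.div_const _).add contDiff_const

lemma contDiff_fst (k : Fin 2) : ContDiff ℝ ∞ (fun z : C4 => z.1 k) := by fun_prop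

lemma contDiff_snd (k : Fin 2) : ContDiff ℝ ∞ (fun z : C4 => z.2 k) := by fun_prop

lemma contDiffAt_inv {κ : ChartIndex} {z : C4} (h1 : z.1 κ.i ≠ 0) (h2 : z.2 κ.j ≠ 0) :
    ContDiffAt ℝ ∞ (P.inv κ) z := by
  unfold inv
  exact contDiffAt_const.mul (((contDiffAt_ph (contDiff_snd _).contDiffAt h2).pow _).mul
    ((contDiffAt_ph (contDiff_fst _).contDiffAt h1).pow _))

lemma contDiffAt_coord {κ : ChartIndex} {z : C4} (hz : z ∈ P.dom κ) :
    ContDiffAt ℝ ∞ (P.coord κ) z := by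
  obtain ⟨h1, h2, h3⟩ := hz
  have harg : ContDiffAt ℝ ∞ (fun y => (P.inv κ y).arg) z := by
    have hl : ContDiffAt ℝ ∞ (fun y => Complex.log (P.inv κ y)) z :=
      ((Complex.contDiffAt_log h3).restrict_scalars ℝ).comp z (P.contDiffAt_inv h1 h2)
    have := Complex.imCLM.contDiff.contDiffAt.comp z hl
    refine this.congr_of_eventuallyEq (Filter.Eventually.of_forall fun y => ?_)
    simp [Complex.log_im]
  have hrot : ContDiffAt ℝ ∞ (P.rot κ) z := by
    unfold rot
    refine (contDiffAt_zpow' (contDiffAt_ph (contDiff_fst _).contDiffAt h1) (ph_ne h1) _).mul ?_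
    exact contDiffAt_zpow' (f := fun y => ph (y.2 κ.j) / P.angle κ (P.inv κ y).arg)
      (contDiffAt_div' (contDiffAt_ph (contDiff_snd _).contDiffAt h2)
        ((P.contDiff_angle κ).contDiffAt.comp z harg) (P.angle_ne _ _))
      (div_ne_zero (ph_ne h2) (P.angle_ne _ _)) _
  have hr0 : P.rot κ z ≠ 0 :=
    norm_ne_zero_iff.mp (by rw [P.norm_rot h1 h2]; exact one_ne_zero)
  unfold coord
  refine ContDiffAt.prodMk ?_ (ContDiffAt.prodMk ?_ harg)
  · exact contDiffAt_div' (contDiff_fst _).contDiffAt (contDiff_fst _).contDiffAt h1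
  · refine contDiffAt_div' ((contDiffAt_zpow' hrot hr0 _).mul (contDiff_snd _).contDiffAt) ?_ ?_
    · exact contDiffAt_ofReal ((contDiff_snd _).contDiffAt.norm ℝ h2)
    · exact_mod_cast norm_ne_zero_iff.mpr h2

lemma contDiff_slice (κ : ChartIndex) : ContDiff ℝ ∞ (P.slice κ) := by
  have hs : ∀ f : E5 → ℂ, ContDiff ℝ ∞ f →
      ContDiff ℝ ∞ (fun x => ((√(1 + ‖f x‖ ^ 2) : ℝ) : ℂ)) := fun f hf =>
    Complex.ofRealCLM.contDiff.comp
      (ContDiff.sqrt (contDiff_const.add (hf.norm_sq ℝ)) fun x => by positivity)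
  have hne : ∀ b : ℂ, ((√(1 + ‖b‖ ^ 2) : ℝ) : ℂ) ≠ 0 := fun b => by
    exact_mod_cast (sqrt_pos' b).ne'
  unfold slice
  refine ContDiff.prodMk (contDiff_pi.mpr fun k => ?_) (contDiff_pi.mpr fun k => ?_)
  · refine contDiff_iff_contDiffAt.mpr fun x =>
      contDiffAt_div' ?_ (hs (fun x => x.1) (by fun_prop)).contDiffAt (hne _)
    split_ifs <;> fun_prop
  · refine contDiff_iff_contDiffAt.mpr fun x =>
      contDiffAt_div' ?_ (hs (fun x => x.2.1) (by fun_prop)).contDiffAt (hne _)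
    split_ifs
    · exact ((P.contDiff_angle κ).comp (by fun_prop : ContDiff ℝ ∞ fun x : E5 => x.2.2)).contDiffAt
    · fun_prop

lemma isOpen_dom (κ : ChartIndex) : IsOpen (P.dom κ) := by
  rw [isOpen_iff_mem_nhds]
  rintro z ⟨h1, h2, h3⟩
  have e1 := (contDiff_fst κ.i).continuous.continuousAt.eventually_ne h1
  have e2 := (contDiff_snd κ.j).continuous.continuousAt.eventually_ne h2
  have e3 := (P.contDiffAt_inv h1 h2).continuousAt.eventually
    (Complex.isOpen_slitPlane.mem_nhds h3)
  filter_upwards [e1, e2, e3] with y a b c using ⟨a, b, c⟩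

lemma coord_tgt {κ : ChartIndex} {z : C4} (hz : z ∈ P.dom κ) : P.coord κ z ∈ tgt := by
  have h := Complex.mem_slitPlane_iff_arg.mp hz.2.2
  exact ⟨trivial, trivial, Complex.neg_pi_lt_arg _,
    lt_of_le_of_ne (Complex.arg_le_pi _) h.1⟩

/-! ### The quotient manifold -/

/-- The projection `S³ × S³ → Y^{p,q}`. -/
def proj (z : S3S3) : P.Y := Quotient.mk P.orbitSetoid z

lemma isQuotientMap_proj : IsQuotientMap P.proj := isQuotientMap_quot_mk

/-- The coordinates on the quotient. -/
def coordY (κ : ChartIndex) : P.Y → E5 :=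
  Quotient.lift (s := P.orbitSetoid) (fun z => P.coord κ z.1)
    (by rintro z w ⟨ζ, h⟩; simp only [← h, coord_act])

/-- The domain of the coordinates on the quotient. -/
def domY (κ : ChartIndex) : Set P.Y :=
  Quotient.lift (s := P.orbitSetoid) (fun z => z.1 ∈ P.dom κ)
    (by rintro z w ⟨ζ, h⟩; simp only [← h, dom_act])

lemma isOpen_domY (κ : ChartIndex) : IsOpen (P.domY κ) := by
  rw [← P.isQuotientMap_proj.isOpen_preimage]
  exact (P.isOpen_dom κ).preimage continuous_subtype_val

/-- The chart of `Y^{p,q}` with label `κ`. -/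
def chart (κ : ChartIndex) : OpenPartialHomeomorph P.Y E5 where
  toFun := P.coordY κ
  invFun x := P.proj (P.sliceS κ x)
  source := P.domY κ
  target := tgt
  map_source' := by
    rintro ⟨z⟩ hz
    exact P.coord_tgt hz
  map_target' x hx := P.slice_dom κ hx
  left_inv' := by
    rintro ⟨z⟩ hz
    obtain ⟨ζ, h⟩ := P.slice_coord hz
    exact (Quotient.sound (s := P.orbitSetoid) ⟨ζ, h⟩).symm
  right_inv' x hx := P.coord_slice κ hx
  open_source := P.isOpen_domY κ
  open_target := isOpen_tgt
  continuousOn_toFun := by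
    rw [P.isQuotientMap_proj.continuousOn_isOpen_iff (P.isOpen_domY κ)]
    intro z hz
    exact ((P.contDiffAt_coord hz).continuousAt.comp
      continuous_subtype_val.continuousAt).continuousWithinAt
  continuousOn_invFun :=
    (P.isQuotientMap_proj.continuous.comp
      ((P.contDiff_slice κ).continuous.subtype_mk _)).continuousOn

lemma exists_chart (y : P.Y) : ∃ κ, y ∈ (P.chart κ).source := by
  obtain ⟨z⟩ := y
  have key : ∀ w : Fin 2 → ℂ, ‖w 0‖ ^ 2 + ‖w 1‖ ^ 2 = 1 → ∃ i, w i ≠ 0 := by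
    intro w hw
    by_contra! h
    simp [h] at hw
  obtain ⟨i, hi⟩ := key _ z.2.1
  obtain ⟨j, hj⟩ := key _ z.2.2
  have h0 : P.inv ⟨i, j, false⟩ z.1 ≠ 0 :=
    norm_ne_zero_iff.mp (by rw [P.norm_inv hi hj]; exact one_ne_zero)
  rcases Complex.mem_slitPlane_or_neg_mem_slitPlane h0 with h | h
  · exact ⟨⟨i, j, false⟩, hi, hj, h⟩
  · refine ⟨⟨i, j, true⟩, hi, hj, ?_⟩
    simpa [inv, ChartIndex.sgn] using h

/-- The label of the preferred chart at a point. -/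
def idx (y : P.Y) : ChartIndex := (P.exists_chart y).choose

instance : ChartedSpace E5 P.Y where
  atlas := Set.range P.chart
  chartAt y := P.chart (P.idx y)
  mem_chart_source y := (P.exists_chart y).choose_spec
  chart_mem_atlas _ := ⟨_, rfl⟩

instance : IsManifold 𝓘(ℝ, E5) ∞ P.Y := by
  refine isManifold_of_contDiffOn _ _ _ ?_
  rintro _ _ ⟨κ, rfl⟩ ⟨κ', rfl⟩
  intro x hx
  have hx' : P.slice κ x ∈ P.dom κ' := hx.1.2
  exact ((P.contDiffAt_coord hx').comp x (P.contDiff_slice κ).contDiffAt).contDiffWithinAt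

/-! ### The Sasaki-Einstein structure

All tensors are given by explicit forms on `ℂ⁴` whose restrictions to `S³ × S³` are basic for the
circle action; here `v` denotes a tangent vector of `ℂ⁴` at `z`.

The numbers `y₁ < 0 < y₂ < 1 < y₃` are the roots of `a - 3y² + 2y³`, where
`a = 1/2 - (p² - 3q²) √(4p² - 3q²) / (4p³)`. With
`z₀ = sin(θ/2) e^{iθ₀}`, `z₁ = cos(θ/2) e^{iθ₁}`, `y = y₁|z₃|² + y₂|z₂|²` and
`φ = θ₀ - θ₁`, `ψ = θ₀ + θ₁ + θ₂ + θ₃`, `β = -(θ₀ + θ₁) - θ₂/y₁ - θ₃/y₂` (`θ₂, θ₃` the arguments of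
`z₂, z₃`) one has on the dense open set where no `zₖ` vanishes
`η / 2 = (dψ - cos θ dφ + y (dβ + cos θ dφ)) / 3` and
`(g - η²) / 4 = (1 - y)/6 (dθ² + sin²θ dφ²) + dy²/(w r) + (w r)/36 (dβ + cos θ dφ)²` with
`w r = 2(a - 3y² + 2y³)/(1 - y)`, which is the usual form of the metric on `Y^{p,q}`
(for `q > 0`; for `q = 0` one has `y₁ = y₂` and the formulas degenerate). The scale is the one for
which `dη(X, Y) = g(X, Φ Y)` with an almost complex structure `Φ` on `ker η`. -/

/-- `√(4p² - 3q²)`. -/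
def disc : ℝ := √(4 * (P.p : ℝ) ^ 2 - 3 * (P.q : ℝ) ^ 2)

/-- The root `y₁`. -/
def y₁ : ℝ := (2 * P.p - 3 * P.q - P.disc) / (4 * P.p)

/-- The root `y₂`. -/
def y₂ : ℝ := (2 * P.p + 3 * P.q - P.disc) / (4 * P.p)

/-- The root `y₃`. -/
def y₃ : ℝ := (P.p + P.disc) / (2 * P.p)

/-- The function `y`, with values in `[y₁, y₂]` on `S³ × S³`. -/
def yFun (z : C4) : ℝ := P.y₁ * ‖z.2 1‖ ^ 2 + P.y₂ * ‖z.2 0‖ ^ 2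

/-- The function `(1 - y) / (y₃ - y)`. -/
def kap (z : C4) : ℝ := (1 - P.yFun z) / (P.y₃ - P.yFun z)

/-- The complex 1-form `dzᵢ`, for `i = 0, 1`. -/
def dz (i : Fin 2) : C4 →L[ℝ] ℂ :=
  (ContinuousLinearMap.proj i).comp (ContinuousLinearMap.fst ℝ (Fin 2 → ℂ) (Fin 2 → ℂ))

/-- The complex 1-form `dz_{2+j}`, for `j = 0, 1`. -/
def dz' (j : Fin 2) : C4 →L[ℝ] ℂ :=
  (ContinuousLinearMap.proj j).comp (ContinuousLinearMap.snd ℝ (Fin 2 → ℂ) (Fin 2 → ℂ))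

/-- The 1-form `|z₀|² dθ₀ + |z₁|² dθ₁ = Im(z̄₀ dz₀ + z̄₁ dz₁)`. -/
def formA (z : C4) : C4 →L[ℝ] ℝ :=
  Complex.imCLM.comp (conj (z.1 0) • dz 0 + conj (z.1 1) • dz 1)

/-- The 1-form `|z_{2+j}|² dθ_{2+j} = Im(z̄_{2+j} dz_{2+j})`. -/
def formB (j : Fin 2) (z : C4) : C4 →L[ℝ] ℝ :=
  Complex.imCLM.comp (conj (z.2 j) • dz' j)

/-- The contact form on `ℂ⁴`. -/
def etaC (z : C4) : C4 →L[ℝ] ℝ :=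
  (4 / 3 * (1 - P.yFun z)) • formA z +
    (2 / 3 * (P.y₂ - P.y₁)) • (P.y₂⁻¹ • formB 1 z - P.y₁⁻¹ • formB 0 z)

/-- Its exterior derivative, `dη(v, w) = D_v η(w) - D_w η(v)`. -/
def omegaC (z : C4) : C4 →L[ℝ] C4 →L[ℝ] ℝ :=
  fderiv ℝ P.etaC z - (fderiv ℝ P.etaC z).flip

/-- The complex 1-form `z₁ dz₀ - z₀ dz₁`. -/
def tauC (z : C4) : C4 →L[ℝ] ℂ := z.1 1 • dz 0 - z.1 0 • dz 1

/-- The complex 1-form `κ (z₃ dz₂ - z₂ dz₃) + i z₂ z₃ (c (B₂/(y₃ - y₁) + B₃/(y₃ - y₂)) - 2/3 (y₂ - y₁) A)`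
with `κ = (1 - y)/(y₃ - y)` and `c = (y₂ - y₁)(y₃ - 1)/(y₃ - y)`. Where `z₂ z₃ ≠ 0` it equals
`√κ` times `z₂ z₃ / |z₂ z₃|` times `dy / √(w r) + i √(w r) / 6 (dβ + cos θ dφ)`. -/
def chiC (z : C4) : C4 →L[ℝ] ℂ :=
  (P.kap z : ℂ) • (z.2 1 • dz' 0 - z.2 0 • dz' 1) +
    (Complex.I * z.2 0 * z.2 1) • Complex.ofRealCLM.comp
      (((P.y₂ - P.y₁) * (P.y₃ - 1) / (P.y₃ - P.yFun z)) •
          ((P.y₃ - P.y₁)⁻¹ • formB 0 z + (P.y₃ - P.y₂)⁻¹ • formB 1 z)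
        - (2 / 3 * (P.y₂ - P.y₁)) • formA z)

/-- The square of a real 1-form, as a symmetric bilinear form. -/
def sq (a : C4 →L[ℝ] ℝ) : C4 →L[ℝ] C4 →L[ℝ] ℝ := a.smulRight a

/-- The Hermitian square `(v, w) ↦ Re (a(v) conj (a(w)))` of a complex 1-form. -/
def hsq (a : C4 →L[ℝ] ℂ) : C4 →L[ℝ] C4 →L[ℝ] ℝ :=
  sq (Complex.reCLM.comp a) + sq (Complex.imCLM.comp a)

/-- The metric on `ℂ⁴` (degenerate along the circle orbits and the radial directions):
`4 (2/3 (1 - y) |z₁ dz₀ - z₀ dz₁|² + |χ|²/κ) + η²`. -/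
def metricC (z : C4) : C4 →L[ℝ] C4 →L[ℝ] ℝ :=
  (8 / 3 * (1 - P.yFun z)) • hsq (tauC z) + (4 / P.kap z) • hsq (P.chiC z) + sq (P.etaC z)

/-- The representative in `S³ × S³ ⊆ ℂ⁴` of a point of `Y^{p,q}` given by the preferred chart. -/
def rep (m : P.Y) : C4 := P.slice (P.idx m) (P.chart (P.idx m) m)

/-- The lift of tangent vectors of `Y^{p,q}` at `m` to tangent vectors of `S³ × S³` at `rep m`:
the tangent space at `m` is the model space of the preferred chart at `m`, whose inverse is the
projection of the slice. -/
def lift (m : P.Y) : E5 →L[ℝ] C4 :=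
  fderiv ℝ (P.slice (P.idx m)) (P.chart (P.idx m) m)

/-- The action of `exp(is)`, `exp(it)` on `z₂`, `z₃`. -/
def rotS (s t : ℝ) (z : S3S3) : S3S3 :=
  ⟨(z.1.1, ![Circle.exp s * z.1.2 0, Circle.exp t * z.1.2 1]), by
    simpa using z.2⟩

/-- The induced action on `Y^{p,q}`. -/
def rotY (s t : ℝ) : P.Y → P.Y :=
  Quotient.map (sa := P.orbitSetoid) (sb := P.orbitSetoid) (rotS s t) (by
    rintro z w ⟨ζ, h⟩
    refine ⟨ζ, ?_⟩
    simp only [rotS, ← h, act]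
    refine Prod.ext rfl ?_
    funext k
    fin_cases k <;> simp <;> ring)

/-- The flow of the Reeb vector field: `z₂`, `z₃` rotate with speeds `-3y₁ / (2(y₂ - y₁))` and
`3y₂ / (2(y₂ - y₁))`. -/
def reebFlow (t : ℝ) : P.Y → P.Y :=
  P.rotY (t * (-3 * P.y₁ / (2 * (P.y₂ - P.y₁)))) (t * (3 * P.y₂ / (2 * (P.y₂ - P.y₁))))

/-- The Reeb vector field. -/
def reeb (m : P.Y) : TangentSpace 𝓘(ℝ, E5) m :=
  mfderiv 𝓘(ℝ, ℝ) 𝓘(ℝ, E5) (fun t : ℝ => P.reebFlow t m) 0 (1 : ℝ)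

end YParam

/-! ## Transverse geometry of contact metric 5-manifolds -/

/-- The tensor fields of a contact metric structure on `M`: the Reeb vector field `ξ`, the contact
form `η`, the 2-form `dη` and the metric `g`. (The endomorphism `Φ` is determined by
`dη(X, Y) = g(X, Φ Y)` and `Φ ξ = 0`.) -/
structure ContactMetricData (E M : Type*) [NormedAddCommGroup E] [NormedSpace ℝ E]
    [TopologicalSpace M] [ChartedSpace E M] where
  ξ : ∀ x : M, TangentSpace 𝓘(ℝ, E) x
  η : ∀ x : M, TangentSpace 𝓘(ℝ, E) x →L[ℝ] ℝ
  dη : ∀ x : M, TangentSpace 𝓘(ℝ, E) x →L[ℝ] TangentSpace 𝓘(ℝ, E) x →L[ℝ] ℝ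
  g : ∀ x : M, TangentSpace 𝓘(ℝ, E) x →L[ℝ] TangentSpace 𝓘(ℝ, E) x →L[ℝ] ℝ

namespace ContactMetricData

variable {E M : Type*} [NormedAddCommGroup E] [NormedSpace ℝ E]
  [TopologicalSpace M] [ChartedSpace E M] (C : ContactMetricData E M)

/-- A vector field is smooth at a point. -/
def SmoothFieldAt [IsManifold 𝓘(ℝ, E) 1 M] (X : ∀ x : M, TangentSpace 𝓘(ℝ, E) x) (x : M) : Prop :=
  ContMDiffAt 𝓘(ℝ, E) (𝓘(ℝ, E).tangent) ∞ (fun y => (⟨y, X y⟩ : TangentBundle 𝓘(ℝ, E) M)) x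

/-- The derivative of the function `f` at `x` in the direction `v`. -/
def dirDeriv (f : M → ℝ) (x : M) (v : TangentSpace 𝓘(ℝ, E) x) : ℝ :=
  mfderiv 𝓘(ℝ, E) 𝓘(ℝ, ℝ) f x v

/-- The right-hand side of the Koszul formula for `2 g(∇_X Y, Z)` at `x`. -/
def koszul (X Y Z : ∀ x : M, TangentSpace 𝓘(ℝ, E) x) (x : M) : ℝ :=
  dirDeriv (fun y => C.g y (Y y) (Z y)) x (X x) + dirDeriv (fun y => C.g y (X y) (Z y)) x (Y x)
    - dirDeriv (fun y => C.g y (X y) (Y y)) x (Z x)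
    + C.g x (VectorField.mlieBracket 𝓘(ℝ, E) X Y x) (Z x)
    - C.g x (VectorField.mlieBracket 𝓘(ℝ, E) X Z x) (Y x)
    - C.g x (VectorField.mlieBracket 𝓘(ℝ, E) Y Z x) (X x)

/-- The Levi-Civita connection of `g`: `∇_X Y` at `x` is the vector determined by the Koszul
formula. -/
def leviCivita [IsManifold 𝓘(ℝ, E) 1 M] (X Y : ∀ x : M, TangentSpace 𝓘(ℝ, E) x) (x : M) :
    TangentSpace 𝓘(ℝ, E) x :=
  Classical.epsilon fun v => ∀ Z : ∀ x : M, TangentSpace 𝓘(ℝ, E) x, SmoothFieldAt Z x →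
    2 * C.g x v (Z x) = C.koszul X Y Z x

/-- The projection `TM → H = ker η` along the Reeb vector field. -/
def hor (x : M) (v : TangentSpace 𝓘(ℝ, E) x) : TangentSpace 𝓘(ℝ, E) x := v - C.η x v • C.ξ x

/-- The transverse Levi-Civita connection on `H`: for a section `Y` of `H`, `∇̄_X Y` is the
`H`-component of `∇_X Y` for `X` in `H`, and `∇̄_ξ Y` is the `H`-component of `[ξ, Y]` (so that
fields projectable to the leaf space of `ξ` are parallel along `ξ`). -/
def transverseLC [IsManifold 𝓘(ℝ, E) 1 M] (X Y : ∀ x : M, TangentSpace 𝓘(ℝ, E) x) (x : M) :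
    TangentSpace 𝓘(ℝ, E) x :=
  C.hor x (C.leviCivita (fun y => C.hor y (X y)) Y x)
    + C.η x (X x) • C.hor x (VectorField.mlieBracket 𝓘(ℝ, E) C.ξ Y x)

/-- `e₀, …, e₃` is an oriented orthonormal basis of `H` at `x`; the orientation of `H` is the one
given by `dη ∧ dη`. -/
structure IsOrientedFrame (x : M) (e : Fin 4 → TangentSpace 𝓘(ℝ, E) x) : Prop where
  horizontal : ∀ i, C.η x (e i) = 0
  orthonormal : ∀ i j, C.g x (e i) (e j) = if i = j then 1 else 0
  oriented : 0 < C.dη x (e 0) (e 1) * C.dη x (e 2) (e 3) - C.dη x (e 0) (e 2) * C.dη x (e 1) (e 3)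
    + C.dη x (e 0) (e 3) * C.dη x (e 1) (e 2)

/-- The fibre at `x` of `∧⁻H*`: the 2-forms `α` with `i_ξ α = 0` whose restriction to `H` is
anti-self-dual, that is `α(e₀, e₁) = -α(e₂, e₃)` in every oriented orthonormal basis of `H`. -/
def asd (x : M) : Submodule ℝ (TangentSpace 𝓘(ℝ, E) x [⋀^Fin 2]→L[ℝ] ℝ) where
  carrier := {α | (∀ v, α ![C.ξ x, v] = 0) ∧
    ∀ e, C.IsOrientedFrame x e → α ![e 0, e 1] = -α ![e 2, e 3]}
  zero_mem' := by constructor <;> intros <;> simp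
  add_mem' := by
    rintro α β ⟨h1, h2⟩ ⟨h1', h2'⟩
    refine ⟨fun v => ?_, fun e he => ?_⟩
    · simp [h1 v, h1' v]
    · simp only [ContinuousAlternatingMap.add_apply, h2 e he, h2' e he]; ring
  smul_mem' := by
    rintro c α ⟨h1, h2⟩
    refine ⟨fun v => ?_, fun e he => ?_⟩
    · simp [h1 v]
    · simp only [ContinuousAlternatingMap.smul_apply, h2 e he, smul_neg]

/-- A section of `∧⁻H*` is smooth at a point. -/
def SmoothFormAt [IsManifold 𝓘(ℝ, E) 1 M] (α : ∀ x : M, C.asd x) (x : M) : Prop :=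
  ∀ X Y : ∀ x : M, TangentSpace 𝓘(ℝ, E) x, SmoothFieldAt X x → SmoothFieldAt Y x →
    ContMDiffAt 𝓘(ℝ, E) 𝓘(ℝ, ℝ) ∞ (fun y => (α y).1 ![X y, Y y]) x

/-- `β` is the value at `x` of `∇̄_X α`, for the connection on `∧⁻H*` induced by the transverse
Levi-Civita connection:
`(∇̄_X α)(Y, Z) = X(α(Y, Z)) - α(∇̄_X Y, Z) - α(Y, ∇̄_X Z)` for sections `Y`, `Z` of `H`. -/
def HasCovDerivAt [IsManifold 𝓘(ℝ, E) 1 M] (α : ∀ x : M, C.asd x)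
    (X : ∀ x : M, TangentSpace 𝓘(ℝ, E) x) (x : M) (β : C.asd x) : Prop :=
  ∀ Y Z : ∀ x : M, TangentSpace 𝓘(ℝ, E) x,
    (∀ y, C.η y (Y y) = 0) → (∀ y, C.η y (Z y) = 0) → SmoothFieldAt Y x → SmoothFieldAt Z x →
      β.1 ![Y x, Z x] = dirDeriv (fun y => (α y).1 ![Y y, Z y]) x (X x)
        - (α x).1 ![C.transverseLC X Y x, Z x] - (α x).1 ![Y x, C.transverseLC X Z x]

/-- A gauge transformation of the `SO(3)`-bundle `∧⁻H*`: a smooth family of isometries of determinant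
`1` of the fibres (for the inner product of 2-forms defined by `g`). -/
structure GaugeTransformation [IsManifold 𝓘(ℝ, E) 1 M] where
  toFun : ∀ x : M, C.asd x →ₗ[ℝ] C.asd x
  isometry : ∀ (x : M) (α : C.asd x) (e : Fin 4 → TangentSpace 𝓘(ℝ, E) x),
    C.IsOrientedFrame x e →
      ∑ i, ∑ j, ((toFun x α).1 ![e i, e j]) ^ 2 = ∑ i, ∑ j, (α.1 ![e i, e j]) ^ 2
  det_eq_one : ∀ x : M, LinearMap.det (M := C.asd x) (A := ℝ) (toFun x) = 1
  smooth : ∀ (α : ∀ x : M, C.asd x) (x : M), C.SmoothFormAt α x →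
    C.SmoothFormAt (fun y => toFun y (α y)) x

/-- A gauge transformation `u` of `∧⁻H*` is covariantly constant for the transverse Levi-Civita
connection: `∇̄_X (u α) = u (∇̄_X α)`. -/
def GaugeTransformation.IsParallel [IsManifold 𝓘(ℝ, E) 1 M] {C : ContactMetricData E M}
    (u : C.GaugeTransformation) : Prop :=
  ∀ (x : M) (X : ∀ x : M, TangentSpace 𝓘(ℝ, E) x) (α : ∀ x : M, C.asd x) (β : C.asd x),
    SmoothFieldAt X x → C.SmoothFormAt α x → C.HasCovDerivAt α X x β →
      C.HasCovDerivAt (fun y => u.toFun y (α y)) X x (u.toFun x β)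

/-- The transverse Levi-Civita connection on `∧⁻H*` is irreducible: the group of covariantly constant
gauge transformations is the centre of the structure group `SO(3)`, which is trivial. -/
def TransverseLCIrreducible [IsManifold 𝓘(ℝ, E) 1 M] : Prop :=
  ∀ u : C.GaugeTransformation, u.IsParallel → ∀ (x : M) (α : C.asd x), u.toFun x α = α

end ContactMetricData

/-- The contact metric structure of `Y^{p,q}`. -/
def YParam.contactMetric (P : YParam) : ContactMetricData E5 P.Y where
  ξ := P.reeb
  η m := ((P.etaC (P.rep m)).comp (P.lift m) : E5 →L[ℝ] ℝ)
  dη m := ((P.omegaC (P.rep m)).bilinearComp (P.lift m) (P.lift m) : E5 →L[ℝ] E5 →L[ℝ] ℝ)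
  g m := ((P.metricC (P.rep m)).bilinearComp (P.lift m) (P.lift m) : E5 →L[ℝ] E5 →L[ℝ] ℝ)

end

/-! A parallel gauge transformation commutes at every point with the curvature of the induced
connection on `∧⁻H*`. The fibre is a Euclidean `ℝ³`. At a point where two curvature values are
non-zero rotations in different planes, these generate `so(3)`; by Schur's lemma the transformation
is there a scalar `s`, and determinant one gives `s³ = 1`, so `s = 1`. By continuity it suffices
that such points are dense.

Coprimality together with `(p, q) ≠ (1, 0)` gives `q > 0`, hence `y₁ < 0 < y₂`. Where no `zₖ`
vanishes there are local coordinates `(x, φ, y, β, ψ)` with `x = cos θ` (`exists_isToric`), and the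
metric is explicit. Only the horizontal fields `∂/∂x`, `∂/∂y` and `∂/∂β - y ∂/∂ψ` are needed. The
first commutes with the other two, so the two curvature values involving it carry no bracket term
(`commute_curvature`). In a frame of `∧⁻H*` scaled so as to avoid square roots, the connection
matrices `toricConn` are rational in `x, y, k, k'`. The two curvature values are rotations in the
planes of the frame elements `0, 1` and `0, 2`, with coefficients that are multiples of `F(y) =
k'(y) (1 - y) + k(y)` (`curvature_xy`, `curvature_xbeta`). This settles all points with toric
coordinates where `F ≠ 0` (`IsToric.gauge_eq`).

Since `(1 - y) F(y) = 4((1 - y)³ - (1 - a))`, the factor `F` has at most one zero with `y < 1`.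
Every point is therefore a limit of points with all `zₖ ≠ 0` and `F ≠ 0`
(`eventually_curvFactor_ne_zero`), and smooth local sections carry the identity `u α = α` to the
limit (`gauge_eq_of_frequently`).

The tensors on the quotient are given by forms on `ℂ⁴`. The forms `η`, `τ`, `χ` vanish on the
generator of the circle and are equivariant up to phases, and `dη` is a combination of `τ̄ ∧ τ` and
`χ̄ ∧ χ` (`omegaC_eq`). Consequently `g`, `η`, `dη` can be computed from any local lift to `S³ × S³`
(`IsLift.forms`), and `eq_smul_gen` gives non-degeneracy. -/

noncomputable section

/-! ## Smooth local coordinates -/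

/-- Smooth coordinates on an open subset of `M` with values in a normed space `E'`. -/
structure LocalCoord (E E' M : Type*) [NormedAddCommGroup E] [NormedSpace ℝ E]
    [NormedAddCommGroup E'] [NormedSpace ℝ E'] [TopologicalSpace M] [ChartedSpace E M]
    extends OpenPartialHomeomorph M E' where
  smooth_toFun : ContMDiffOn 𝓘(ℝ, E) 𝓘(ℝ, E') ∞ toOpenPartialHomeomorph source
  smooth_invFun : ContMDiffOn 𝓘(ℝ, E') 𝓘(ℝ, E) ∞ toOpenPartialHomeomorph.symm target

namespace LocalCoord

variable {E E' M : Type*} [NormedAddCommGroup E] [NormedSpace ℝ E]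
    [NormedAddCommGroup E'] [NormedSpace ℝ E'] [TopologicalSpace M] [ChartedSpace E M]
    (Θ : LocalCoord E E' M)

/-- The local parametrization inverse to the coordinates. -/
def param : E' → M := Θ.toOpenPartialHomeomorph.symm

/-- The coordinate functions. -/
def coords : M → E' := Θ.toOpenPartialHomeomorph

/-- The derivative of the local parametrization. -/
def dparam (q : E') : E' →L[ℝ] TangentSpace 𝓘(ℝ, E) (Θ.param q) :=
  mfderiv 𝓘(ℝ, E') 𝓘(ℝ, E) Θ.param q

/-- The expression of a vector field in the coordinates. -/
def hat (V : ∀ x : M, TangentSpace 𝓘(ℝ, E) x) : E' → E' :=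
  VectorField.mpullback 𝓘(ℝ, E') 𝓘(ℝ, E) Θ.param V

open Classical in
/-- The vector field with given expression in the coordinates, extended by zero. -/
def push (v : E' → E') (x : M) : TangentSpace 𝓘(ℝ, E) x :=
  if x ∈ Θ.source then VectorField.mpullback 𝓘(ℝ, E) 𝓘(ℝ, E') Θ.coords v x else 0

variable {Θ}

lemma param_mem {q : E'} (hq : q ∈ Θ.target) : Θ.param q ∈ Θ.source := Θ.map_target hq

lemma coords_param {q : E'} (hq : q ∈ Θ.target) : Θ.coords (Θ.param q) = q := Θ.right_inv hq

lemma param_coords {x : M} (hx : x ∈ Θ.source) : Θ.param (Θ.coords x) = x := Θ.left_inv hx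

lemma coords_mem {x : M} (hx : x ∈ Θ.source) : Θ.coords x ∈ Θ.target := Θ.map_source hx

lemma contMDiffAt_param {q : E'} (hq : q ∈ Θ.target) :
    ContMDiffAt 𝓘(ℝ, E') 𝓘(ℝ, E) ∞ Θ.param q :=
  Θ.smooth_invFun.contMDiffAt (Θ.open_target.mem_nhds hq)

lemma contMDiffAt_coords {x : M} (hx : x ∈ Θ.source) :
    ContMDiffAt 𝓘(ℝ, E) 𝓘(ℝ, E') ∞ Θ.coords x :=
  Θ.smooth_toFun.contMDiffAt (Θ.open_source.mem_nhds hx)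

lemma mdifferentiableAt_param {q : E'} (hq : q ∈ Θ.target) :
    MDifferentiableAt 𝓘(ℝ, E') 𝓘(ℝ, E) Θ.param q :=
  (contMDiffAt_param hq).mdifferentiableAt (by simp)

lemma mdifferentiableAt_coords {x : M} (hx : x ∈ Θ.source) :
    MDifferentiableAt 𝓘(ℝ, E) 𝓘(ℝ, E') Θ.coords x :=
  (contMDiffAt_coords hx).mdifferentiableAt (by simp)

/-- The derivative of the coordinates at the point with coordinates `q`. -/
def dcoords (Θ : LocalCoord E E' M) (q : E') : TangentSpace 𝓘(ℝ, E) (Θ.param q) →L[ℝ] E' :=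
  mfderiv 𝓘(ℝ, E) 𝓘(ℝ, E') Θ.coords (Θ.param q)

lemma dcoords_comp_dparam {q : E'} (hq : q ∈ Θ.target) :
    (Θ.dcoords q).comp (Θ.dparam q) = ContinuousLinearMap.id ℝ E' := by
  have h := mfderiv_comp q (mdifferentiableAt_coords (param_mem hq)) (mdifferentiableAt_param hq)
  have h2 : mfderiv 𝓘(ℝ, E') 𝓘(ℝ, E') (Θ.coords ∘ Θ.param) q
      = mfderiv 𝓘(ℝ, E') 𝓘(ℝ, E') id q := by
    apply Filter.EventuallyEq.mfderiv_eq
    filter_upwards [Θ.open_target.mem_nhds hq] with q' hq' using coords_param hq'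
  rw [h2, mfderiv_id] at h
  exact h.symm

lemma dparam_comp_dcoords {q : E'} (hq : q ∈ Θ.target) :
    (Θ.dparam q).comp (Θ.dcoords q) = ContinuousLinearMap.id ℝ _ := by
  have h0 : Θ.coords (Θ.param q) = q := coords_param hq
  have h := mfderiv_comp (Θ.param q) (g := Θ.param) (f := Θ.coords) (I' := 𝓘(ℝ, E'))
    (I := 𝓘(ℝ, E)) (I'' := 𝓘(ℝ, E))
    (by rw [h0]; exact mdifferentiableAt_param hq) (mdifferentiableAt_coords (param_mem hq))
  have h2 : mfderiv 𝓘(ℝ, E) 𝓘(ℝ, E) (Θ.param ∘ Θ.coords) (Θ.param q)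
      = mfderiv 𝓘(ℝ, E) 𝓘(ℝ, E) id (Θ.param q) := by
    apply Filter.EventuallyEq.mfderiv_eq
    filter_upwards [Θ.open_source.mem_nhds (param_mem hq)] with x hx using param_coords hx
  rw [h2, mfderiv_id] at h
  -- The base points `Θ.coords (Θ.param q)` and `q` agree only propositionally, so the two
  -- derivatives are compared as maps into the model space.
  have key : ∀ q' : E', q' = q → ∀ w : E',
      (Θ.dparam q' : E' →L[ℝ] E) w = (Θ.dparam q : E' →L[ℝ] E) w := by
    rintro _ rfl _; rfl
  ext v
  exact (key _ h0 _).symm.trans (DFunLike.congr_fun h v).symm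

lemma dcoords_dparam {q : E'} (hq : q ∈ Θ.target) (v : E') : Θ.dcoords q (Θ.dparam q v) = v :=
  DFunLike.congr_fun (dcoords_comp_dparam hq) v

lemma dparam_dcoords {q : E'} (hq : q ∈ Θ.target) (v : TangentSpace 𝓘(ℝ, E) (Θ.param q)) :
    Θ.dparam q (Θ.dcoords q v) = v :=
  DFunLike.congr_fun (dparam_comp_dcoords hq) v

lemma hat_apply {q : E'} (hq : q ∈ Θ.target) (V : ∀ x : M, TangentSpace 𝓘(ℝ, E) x) :
    Θ.hat V q = Θ.dcoords q (V (Θ.param q)) := by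
  have h1 := dparam_comp_dcoords hq
  have h2 := dcoords_comp_dparam hq
  have h : (mfderiv 𝓘(ℝ, E') 𝓘(ℝ, E) Θ.param q).inverse = Θ.dcoords q :=
    ContinuousLinearMap.inverse_eq h1 h2
  exact DFunLike.congr_fun h _

lemma dparam_hat {q : E'} (hq : q ∈ Θ.target) (V : ∀ x : M, TangentSpace 𝓘(ℝ, E) x) :
    Θ.dparam q (Θ.hat V q) = V (Θ.param q) := by
  rw [hat_apply hq, dparam_dcoords hq]

lemma isInvertible_dparam {q : E'} (hq : q ∈ Θ.target) :
    (mfderiv 𝓘(ℝ, E') 𝓘(ℝ, E) Θ.param q).IsInvertible := by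
  have h1 := dparam_comp_dcoords hq
  have h2 := dcoords_comp_dparam hq
  exact .of_inverse h1 h2

lemma isInvertible_dcoords {q : E'} (hq : q ∈ Θ.target) :
    (mfderiv 𝓘(ℝ, E) 𝓘(ℝ, E') Θ.coords (Θ.param q)).IsInvertible := by
  have h1 := dparam_comp_dcoords hq
  have h2 := dcoords_comp_dparam hq
  exact .of_inverse h2 h1

lemma push_param {q : E'} (hq : q ∈ Θ.target) (v : E' → E') :
    Θ.push v (Θ.param q) = Θ.dparam q (v q) := by
  have h1 := dparam_comp_dcoords hq
  have h2 := dcoords_comp_dparam hq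
  have h : (mfderiv 𝓘(ℝ, E) 𝓘(ℝ, E') Θ.coords (Θ.param q)).inverse = Θ.dparam q :=
    ContinuousLinearMap.inverse_eq h2 h1
  rw [push, if_pos (param_mem hq)]
  refine (DFunLike.congr_fun h _).trans ?_
  exact congrArg (fun q' => Θ.dparam q (v q')) (coords_param hq)

lemma hat_push {q : E'} (hq : q ∈ Θ.target) (v : E' → E') : Θ.hat (Θ.push v) q = v q := by
  rw [hat_apply hq, push_param hq, dcoords_dparam hq]

lemma push_of_notMem {x : M} (hx : x ∉ Θ.source) (v : E' → E') : Θ.push v x = 0 := if_neg hx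

lemma mdifferentiableAt_of_comp_param {q : E'} (hq : q ∈ Θ.target) {f : M → ℝ}
    (hf : DifferentiableAt ℝ (f ∘ Θ.param) q) :
    MDifferentiableAt 𝓘(ℝ, E) 𝓘(ℝ, ℝ) f (Θ.param q) := by
  have h : MDifferentiableAt 𝓘(ℝ, E') 𝓘(ℝ, ℝ) (f ∘ Θ.param) (Θ.coords (Θ.param q)) := by
    rw [coords_param hq]; exact hf.mdifferentiableAt
  refine (h.comp _ (mdifferentiableAt_coords (param_mem hq))).congr_of_eventuallyEq ?_
  filter_upwards [Θ.open_source.mem_nhds (param_mem hq)] with x hx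
  simp [param_coords hx]

lemma dirDeriv_param {q : E'} (hq : q ∈ Θ.target) {f : M → ℝ}
    (hf : DifferentiableAt ℝ (f ∘ Θ.param) q) (v : E') :
    ContactMetricData.dirDeriv f (Θ.param q) (Θ.dparam q v) = fderiv ℝ (f ∘ Θ.param) q v := by
  have h := mfderiv_comp q (mdifferentiableAt_of_comp_param hq hf) (mdifferentiableAt_param hq)
  rw [mfderiv_eq_fderiv] at h
  rw [h]
  rfl

lemma contMDiffAt_of_comp_param {q : E'} (hq : q ∈ Θ.target) {f : M → ℝ}
    (hf : ContDiffAt ℝ ∞ (f ∘ Θ.param) q) :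
    ContMDiffAt 𝓘(ℝ, E) 𝓘(ℝ, ℝ) ∞ f (Θ.param q) := by
  have h : ContMDiffAt 𝓘(ℝ, E') 𝓘(ℝ, ℝ) ∞ (f ∘ Θ.param) (Θ.coords (Θ.param q)) := by
    rw [coords_param hq]; exact hf.contMDiffAt
  refine (h.comp _ (contMDiffAt_coords (param_mem hq))).congr_of_eventuallyEq ?_
  filter_upwards [Θ.open_source.mem_nhds (param_mem hq)] with x hx
  simp [param_coords hx]

lemma contDiffAt_comp_param {q : E'} (hq : q ∈ Θ.target) {f : M → ℝ}
    (hf : ContMDiffAt 𝓘(ℝ, E) 𝓘(ℝ, ℝ) ∞ f (Θ.param q)) :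
    ContDiffAt ℝ ∞ (f ∘ Θ.param) q :=
  (hf.comp q (contMDiffAt_param hq)).contDiffAt

lemma contDiffAt_hat [CompleteSpace E'] {q : E'} (hq : q ∈ Θ.target) {V : ∀ x : M, TangentSpace 𝓘(ℝ, E) x}
    [IsManifold 𝓘(ℝ, E) 1 M]
    (hV : ContactMetricData.SmoothFieldAt V (Θ.param q)) : ContDiffAt ℝ ∞ (Θ.hat V) q := by
  refine contMDiffAt_vectorSpace_iff_contDiffAt.mp ?_
  exact ContMDiffAt.mpullback_vectorField_preimage hV (contMDiffAt_param hq)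
    (isInvertible_dparam hq) (by rfl)

lemma smoothFieldAt_push [CompleteSpace E] {q : E'} (hq : q ∈ Θ.target) {v : E' → E'}
    [IsManifold 𝓘(ℝ, E) 1 M]
    (hv : ContDiffAt ℝ ∞ v q) : ContactMetricData.SmoothFieldAt (Θ.push v) (Θ.param q) := by
  replace hv := contMDiffAt_vectorSpace_iff_contDiffAt.mpr hv
  have := ContMDiffAt.mpullback_vectorField_preimage (I := 𝓘(ℝ, E)) (I' := 𝓘(ℝ, E'))
    (V := v) (f := Θ.coords) (x₀ := Θ.param q) (m := ∞) (by rw [coords_param hq]; exact hv)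
    (contMDiffAt_coords (param_mem hq)) (isInvertible_dcoords hq) (by rfl)
  refine this.congr_of_eventuallyEq ?_
  filter_upwards [Θ.open_source.mem_nhds (param_mem hq)] with x hx
  simp only [push, if_pos hx]

lemma hat_mlieBracket [IsManifold 𝓘(ℝ, E) ∞ M] [CompleteSpace E] [CompleteSpace E'] {q : E'} (hq : q ∈ Θ.target) {V W : ∀ x : M, TangentSpace 𝓘(ℝ, E) x}
    [IsManifold 𝓘(ℝ, E) 1 M]
    (hV : ContactMetricData.SmoothFieldAt V (Θ.param q))
    (hW : ContactMetricData.SmoothFieldAt W (Θ.param q)) :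
    Θ.hat (VectorField.mlieBracket 𝓘(ℝ, E) V W) q
      = VectorField.lieBracket ℝ (Θ.hat V) (Θ.hat W) q := by
  have : IsManifold 𝓘(ℝ, E) (minSmoothness ℝ 3) M := by
    rw [minSmoothness_of_isRCLikeNormedField]
    exact IsManifold.of_le (n := ∞) (WithTop.coe_le_coe.mpr le_top)
  have := VectorField.mpullback_mlieBracket (I := 𝓘(ℝ, E')) (I' := 𝓘(ℝ, E)) (f := Θ.param)
    (x₀ := q) (V := V) (W := W) (n := ∞) (hV.mdifferentiableAt (by simp))
    (hW.mdifferentiableAt (by simp)) (contMDiffAt_param hq)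
    (by rw [minSmoothness_of_isRCLikeNormedField]; exact WithTop.coe_le_coe.mpr le_top)
  refine Eq.trans this ?_
  rw [← VectorField.mlieBracketWithin_univ, VectorField.mlieBracketWithin_eq_lieBracketWithin]
  exact congrFun (VectorField.lieBracketWithin_univ (𝕜 := ℝ) (V := Θ.hat V) (W := Θ.hat W)) q

end LocalCoord

/-! ### The Levi-Civita connection in coordinates -/

namespace LocalCoord

variable {E E' M : Type*} [NormedAddCommGroup E] [NormedSpace ℝ E]
    [NormedAddCommGroup E'] [NormedSpace ℝ E'] [TopologicalSpace M] [ChartedSpace E M]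

/-- `G` is the expression of the metric of `C` in the coordinates `Θ`. -/
structure IsMetricExpr (Θ : LocalCoord E E' M) (C : ContactMetricData E M)
    (G : E' → E' →L[ℝ] E' →L[ℝ] ℝ) : Prop where
  eq : ∀ q ∈ Θ.target, ∀ v w, C.g (Θ.param q) (Θ.dparam q v) (Θ.dparam q w) = G q v w
  diff : ∀ q ∈ Θ.target, DifferentiableAt ℝ G q
  symm : ∀ q ∈ Θ.target, ∀ v w, G q v w = G q w v
  pos : ∀ q ∈ Θ.target, ∀ v, v ≠ 0 → 0 < G q v v

/-- The Christoffel symbols of the first kind of `G` (doubled), with arguments `u, v` in the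
lower indices. -/
def christoffel (G : E' → E' →L[ℝ] E' →L[ℝ] ℝ) (q u v w : E') : ℝ :=
  fderiv ℝ G q u v w + fderiv ℝ G q v u w - fderiv ℝ G q w u v

variable {Θ : LocalCoord E E' M} {C : ContactMetricData E M} {G : E' → E' →L[ℝ] E' →L[ℝ] ℝ}

lemma fderiv_bilinear_apply {B : E' → E' →L[ℝ] E' →L[ℝ] ℝ} {Y Z : E' → E'} {q : E'}
    (hB : DifferentiableAt ℝ B q) (hY : DifferentiableAt ℝ Y q) (hZ : DifferentiableAt ℝ Z q)
    (x : E') :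
    DifferentiableAt ℝ (fun q' => B q' (Y q') (Z q')) q ∧
    fderiv ℝ (fun q' => B q' (Y q') (Z q')) q x
      = fderiv ℝ B q x (Y q) (Z q) + B q (fderiv ℝ Y q x) (Z q) + B q (Y q) (fderiv ℝ Z q x) := by
  have h := (hB.hasFDerivAt.clm_apply hY.hasFDerivAt).clm_apply hZ.hasFDerivAt
  refine ⟨h.differentiableAt, ?_⟩
  rw [h.fderiv]
  simp
  ring

lemma IsMetricExpr.dirDeriv_metric (hG : Θ.IsMetricExpr C G) {q : E'} (hq : q ∈ Θ.target)
    {X Y Z : ∀ x : M, TangentSpace 𝓘(ℝ, E) x}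
    (hY : DifferentiableAt ℝ (Θ.hat Y) q) (hZ : DifferentiableAt ℝ (Θ.hat Z) q) :
    ContactMetricData.dirDeriv (fun y => C.g y (Y y) (Z y)) (Θ.param q) (X (Θ.param q))
      = fderiv ℝ G q (Θ.hat X q) (Θ.hat Y q) (Θ.hat Z q)
        + G q (fderiv ℝ (Θ.hat Y) q (Θ.hat X q)) (Θ.hat Z q)
        + G q (Θ.hat Y q) (fderiv ℝ (Θ.hat Z) q (Θ.hat X q)) := by
  obtain ⟨h1, h2⟩ := fderiv_bilinear_apply (hG.diff q hq) hY hZ (Θ.hat X q)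
  have e : (fun y => C.g y (Y y) (Z y)) ∘ Θ.param
      =ᶠ[𝓝 q] fun q' => G q' (Θ.hat Y q') (Θ.hat Z q') := by
    filter_upwards [Θ.open_target.mem_nhds hq] with q' hq'
    rw [Function.comp_apply, ← hG.eq q' hq', dparam_hat hq', dparam_hat hq']
  rw [← dparam_hat hq X, dirDeriv_param hq (h1.congr_of_eventuallyEq e), e.fderiv_eq, h2]

/-- Positive definiteness makes `v ↦ G q v ·` injective, hence onto the dual space in finite
dimension. This supplies the vector demanded by the Koszul formula. -/
lemma IsMetricExpr.exists_repr [FiniteDimensional ℝ E'] (hG : Θ.IsMetricExpr C G) {q : E'}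
    (hq : q ∈ Θ.target) (f : E' →ₗ[ℝ] ℝ) : ∃ v, ∀ w, G q v w = f w := by
  let L : E' →ₗ[ℝ] Module.Dual ℝ E' :=
    LinearMap.mk₂ ℝ (fun v w => G q v w) (by simp) (by simp) (by simp) (by simp)
  have inj : Function.Injective L := by
    rw [injective_iff_map_eq_zero]
    intro v hv
    by_contra h
    have := hG.pos q hq v h
    have h0 : L v v = 0 := by rw [hv]; rfl
    exact this.ne' h0
  have surj : Function.Surjective L :=
    (LinearMap.injective_iff_surjective_of_finrank_eq_finrank
      (Subspace.dual_finrank_eq (K := ℝ) (V := E')).symm).mp inj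
  obtain ⟨v, hv⟩ := surj f
  exact ⟨v, fun w => DFunLike.congr_fun hv w⟩

variable [IsManifold 𝓘(ℝ, E) ∞ M] [CompleteSpace E] [CompleteSpace E'] [IsManifold 𝓘(ℝ, E) 1 M]

/-- The product rule produces derivatives of the components of all three fields; those of `X` and
`Z` cancel against the brackets, those of `Y` add up to the factor `2`. -/
lemma IsMetricExpr.koszul_param (hG : Θ.IsMetricExpr C G) {q : E'} (hq : q ∈ Θ.target)
    {X Y Z : ∀ x : M, TangentSpace 𝓘(ℝ, E) x}
    (hX : ContactMetricData.SmoothFieldAt X (Θ.param q))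
    (hY : ContactMetricData.SmoothFieldAt Y (Θ.param q))
    (hZ : ContactMetricData.SmoothFieldAt Z (Θ.param q)) :
    C.koszul X Y Z (Θ.param q)
      = 2 * G q (fderiv ℝ (Θ.hat Y) q (Θ.hat X q)) (Θ.hat Z q)
        + christoffel G q (Θ.hat X q) (Θ.hat Y q) (Θ.hat Z q) := by
  have dX := (contDiffAt_hat hq hX).differentiableAt (by simp)
  have dY := (contDiffAt_hat hq hY).differentiableAt (by simp)
  have dZ := (contDiffAt_hat hq hZ).differentiableAt (by simp)
  have br : ∀ {U V W : ∀ x : M, TangentSpace 𝓘(ℝ, E) x},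
      ContactMetricData.SmoothFieldAt U (Θ.param q) →
      ContactMetricData.SmoothFieldAt V (Θ.param q) →
      C.g (Θ.param q) (VectorField.mlieBracket 𝓘(ℝ, E) U V (Θ.param q)) (W (Θ.param q))
        = G q (fderiv ℝ (Θ.hat V) q (Θ.hat U q)) (Θ.hat W q)
          - G q (fderiv ℝ (Θ.hat U) q (Θ.hat V q)) (Θ.hat W q) := by
    intro U V W hU hV
    rw [← dparam_hat hq W, ← dparam_hat hq (VectorField.mlieBracket 𝓘(ℝ, E) U V), hG.eq q hq,
      hat_mlieBracket hq hU hV, VectorField.lieBracket]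
    simp
  rw [ContactMetricData.koszul, hG.dirDeriv_metric hq dY dZ, hG.dirDeriv_metric hq dX dZ,
    hG.dirDeriv_metric hq dX dY, br hX hY, br hX hZ, br hY hZ, christoffel]
  have s := hG.symm q hq
  rw [s (Θ.hat Y q), s (Θ.hat X q) (fderiv ℝ (Θ.hat Z) q (Θ.hat Y q)),
    s (Θ.hat X q) (fderiv ℝ (Θ.hat Y) q (Θ.hat Z q))]
  ring

lemma IsMetricExpr.leviCivita_param [FiniteDimensional ℝ E'] (hG : Θ.IsMetricExpr C G) {q : E'}
    (hq : q ∈ Θ.target) {X Y : ∀ x : M, TangentSpace 𝓘(ℝ, E) x}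
    (hX : ContactMetricData.SmoothFieldAt X (Θ.param q))
    (hY : ContactMetricData.SmoothFieldAt Y (Θ.param q)) (w : E') :
    2 * G q (Θ.dcoords q (C.leviCivita X Y (Θ.param q))) w
      = 2 * G q (fderiv ℝ (Θ.hat Y) q (Θ.hat X q)) w
        + christoffel G q (Θ.hat X q) (Θ.hat Y q) w := by
  -- `leviCivita` is a choice by `epsilon`: its defining property is available only after some
  -- vector has been shown to satisfy the Koszul formula for all smooth `Z`.
  have hex : ∃ v : TangentSpace 𝓘(ℝ, E) (Θ.param q), ∀ Z : ∀ x : M, TangentSpace 𝓘(ℝ, E) x,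
      ContactMetricData.SmoothFieldAt Z (Θ.param q) →
      2 * C.g (Θ.param q) v (Z (Θ.param q)) = C.koszul X Y Z (Θ.param q) := by
    let f : E' →ₗ[ℝ] ℝ := (1 / 2 : ℝ) •
      (2 • (G q (fderiv ℝ (Θ.hat Y) q (Θ.hat X q))).toLinearMap
        + (fderiv ℝ G q (Θ.hat X q) (Θ.hat Y q)).toLinearMap
        + (fderiv ℝ G q (Θ.hat Y q) (Θ.hat X q)).toLinearMap
        - (((fderiv ℝ G q).flip (Θ.hat X q)).flip (Θ.hat Y q)).toLinearMap)
    obtain ⟨v, hv⟩ := hG.exists_repr hq f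
    refine ⟨Θ.dparam q v, fun Z hZ => ?_⟩
    rw [hG.koszul_param hq hX hY hZ, ← dparam_hat hq Z, hG.eq q hq, hv]
    simp [f, christoffel]
    ring
  have spec := Classical.epsilon_spec hex
  -- Testing with the field of constant coordinate expression `w` turns the property for fields into
  -- one for vectors.
  have hs := smoothFieldAt_push (E := E) hq (v := fun _ => w) contDiffAt_const
  have h := spec (Θ.push fun _ => w) hs
  rw [hG.koszul_param hq hX hY hs, hat_push hq, push_param hq] at h
  rw [← h, ← hG.eq q hq, dparam_dcoords hq]
  rfl

end LocalCoord

/-! ### Alternating forms and the projection to `H` -/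

namespace ContactMetricData

variable {E M : Type*} [NormedAddCommGroup E] [NormedSpace ℝ E]
    [TopologicalSpace M] [ChartedSpace E M] {C : ContactMetricData E M}

lemma alternating_swap {T : Type*} [AddCommGroup T] [Module ℝ T] [TopologicalSpace T]
    (α : T [⋀^Fin 2]→L[ℝ] ℝ) (v w : T) : α ![v, w] = -α ![w, v] := by
  have h := α.toAlternatingMap.map_swap ![v, w] (i := 0) (j := 1) (by decide)
  have e : ![v, w] ∘ Equiv.swap (0 : Fin 2) 1 = ![w, v] := by
    funext i; fin_cases i <;> simp
  rw [e] at h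
  have h' : α ![w, v] = - α ![v, w] := h
  rw [h']; ring

lemma alternating_add_left {T : Type*} [AddCommGroup T] [Module ℝ T] [TopologicalSpace T]
    (α : T [⋀^Fin 2]→L[ℝ] ℝ) (u v w : T) : α ![u + v, w] = α ![u, w] + α ![v, w] :=
  α.toAlternatingMap.map_vecCons_add ![w] u v

lemma alternating_smul_left {T : Type*} [AddCommGroup T] [Module ℝ T] [TopologicalSpace T]
    (α : T [⋀^Fin 2]→L[ℝ] ℝ) (c : ℝ) (v w : T) : α ![c • v, w] = c * α ![v, w] :=
  α.toAlternatingMap.map_vecCons_smul ![w] c v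

/-- Forms in `∧⁻H*` are annihilated by `ξ`, so the projection to `H` in `transverseLC` is invisible
to them and the Levi-Civita derivative itself may be inserted. -/
lemma asd_hor_left {x : M} (α : C.asd x) (v w : TangentSpace 𝓘(ℝ, E) x) :
    α.1 ![C.hor x v, w] = α.1 ![v, w] := by
  rw [hor, sub_eq_add_neg, ← neg_smul, alternating_add_left, alternating_smul_left, α.2.1]
  ring

lemma asd_hor_right {x : M} (α : C.asd x) (v w : TangentSpace 𝓘(ℝ, E) x) :
    α.1 ![v, C.hor x w] = α.1 ![v, w] := by
  rw [alternating_swap, asd_hor_left, ← alternating_swap]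

end ContactMetricData

/-! ### The induced connection on `∧⁻H*` in coordinates -/

namespace LocalCoord

variable {E E' M : Type*} [NormedAddCommGroup E] [NormedSpace ℝ E]
    [NormedAddCommGroup E'] [NormedSpace ℝ E'] [TopologicalSpace M] [ChartedSpace E M]
    {Θ : LocalCoord E E' M} {C : ContactMetricData E M} {G : E' → E' →L[ℝ] E' →L[ℝ] ℝ}
    [CompleteSpace E] [IsManifold 𝓘(ℝ, E) 1 M]

/-- `e` and `r` are the expressions of the contact form and the Reeb field in the coordinates. -/
structure IsContactExpr (Θ : LocalCoord E E' M) (C : ContactMetricData E M)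
    (e : E' → E' →L[ℝ] ℝ) (r : E' → E') : Prop where
  eta : ∀ q ∈ Θ.target, ∀ v, C.η (Θ.param q) (Θ.dparam q v) = e q v
  xi : ∀ q ∈ Θ.target, C.ξ (Θ.param q) = Θ.dparam q (r q)
  eta_smooth : ∀ q ∈ Θ.target, ContDiffAt ℝ ∞ e q
  xi_smooth : ∀ q ∈ Θ.target, ContDiffAt ℝ ∞ r q
  eta_xi : ∀ q ∈ Θ.target, e q (r q) = 1

/-- `HasCovDerivAt` tests with sections that are horizontal everywhere. Subtracting the Reeb
component from the constant extension of `v`, and extending by zero, gives such a section. -/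
lemma IsContactExpr.exists_horizontal {e : E' → E' →L[ℝ] ℝ} {r : E' → E'}
    (hC : Θ.IsContactExpr C e r) {q : E'} (hq : q ∈ Θ.target) {v : E'} (hv : e q v = 0) :
    ∃ Y : ∀ x : M, TangentSpace 𝓘(ℝ, E) x, (∀ y, C.η y (Y y) = 0) ∧
      ContactMetricData.SmoothFieldAt Y (Θ.param q) ∧ Y (Θ.param q) = Θ.dparam q v := by
  refine ⟨Θ.push fun q' => v - e q' v • r q', fun y => ?_, smoothFieldAt_push hq ?_, ?_⟩
  · by_cases hy : y ∈ Θ.source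
    · rw [← param_coords hy, push_param (coords_mem hy), hC.eta _ (coords_mem hy)]
      simp [hC.eta_xi _ (coords_mem hy)]
    · rw [push_of_notMem hy, map_zero]
  · exact contDiffAt_const.sub (((hC.eta_smooth q hq).clm_apply contDiffAt_const).smul
      (hC.xi_smooth q hq))
  · rw [push_param hq]; simp [hv]

/-- The derivatives of the components of `Y` and `Z` cancel, so the condition is tensorial and can
be tested on single horizontal vectors. For horizontal `X` the bracket with `ξ` does not enter, and
`Γ` is the Christoffel map in the direction of `X`. -/
theorem IsMetricExpr.hasCovDerivAt_iff [IsManifold 𝓘(ℝ, E) ∞ M] [CompleteSpace E']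
    [FiniteDimensional ℝ E'] (hG : Θ.IsMetricExpr C G) {e : E' → E' →L[ℝ] ℝ}
    {r : E' → E'} (hC : Θ.IsContactExpr C e r) {q : E'} (hq : q ∈ Θ.target)
    {X : ∀ x : M, TangentSpace 𝓘(ℝ, E) x} (hX : ContactMetricData.SmoothFieldAt X (Θ.param q))
    (hX0 : ∀ y, C.η y (X y) = 0) {α : ∀ x : M, C.asd x} {a : E' → E' →L[ℝ] E' →L[ℝ] ℝ}
    (ha : DifferentiableAt ℝ a q)
    (hα : ∀ q' ∈ Θ.target, ∀ v w,
      (α (Θ.param q')).1 ![Θ.dparam q' v, Θ.dparam q' w] = a q' v w)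
    {Γ : E' → E'} (hΓ : ∀ v w, 2 * G q (Γ v) w = christoffel G q (Θ.hat X q) v w)
    (β : C.asd (Θ.param q)) :
    C.HasCovDerivAt α X (Θ.param q) β ↔
      ∀ v w, e q v = 0 → e q w = 0 → β.1 ![Θ.dparam q v, Θ.dparam q w]
        = fderiv ℝ a q (Θ.hat X q) v w - a q (Γ v) w - a q v (Γ w) := by
  have main : ∀ Y Z : ∀ x : M, TangentSpace 𝓘(ℝ, E) x,
      ContactMetricData.SmoothFieldAt Y (Θ.param q) →
      ContactMetricData.SmoothFieldAt Z (Θ.param q) →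
      ContactMetricData.dirDeriv (fun y => (α y).1 ![Y y, Z y]) (Θ.param q) (X (Θ.param q))
        - (α (Θ.param q)).1 ![C.transverseLC X Y (Θ.param q), Z (Θ.param q)]
        - (α (Θ.param q)).1 ![Y (Θ.param q), C.transverseLC X Z (Θ.param q)]
      = fderiv ℝ a q (Θ.hat X q) (Θ.hat Y q) (Θ.hat Z q) - a q (Γ (Θ.hat Y q)) (Θ.hat Z q)
        - a q (Θ.hat Y q) (Γ (Θ.hat Z q)) := by
    intro Y Z hY hZ
    have dY := (contDiffAt_hat hq hY).differentiableAt (by simp)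
    have dZ := (contDiffAt_hat hq hZ).differentiableAt (by simp)
    obtain ⟨h1, h2⟩ := fderiv_bilinear_apply ha dY dZ (Θ.hat X q)
    have ev : (fun y => (α y).1 ![Y y, Z y]) ∘ Θ.param
        =ᶠ[𝓝 q] fun q' => a q' (Θ.hat Y q') (Θ.hat Z q') := by
      filter_upwards [Θ.open_target.mem_nhds hq] with q' hq'
      rw [Function.comp_apply, ← hα q' hq', dparam_hat hq', dparam_hat hq']
    have hor : (fun y => C.hor y (X y)) = X := by
      funext y; simp [ContactMetricData.hor, hX0 y]
    have lc : ∀ Y : ∀ x : M, TangentSpace 𝓘(ℝ, E) x,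
        ContactMetricData.SmoothFieldAt Y (Θ.param q) →
        C.transverseLC X Y (Θ.param q) = C.hor (Θ.param q)
          (Θ.dparam q (fderiv ℝ (Θ.hat Y) q (Θ.hat X q) + Γ (Θ.hat Y q))) := by
      intro Y hY
      rw [ContactMetricData.transverseLC, hX0, zero_smul, add_zero, hor]
      congr 1
      -- `leviCivita` is only known through its products with `G`; the difference `d` of the two
      -- sides has `G q d d = 0`, hence vanishes.
      have key : Θ.dcoords q (C.leviCivita X Y (Θ.param q))
          - (fderiv ℝ (Θ.hat Y) q (Θ.hat X q) + Γ (Θ.hat Y q)) = 0 := by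
        by_contra hne
        refine (hG.pos q hq _ hne).ne' ?_
        generalize hd : Θ.dcoords q (C.leviCivita X Y (Θ.param q))
          - (fderiv ℝ (Θ.hat Y) q (Θ.hat X q) + Γ (Θ.hat Y q)) = d
        have k1 := hG.leviCivita_param hq hX hY d
        rw [← hΓ] at k1
        nth_rewrite 1 [← hd]
        simp only [map_sub, map_add, sub_apply, add_apply]
        linarith
      rw [sub_eq_zero] at key
      rw [← key, dparam_dcoords hq]
    rw [lc Y hY, lc Z hZ, ContactMetricData.asd_hor_left, ContactMetricData.asd_hor_right,
      ← dparam_hat hq X, dirDeriv_param hq (h1.congr_of_eventuallyEq ev), ev.fderiv_eq, h2,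
      ← dparam_hat hq Y, ← dparam_hat hq Z, hα q hq, hα q hq]
    simp only [map_add, add_apply]
    ring
  constructor
  · intro h v w hv hw
    obtain ⟨Y, hY0, hY, hYv⟩ := hC.exists_horizontal hq hv
    obtain ⟨Z, hZ0, hZ, hZw⟩ := hC.exists_horizontal hq hw
    have := h Y Z hY0 hZ0 hY hZ
    rw [main Y Z hY hZ, hat_apply hq Y, hat_apply hq Z, hYv, hZw, dcoords_dparam hq,
      dcoords_dparam hq] at this
    exact this
  · intro h Y Z hY0 hZ0 hY hZ
    rw [main Y Z hY hZ, ← h, dparam_hat hq, dparam_hat hq]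
    · rw [← hC.eta q hq, dparam_hat hq, hY0]
    · rw [← hC.eta q hq, dparam_hat hq, hZ0]

end LocalCoord

/-! ## Anti-self-dual forms in terms of a coframe -/

/-- The wedge product of two continuous linear forms. -/
def wedge {T : Type*} [AddCommGroup T] [Module ℝ T] [TopologicalSpace T] (a b : T →L[ℝ] ℝ) :
    T [⋀^Fin 2]→L[ℝ] ℝ where
  toFun v := a (v 0) * b (v 1) - a (v 1) * b (v 0)
  map_update_add' := by
    intro d v i x y
    rw [Subsingleton.elim d (instDecidableEqFin 2)]
    fin_cases i <;> simp <;> ring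
  map_update_smul' := by
    intro d v i c x
    rw [Subsingleton.elim d (instDecidableEqFin 2)]
    fin_cases i <;> simp <;> ring
  map_eq_zero_of_eq' := by
    intro v i j h hij
    have : v 0 = v 1 := by
      fin_cases i <;> fin_cases j <;> simp_all
    simp only [this]; ring
  cont := by fun_prop

@[simp] lemma wedge_apply {T : Type*} [AddCommGroup T] [Module ℝ T] [TopologicalSpace T]
    (a b : T →L[ℝ] ℝ) (v w : T) : wedge a b ![v, w] = a v * b w - a w * b v := rfl

/-- The anti-self-dual 2-form with coefficients `t` in the oriented orthonormal coframe `l`. -/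
def asdForm {T : Type*} [AddCommGroup T] [Module ℝ T] [TopologicalSpace T]
    (l : Fin 4 → T →L[ℝ] ℝ) (t : Fin 3 → ℝ) : T [⋀^Fin 2]→L[ℝ] ℝ :=
  t 0 • (wedge (l 0) (l 1) - wedge (l 2) (l 3)) + t 1 • (wedge (l 0) (l 2) + wedge (l 1) (l 3))
    + t 2 • (wedge (l 0) (l 3) - wedge (l 1) (l 2))

lemma asdForm_apply {T : Type*} [AddCommGroup T] [Module ℝ T] [TopologicalSpace T]
    (l : Fin 4 → T →L[ℝ] ℝ) (t : Fin 3 → ℝ) (v w : T) :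
    asdForm l t ![v, w] =
      t 0 * ((l 0 v * l 1 w - l 0 w * l 1 v) - (l 2 v * l 3 w - l 2 w * l 3 v))
      + t 1 * ((l 0 v * l 2 w - l 0 w * l 2 v) + (l 1 v * l 3 w - l 1 w * l 3 v))
      + t 2 * ((l 0 v * l 3 w - l 0 w * l 3 v) - (l 1 v * l 2 w - l 1 w * l 2 v)) := by
  simp [asdForm]
  ring

lemma eq_zero_of_sum_six_sq {a b c d e f : ℝ}
    (h : a ^ 2 + b ^ 2 + c ^ 2 + d ^ 2 + e ^ 2 + f ^ 2 = 0) :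
    a = 0 ∧ b = 0 ∧ c = 0 ∧ d = 0 ∧ e = 0 ∧ f = 0 := by
  refine ⟨?_, ?_, ?_, ?_, ?_, ?_⟩ <;> refine pow_eq_zero_iff two_ne_zero |>.mp ?_ <;>
  linarith [sq_nonneg a, sq_nonneg b, sq_nonneg c, sq_nonneg d, sq_nonneg e, sq_nonneg f]

/-- Complementary `2 × 2` minors of a rotation in four dimensions agree. -/
lemma complementary_minors (B : Matrix (Fin 4) (Fin 4) ℝ) (h : B * B.transpose = 1)
    (hd : 0 < B.det) :
    (B 0 0 * B 1 1 - B 0 1 * B 1 0 = B 2 2 * B 3 3 - B 2 3 * B 3 2) ∧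
    (B 0 0 * B 1 2 - B 0 2 * B 1 0 = -(B 2 1 * B 3 3 - B 2 3 * B 3 1)) ∧
    (B 0 0 * B 1 3 - B 0 3 * B 1 0 = B 2 1 * B 3 2 - B 2 2 * B 3 1) ∧
    (B 0 1 * B 1 2 - B 0 2 * B 1 1 = B 2 0 * B 3 3 - B 2 3 * B 3 0) ∧
    (B 0 1 * B 1 3 - B 0 3 * B 1 1 = -(B 2 0 * B 3 2 - B 2 2 * B 3 0)) ∧
    (B 0 2 * B 1 3 - B 0 3 * B 1 2 = B 2 0 * B 3 1 - B 2 1 * B 3 0) := by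
  have hdet : B.det = 1 := by
    have : B.det * B.det = 1 := by
      have := congrArg Matrix.det h
      rwa [Matrix.det_mul, Matrix.det_transpose, Matrix.det_one] at this
    nlinarith
  have hg : ∀ i j, ∑ k, B i k * B j k = if i = j then 1 else 0 := by
    intro i j
    have := congrFun (congrFun h i) j
    simpa [Matrix.mul_apply, Matrix.one_apply] using this
  have g00 := hg 0 0
  have g01 := hg 0 1
  have g11 := hg 1 1
  have g22 := hg 2 2
  have g23 := hg 2 3
  have g33 := hg 3 3
  simp [Fin.sum_univ_four] at g00 g01 g11 g22 g23 g33
  rw [Matrix.det_succ_row_zero] at hdet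
  simp [Fin.sum_univ_succ, Matrix.det_fin_three, Fin.succAbove, Matrix.submatrix] at hdet
  -- The vectors of minors of rows `0, 1` and of rows `2, 3` are unit vectors, by the Gram
  -- determinants of orthonormal pairs, and their signed inner product is `det B` by Laplace
  -- expansion. The squared distance is `1 + 1 - 2 = 0`.
  have key : (B 0 0 * B 1 1 - B 0 1 * B 1 0 - (B 2 2 * B 3 3 - B 2 3 * B 3 2)) ^ 2 +
    (B 0 0 * B 1 2 - B 0 2 * B 1 0 + (B 2 1 * B 3 3 - B 2 3 * B 3 1)) ^ 2 +
    (B 0 0 * B 1 3 - B 0 3 * B 1 0 - (B 2 1 * B 3 2 - B 2 2 * B 3 1)) ^ 2 +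
    (B 0 1 * B 1 2 - B 0 2 * B 1 1 - (B 2 0 * B 3 3 - B 2 3 * B 3 0)) ^ 2 +
    (B 0 1 * B 1 3 - B 0 3 * B 1 1 + (B 2 0 * B 3 2 - B 2 2 * B 3 0)) ^ 2 +
    (B 0 2 * B 1 3 - B 0 3 * B 1 2 - (B 2 0 * B 3 1 - B 2 1 * B 3 0)) ^ 2 = 0 := by
    linear_combination (B 1 0 * B 1 0 + B 1 1 * B 1 1 + B 1 2 * B 1 2 + B 1 3 * B 1 3) * g00 + g11
      - (B 0 0 * B 1 0 + B 0 1 * B 1 1 + B 0 2 * B 1 2 + B 0 3 * B 1 3) * g01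
      + (B 3 0 * B 3 0 + B 3 1 * B 3 1 + B 3 2 * B 3 2 + B 3 3 * B 3 3) * g22 + g33
      - (B 2 0 * B 3 0 + B 2 1 * B 3 1 + B 2 2 * B 3 2 + B 2 3 * B 3 3) * g23 - 2 * hdet
  obtain ⟨h1, h2, h3, h4, h5, h6⟩ := eq_zero_of_sum_six_sq key
  refine ⟨?_, ?_, ?_, ?_, ?_, ?_⟩ <;> linarith

namespace ContactMetricData

variable {E M : Type*} [NormedAddCommGroup E] [NormedSpace ℝ E]
    [TopologicalSpace M] [ChartedSpace E M] {C : ContactMetricData E M}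

/-- `l` is a coframe of `H` at `x` in which the metric and `dη` are the standard ones, with dual
frame `b`. -/
structure IsCoframe (C : ContactMetricData E M) (x : M)
    (l : Fin 4 → TangentSpace 𝓘(ℝ, E) x →L[ℝ] ℝ) (b : Fin 4 → TangentSpace 𝓘(ℝ, E) x) : Prop where
  metric : ∀ v w, C.g x v w = ∑ i, l i v * l i w + C.η x v * C.η x w
  dη : ∀ v w, C.dη x v w = (l 0 v * l 1 w - l 0 w * l 1 v) + (l 2 v * l 3 w - l 2 w * l 3 v)
  xi : ∀ i, l i (C.ξ x) = 0
  dual : ∀ i j, l i (b j) = if i = j then 1 else 0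
  eta_dual : ∀ j, C.η x (b j) = 0
  expand : ∀ v, v = ∑ i, l i v • b i + C.η x v • C.ξ x

/-- The coefficients of an oriented orthonormal frame form a matrix in `SO(4)`: half of `dη ∧ dη` is
`l 0 ∧ l 1 ∧ l 2 ∧ l 3`, so the orientation condition says that the determinant is positive.
Anti-self-duality in that frame is then `complementary_minors`. -/
lemma IsCoframe.asdForm_mem {x : M} {l : Fin 4 → TangentSpace 𝓘(ℝ, E) x →L[ℝ] ℝ}
    {b : Fin 4 → TangentSpace 𝓘(ℝ, E) x} (h : C.IsCoframe x l b) (t : Fin 3 → ℝ) :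
    asdForm l t ∈ C.asd x := by
  refine ⟨fun v => ?_, fun e he => ?_⟩
  · simp [asdForm_apply, h.xi]
  · let B : Matrix (Fin 4) (Fin 4) ℝ := Matrix.of fun i j => l j (e i)
    have hB : ∀ i j, B i j = l j (e i) := fun _ _ => rfl
    have h1 : B * B.transpose = 1 := by
      ext i j
      have := he.orthonormal i j
      rw [h.metric, he.horizontal, he.horizontal] at this
      simpa [Matrix.mul_apply, Matrix.one_apply, hB] using this
    have h2 : 0 < B.det := by
      have ho := he.oriented
      simp only [h.dη, ← hB] at ho
      refine ho.trans_eq ?_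
      rw [Matrix.det_succ_row_zero]
      simp [Fin.sum_univ_succ, Matrix.det_fin_three, Fin.succAbove, Matrix.submatrix]
      ring
    obtain ⟨m1, m2, m3, m4, m5, m6⟩ := complementary_minors B h1 h2
    simp only [asdForm_apply, ← hB]
    linear_combination t 0 * m1 - t 0 * m6 + t 1 * m2 + t 1 * m5 + t 2 * m3 - t 2 * m4

/-- Anti-self-duality in three frames permuted from the dual frame gives three linear relations,
which leave only the values on `(b 0, b i)` free. -/
lemma IsCoframe.eq_asdForm {x : M} {l : Fin 4 → TangentSpace 𝓘(ℝ, E) x →L[ℝ] ℝ}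
    {b : Fin 4 → TangentSpace 𝓘(ℝ, E) x} (h : C.IsCoframe x l b) (α : C.asd x) :
    α.1 = asdForm l ![α.1 ![b 0, b 1], α.1 ![b 0, b 2], α.1 ![b 0, b 3]] := by
  have fr : ∀ σ : Fin 4 → Fin 4, Function.Injective σ →
      0 < C.dη x (b (σ 0)) (b (σ 1)) * C.dη x (b (σ 2)) (b (σ 3))
        - C.dη x (b (σ 0)) (b (σ 2)) * C.dη x (b (σ 1)) (b (σ 3))
        + C.dη x (b (σ 0)) (b (σ 3)) * C.dη x (b (σ 1)) (b (σ 2)) →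
      α.1 ![b (σ 0), b (σ 1)] = -α.1 ![b (σ 2), b (σ 3)] := by
    intro σ hσ ho
    refine α.2.2 (fun i => b (σ i)) ⟨fun i => h.eta_dual _, fun i j => ?_, ho⟩
    rw [h.metric, h.eta_dual]
    simp [h.dual, hσ.eq_iff, eq_comm]
  -- Cyclic permutations of `1, 2, 3` are even, so the permuted dual frames are still oriented.
  have f1 := fr ![0, 1, 2, 3] (by decide) (by simp [h.dη, h.dual])
  have f2 := fr ![0, 2, 3, 1] (by decide) (by simp [h.dη, h.dual])
  have f3 := fr ![0, 3, 1, 2] (by decide) (by simp [h.dη, h.dual])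
  simp at f1 f2 f3
  have self : ∀ v, α.1 ![v, v] = 0 := fun v => by
    have := alternating_swap α.1 v v; linarith
  have left : ∀ v w, α.1 ![v, w] = ∑ i, l i v * α.1 ![b i, w] := by
    intro v w
    conv_lhs => rw [h.expand v]
    simp only [Fin.sum_univ_four, alternating_add_left, alternating_smul_left, α.2.1 w]
    ring
  have right : ∀ v w, α.1 ![v, w] = ∑ i, l i w * α.1 ![v, b i] := by
    intro v w
    rw [alternating_swap, left, ← Finset.sum_neg_distrib]
    refine Finset.sum_congr rfl fun i _ => ?_
    rw [alternating_swap α.1 v]; ring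
  have ext2 : ∀ v w, α.1 ![v, w]
      = asdForm l ![α.1 ![b 0, b 1], α.1 ![b 0, b 2], α.1 ![b 0, b 3]] ![v, w] := by
    intro v w
    rw [left v w]
    simp only [right _ w, asdForm_apply, Fin.sum_univ_four, self]
    rw [alternating_swap α.1 (b 1) (b 0), alternating_swap α.1 (b 2) (b 0),
      alternating_swap α.1 (b 3) (b 0), alternating_swap α.1 (b 2) (b 1),
      alternating_swap α.1 (b 3) (b 2), alternating_swap α.1 (b 1) (b 3)]
    simp
    rw [f1, f2, f3]
    ring
  ext v
  have : v = ![v 0, v 1] := by funext i; fin_cases i <;> rfl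
  rw [this, ext2]

lemma IsCoframe.asdForm_dual {x : M} {l : Fin 4 → TangentSpace 𝓘(ℝ, E) x →L[ℝ] ℝ}
    {b : Fin 4 → TangentSpace 𝓘(ℝ, E) x} (h : C.IsCoframe x l b) (t : Fin 3 → ℝ) :
    asdForm l t ![b 0, b 1] = t 0 ∧ asdForm l t ![b 0, b 2] = t 1 ∧
      asdForm l t ![b 0, b 3] = t 2 := by
  simp [asdForm_apply, h.dual]

/-- The identification of `∧⁻H*` with `ℝ³` given by a coframe. -/
def IsCoframe.asdEquiv {x : M} {l : Fin 4 → TangentSpace 𝓘(ℝ, E) x →L[ℝ] ℝ}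
    {b : Fin 4 → TangentSpace 𝓘(ℝ, E) x} (h : C.IsCoframe x l b) : (Fin 3 → ℝ) ≃ₗ[ℝ] C.asd x where
  toFun t := ⟨asdForm l t, h.asdForm_mem t⟩
  map_add' s t := by
    apply Subtype.ext; simp only [asdForm, Pi.add_apply, Submodule.coe_add]; module
  map_smul' c t := by
    apply Subtype.ext
    simp only [asdForm, Pi.smul_apply, smul_eq_mul, Submodule.coe_smul, RingHom.id_apply]; module
  invFun α := ![α.1 ![b 0, b 1], α.1 ![b 0, b 2], α.1 ![b 0, b 3]]
  left_inv t := by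
    obtain ⟨h0, h1, h2⟩ := h.asdForm_dual t
    simp only [h0, h1, h2]
    funext i; fin_cases i <;> rfl
  right_inv α := Subtype.ext (h.eq_asdForm α).symm

lemma IsCoframe.finrank_asd {x : M} {l : Fin 4 → TangentSpace 𝓘(ℝ, E) x →L[ℝ] ℝ}
    {b : Fin 4 → TangentSpace 𝓘(ℝ, E) x} (h : C.IsCoframe x l b) :
    Module.finrank ℝ (C.asd x) = 3 := by
  rw [← h.asdEquiv.finrank_eq]; simp

end ContactMetricData

namespace YParam

variable (P : YParam)

/-! ## The parameters -/

lemma p_pos' : (0 : ℝ) < P.p := by exact_mod_cast P.p_pos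

lemma q_lt_p : (P.q : ℝ) < P.p := by exact_mod_cast P.lt

lemma q_nonneg : (0 : ℝ) ≤ P.q := Nat.cast_nonneg _

lemma disc_sq : P.disc ^ 2 = 4 * (P.p : ℝ) ^ 2 - 3 * (P.q : ℝ) ^ 2 := by
  have h1 := P.q_lt_p
  have h2 := P.q_nonneg
  exact Real.sq_sqrt (by nlinarith)

lemma p_lt_disc : (P.p : ℝ) < P.disc := by
  have h1 := P.q_lt_p
  have h2 := P.q_nonneg
  exact Real.lt_sqrt_of_sq_lt (by nlinarith)

lemma y_sub : P.y₂ - P.y₁ = 3 * P.q / (2 * P.p) := by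
  have := P.p_pos'
  unfold y₁ y₂; field_simp; ring

lemma y_sum : P.y₃ = 3 / 2 - P.y₁ - P.y₂ := by
  have := P.p_pos'
  unfold y₁ y₂ y₃; field_simp; ring

/-- The cubic `a - 3y² + 2y³` has no linear term, so the second elementary symmetric function of its
roots vanishes; here `y₃` is eliminated by `y_sum`. -/
lemma y_rel : P.y₁ * P.y₂ + (P.y₁ + P.y₂) * (3 / 2 - P.y₁ - P.y₂) = 0 := by
  have := P.p_pos'
  unfold y₁ y₂; field_simp
  linear_combination (-6) * P.disc_sq

lemma q_eq : (P.q : ℝ) = 2 / 3 * (P.y₂ - P.y₁) * P.p := by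
  have := P.p_pos'
  rw [y_sub]; field_simp

lemma one_lt_y₃ : 1 < P.y₃ := by
  have := P.p_pos'
  have := P.p_lt_disc
  unfold y₃; rw [lt_div_iff₀ (by positivity)]; linarith

lemma y₂_lt_one : P.y₂ < 1 := by
  have h0 := P.p_pos'
  have h1 := P.q_lt_p
  have h3 := P.p_lt_disc
  have h4 := P.disc_sq
  unfold y₂; rw [div_lt_iff₀ (by positivity)]
  have h2 := P.q_nonneg
  nlinarith

variable {P}

lemma y₁_neg (hq : 0 < P.q) : P.y₁ < 0 := by
  have h0 := P.p_pos'
  have h1 := P.q_lt_p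
  have h3 := P.p_lt_disc
  have h4 := P.disc_sq
  have h5 : (0 : ℝ) < P.q := by exact_mod_cast hq
  unfold y₁; rw [div_lt_iff₀ (by positivity)]
  nlinarith

lemma y₂_pos (hq : 0 < P.q) : 0 < P.y₂ := by
  have h0 := P.p_pos'
  have h4 := P.disc_sq
  have h3 := P.p_lt_disc
  have h5 : (0 : ℝ) < P.q := by exact_mod_cast hq
  unfold y₂; rw [lt_div_iff₀ (by positivity)]
  nlinarith

variable (P)

/-- Writing the weights through `p` and `y₂ - y₁` reduces the vanishing of `η` and `χ` on the circle
generator to identities between the roots. -/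
lemma wt_zero : ((P.wt 0 : ℕ) : ℝ) = P.p * (1 - 2 / 3 * (P.y₂ - P.y₁)) := by
  have h : ((P.wt 0 : ℕ) : ℝ) = P.p - P.q := by simp [wt, Nat.cast_sub P.lt.le]
  rw [h, P.q_eq]; ring

lemma wt_one : ((P.wt 1 : ℕ) : ℝ) = P.p * (1 + 2 / 3 * (P.y₂ - P.y₁)) := by
  have h : ((P.wt 1 : ℕ) : ℝ) = P.p + P.q := by simp [wt]
  rw [h, P.q_eq]; ring

/-! ## Forms on `ℂ⁴` -/

/-- `S³ × S³` as a subset of `ℂ⁴`. -/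
def spheres : Set C4 :=
  {z | ‖z.1 0‖ ^ 2 + ‖z.1 1‖ ^ 2 = 1 ∧ ‖z.2 0‖ ^ 2 + ‖z.2 1‖ ^ 2 = 1}

/-- `v` is tangent to `S³ × S³` at `z`. -/
def IsTangent (z v : C4) : Prop :=
  (conj (z.1 0) * v.1 0 + conj (z.1 1) * v.1 1).re = 0 ∧
    (conj (z.2 0) * v.2 0 + conj (z.2 1) * v.2 1).re = 0

/-- The generator of the circle action. -/
def gen (z : C4) : C4 :=
  (fun i => Complex.I * P.p * z.1 i, fun j => -(Complex.I * P.wt j * z.2 j))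

lemma formA_apply (z v : C4) :
    formA z v = (conj (z.1 0) * v.1 0 + conj (z.1 1) * v.1 1).im := rfl

lemma formB_apply (j : Fin 2) (z v : C4) : formB j z v = (conj (z.2 j) * v.2 j).im := rfl

lemma tauC_apply (z v : C4) : tauC z v = z.1 1 * v.1 0 - z.1 0 * v.1 1 := rfl

lemma etaC_apply (z v : C4) : P.etaC z v = 4 / 3 * (1 - P.yFun z) * formA z v +
    2 / 3 * (P.y₂ - P.y₁) * (P.y₂⁻¹ * formB 1 z v - P.y₁⁻¹ * formB 0 z v) := rfl

/-- The real 1-form in the definition of `chiC`. -/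
def chiR (z v : C4) : ℝ :=
  (P.y₂ - P.y₁) * (P.y₃ - 1) / (P.y₃ - P.yFun z) *
    ((P.y₃ - P.y₁)⁻¹ * formB 0 z v + (P.y₃ - P.y₂)⁻¹ * formB 1 z v)
      - 2 / 3 * (P.y₂ - P.y₁) * formA z v

lemma chiC_apply (z v : C4) : P.chiC z v = P.kap z * (z.2 1 * v.2 0 - z.2 0 * v.2 1) +
    Complex.I * z.2 0 * z.2 1 * P.chiR z v := rfl

/-- The differential of `yFun`. -/
def dyC (z : C4) : C4 →L[ℝ] ℝ :=
  (2 * P.y₁) • Complex.reCLM.comp (conj (z.2 1) • dz' 1)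
    + (2 * P.y₂) • Complex.reCLM.comp (conj (z.2 0) • dz' 0)

lemma dyC_apply (z v : C4) : P.dyC z v = 2 * P.y₁ * (conj (z.2 1) * v.2 1).re +
    2 * P.y₂ * (conj (z.2 0) * v.2 0).re := rfl

lemma hasFDerivAt_sq_norm (w : ℂ) : HasFDerivAt (fun w : ℂ => ‖w‖ ^ 2)
    ((2 : ℝ) • Complex.reCLM.comp (conj w • ContinuousLinearMap.id ℝ ℂ)) w := by
  refine (hasStrictFDerivAt_norm_sq w).hasFDerivAt.congr_fderiv ?_
  refine ContinuousLinearMap.ext fun v => ?_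
  simp [Complex.inner]
  ring

lemma hasFDerivAt_yFun (z : C4) : HasFDerivAt P.yFun (P.dyC z) z := by
  have h : ∀ j : Fin 2, HasFDerivAt (fun z : C4 => ‖z.2 j‖ ^ 2)
      (((2 : ℝ) • Complex.reCLM.comp (conj (z.2 j) • ContinuousLinearMap.id ℝ ℂ)).comp (dz' j)) z :=
    fun j => HasFDerivAt.comp (g := fun w : ℂ => ‖w‖ ^ 2) (f := dz' j) z
      (hasFDerivAt_sq_norm (z.2 j)) (dz' j).hasFDerivAt
  refine (((h 1).const_mul P.y₁).add ((h 0).const_mul P.y₂)).congr_fderiv ?_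
  refine ContinuousLinearMap.ext fun v => ?_
  simp [dyC, dz']
  ring

/-- `formA` as a bilinear map. -/
def formAL : C4 →L[ℝ] C4 →L[ℝ] ℝ :=
  LinearMap.toContinuousLinearMap
    { toFun := formA
      map_add' := by intro a b; refine ContinuousLinearMap.ext fun v => ?_; simp [formA_apply]; ring
      map_smul' := by intro a b; refine ContinuousLinearMap.ext fun v => ?_; simp [formA_apply]; ring }

/-- `formB` as a bilinear map. -/
def formBL (j : Fin 2) : C4 →L[ℝ] C4 →L[ℝ] ℝ :=
  LinearMap.toContinuousLinearMap
    { toFun := formB j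
      map_add' := by intro a b; refine ContinuousLinearMap.ext fun v => ?_; simp [formB_apply]; ring
      map_smul' := by intro a b; refine ContinuousLinearMap.ext fun v => ?_; simp [formB_apply]; ring }

lemma fderiv_etaC_apply (z v w : C4) : fderiv ℝ P.etaC z v w =
    -(4 / 3 * P.dyC z v * formA z w) + 4 / 3 * (1 - P.yFun z) * formA v w
    + 2 / 3 * (P.y₂ - P.y₁) * (P.y₂⁻¹ * formB 1 v w - P.y₁⁻¹ * formB 0 v w) := by
  have hA : HasFDerivAt formA formAL z := formAL.hasFDerivAt
  have hB : ∀ j, HasFDerivAt (formB j) (formBL j) z := fun j => (formBL j).hasFDerivAt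
  have h := ((((P.hasFDerivAt_yFun z).const_sub 1).const_mul (4 / 3)).smul hA).add
    ((((hB 1).const_smul P.y₂⁻¹).sub ((hB 0).const_smul P.y₁⁻¹)).const_smul
      (2 / 3 * (P.y₂ - P.y₁)))
  have h' : HasFDerivAt P.etaC _ z := h
  rw [h'.fderiv]
  have e1 : ∀ v, formAL v = formA v := fun _ => rfl
  have e2 : ∀ j v, formBL j v = formB j v := fun _ _ => rfl
  simp [e1, e2]
  ring

lemma formA_swap (v w : C4) : formA w v = -formA v w := by
  simp [formA_apply]; ring

lemma formB_swap (j : Fin 2) (v w : C4) : formB j w v = -formB j v w := by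
  simp [formB_apply]; ring

/-- The forms `formA` and `formB` are linear in the base point and antisymmetric, so their exterior
derivatives are twice themselves; the remaining term comes from the derivative of `y`. -/
lemma omegaC_apply (z v w : C4) : P.omegaC z v w =
    -(4 / 3 * (P.dyC z v * formA z w - P.dyC z w * formA z v))
    + 8 / 3 * (1 - P.yFun z) * formA v w
    + 4 / 3 * (P.y₂ - P.y₁) * (P.y₂⁻¹ * formB 1 v w - P.y₁⁻¹ * formB 0 v w) := by
  have : P.omegaC z v w = fderiv ℝ P.etaC z v w - fderiv ℝ P.etaC z w v := rfl
  rw [this, fderiv_etaC_apply, fderiv_etaC_apply, formA_swap v w, formB_swap 0 v w,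
    formB_swap 1 v w]
  ring

end YParam

namespace YParam

variable {P : YParam}

lemma y_rel' : P.y₁ * P.y₂ = -(P.y₁ + P.y₂) * P.y₃ := by
  rw [P.y_sum]; linarith [P.y_rel]

/-- Both sides are half the derivative at `y₃` of the cubic `a - 3y² + 2y³ = 2(y - y₁)(y - y₂)(y -
y₃)`. -/
lemma y₃_sub_mul : (P.y₃ - P.y₁) * (P.y₃ - P.y₂) = 3 * P.y₃ * (P.y₃ - 1) := by
  rw [P.y_sum]; linear_combination P.y_rel

lemma y₃_sub_y₂_pos : 0 < P.y₃ - P.y₂ := by linarith [P.one_lt_y₃, P.y₂_lt_one]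

lemma y₁_le_y₂ : P.y₁ ≤ P.y₂ := by
  have h : 0 ≤ P.y₂ - P.y₁ := by
    rw [P.y_sub]; exact div_nonneg (by linarith [P.q_nonneg]) (by linarith [P.p_pos'])
  linarith

lemma y₃_sub_y₁_pos : 0 < P.y₃ - P.y₁ := by
  linarith [P.one_lt_y₃, P.y₂_lt_one, P.y₁_le_y₂]

lemma y_sub_pos (hq : 0 < P.q) : 0 < P.y₂ - P.y₁ := by
  linarith [y₁_neg hq, y₂_pos hq]

lemma yFun_eq {z : C4} (hz : z ∈ spheres) :
    P.yFun z = P.y₁ * (1 - ‖z.2 0‖ ^ 2) + P.y₂ * ‖z.2 0‖ ^ 2 := by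
  rw [yFun, ← hz.2]; ring

lemma yFun_le {z : C4} (hz : z ∈ spheres) : P.yFun z ≤ P.y₂ := by
  have h1 := P.y₁_le_y₂
  have h2 := hz.2
  rw [yFun_eq hz]
  nlinarith [sq_nonneg ‖z.2 1‖]

lemma one_sub_yFun_pos {z : C4} (hz : z ∈ spheres) : 0 < 1 - P.yFun z := by
  linarith [yFun_le (P := P) hz, P.y₂_lt_one]

lemma y₃_sub_yFun_pos {z : C4} (hz : z ∈ spheres) : 0 < P.y₃ - P.yFun z := by
  linarith [yFun_le (P := P) hz, P.y₂_lt_one, P.one_lt_y₃]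

lemma kap_pos {z : C4} (hz : z ∈ spheres) : 0 < P.kap z :=
  div_pos (one_sub_yFun_pos hz) (y₃_sub_yFun_pos hz)

/-- With `t = |z₂|²` on the spheres, `y₁ (1 - t) + y₂ t` is `yFun`. This identity and `coeff_diag`
are the scalar content of `omegaC_eq`; `coeff_eta_gen` and `coeff_chi_gen` express that `η` and `χ`
vanish on the circle generator. All follow from the relations between the three roots. -/
lemma coeff_mixed (hq : 0 < P.q) {t : ℝ} (hy : P.y₃ - (P.y₁ * (1 - t) + P.y₂ * t) ≠ 0) :
    4 / 3 * (P.y₂ - P.y₁) * (P.y₂⁻¹ + P.y₁⁻¹)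
      = -(4 * ((P.y₂ - P.y₁) * (P.y₃ - 1) / (P.y₃ - (P.y₁ * (1 - t) + P.y₂ * t)))
        * ((P.y₃ - P.y₁)⁻¹ * t + (P.y₃ - P.y₂)⁻¹ * (1 - t))) := by
  have e := y_rel' (P := P)
  have e2 := y₃_sub_mul (P := P)
  have h1 := (y₁_neg hq).ne
  have h2 := (y₂_pos hq).ne'
  have h31 := (y₃_sub_y₁_pos (P := P)).ne'
  have h32 := (y₃_sub_y₂_pos (P := P)).ne'
  have hs := P.y_sum
  generalize P.y₁ = a at *
  generalize P.y₂ = b at *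
  generalize P.y₃ = c at *
  field_simp
  grind

lemma coeff_diag (hq : 0 < P.q) {t : ℝ} (hy : P.y₃ - (P.y₁ * (1 - t) + P.y₂ * t) ≠ 0) :
    4 / 3 * (P.y₂ - P.y₁) * (P.y₂⁻¹ * t - P.y₁⁻¹ * (1 - t))
      = 4 * ((1 - (P.y₁ * (1 - t) + P.y₂ * t)) / (P.y₃ - (P.y₁ * (1 - t) + P.y₂ * t))
        + ((P.y₂ - P.y₁) * (P.y₃ - 1) / (P.y₃ - (P.y₁ * (1 - t) + P.y₂ * t)))
          * ((P.y₃ - P.y₁)⁻¹ - (P.y₃ - P.y₂)⁻¹) * (t * (1 - t))) := by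
  have e := y_rel' (P := P)
  have e2 := y₃_sub_mul (P := P)
  have h1 := (y₁_neg hq).ne
  have h2 := (y₂_pos hq).ne'
  have h31 := (y₃_sub_y₁_pos (P := P)).ne'
  have h32 := (y₃_sub_y₂_pos (P := P)).ne'
  have hs := P.y_sum
  generalize P.y₁ = a at *
  generalize P.y₂ = b at *
  generalize P.y₃ = c at *
  field_simp
  grind

lemma coeff_eta_gen (hq : 0 < P.q) (t : ℝ) :
    4 / 3 * (1 - (P.y₁ * (1 - t) + P.y₂ * t)) + 2 / 3 * (P.y₂ - P.y₁) *
      (P.y₂⁻¹ * (-((1 + 2 / 3 * (P.y₂ - P.y₁)) * (1 - t)))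
        - P.y₁⁻¹ * (-((1 - 2 / 3 * (P.y₂ - P.y₁)) * t))) = 0 := by
  have e := y_rel' (P := P)
  have h1 := (y₁_neg hq).ne
  have h2 := (y₂_pos hq).ne'
  have hs := P.y_sum
  generalize P.y₁ = a at *
  generalize P.y₂ = b at *
  generalize P.y₃ = c at *
  field_simp
  grind

lemma coeff_chi_gen (hq : 0 < P.q) {t : ℝ} (hy : P.y₃ - (P.y₁ * (1 - t) + P.y₂ * t) ≠ 0) :
    (1 - (P.y₁ * (1 - t) + P.y₂ * t)) / (P.y₃ - (P.y₁ * (1 - t) + P.y₂ * t))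
        * (4 / 3 * (P.y₂ - P.y₁))
      + ((P.y₂ - P.y₁) * (P.y₃ - 1) / (P.y₃ - (P.y₁ * (1 - t) + P.y₂ * t))) *
      ((P.y₃ - P.y₁)⁻¹ * (-((1 - 2 / 3 * (P.y₂ - P.y₁)) * t))
        + (P.y₃ - P.y₂)⁻¹ * (-((1 + 2 / 3 * (P.y₂ - P.y₁)) * (1 - t))))
      - 2 / 3 * (P.y₂ - P.y₁) = 0 := by
  have e := y_rel' (P := P)
  have e2 := y₃_sub_mul (P := P)
  have h1 := (y₁_neg hq).ne
  have h2 := (y₂_pos hq).ne'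
  have h31 := (y₃_sub_y₁_pos (P := P)).ne'
  have h32 := (y₃_sub_y₂_pos (P := P)).ne'
  have hs := P.y_sum
  generalize P.y₁ = a at *
  generalize P.y₂ = b at *
  generalize P.y₃ = c at *
  field_simp
  grind

/-! ### The generator of the circle action -/

lemma conj_mul_self_eq (w : ℂ) : conj w * w = ((‖w‖ ^ 2 : ℝ) : ℂ) := by
  rw [mul_comm, Complex.mul_conj, Complex.normSq_eq_norm_sq]

lemma formB_gen (j : Fin 2) (z : C4) : formB j z (P.gen z) = -(P.wt j * ‖z.2 j‖ ^ 2) := by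
  have : conj (z.2 j) * (P.gen z).2 j = ((-(P.wt j * ‖z.2 j‖ ^ 2) : ℝ) : ℂ) * Complex.I := by
    simp only [gen]
    push_cast
    have := conj_mul_self_eq (z.2 j)
    push_cast at this
    linear_combination (-(Complex.I * P.wt j)) * this
  rw [formB_apply, this]
  simp [-Complex.ofReal_neg, -Complex.ofReal_mul, -Complex.ofReal_pow]

lemma conj_mul_gen_fst {z : C4} (hz : z ∈ spheres) :
    conj (z.1 0) * (P.gen z).1 0 + conj (z.1 1) * (P.gen z).1 1 = P.p * Complex.I := by
  have h0 := conj_mul_self_eq (z.1 0)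
  have h1 := conj_mul_self_eq (z.1 1)
  have h : ((‖z.1 0‖ ^ 2 : ℝ) : ℂ) + ((‖z.1 1‖ ^ 2 : ℝ) : ℂ) = 1 := by exact_mod_cast hz.1
  simp only [gen]
  linear_combination (Complex.I * P.p) * (h0 + h1 + h)

lemma formA_gen {z : C4} (hz : z ∈ spheres) : formA z (P.gen z) = P.p := by
  rw [formA_apply, conj_mul_gen_fst hz]; simp

lemma isTangent_gen {z : C4} (hz : z ∈ spheres) : IsTangent z (P.gen z) := by
  refine ⟨?_, ?_⟩
  · rw [conj_mul_gen_fst hz]; simp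
  · have h0 := conj_mul_self_eq (z.2 0)
    have h1 := conj_mul_self_eq (z.2 1)
    have : conj (z.2 0) * (P.gen z).2 0 + conj (z.2 1) * (P.gen z).2 1
        = ((-(P.wt 0 * ‖z.2 0‖ ^ 2 + P.wt 1 * ‖z.2 1‖ ^ 2) : ℝ) : ℂ) * Complex.I := by
      simp only [gen]
      push_cast
      push_cast at h0 h1
      linear_combination (-(Complex.I * P.wt 0)) * h0 + (-(Complex.I * P.wt 1)) * h1
    rw [this, Complex.re_ofReal_mul]; simp

lemma tauC_gen (z : C4) : tauC z (P.gen z) = 0 := by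
  simp only [tauC_apply, gen]; ring

lemma norm_snd_one {z : C4} (hz : z ∈ spheres) : ‖z.2 1‖ ^ 2 = 1 - ‖z.2 0‖ ^ 2 := by
  linarith [hz.2]

lemma etaC_gen (hq : 0 < P.q) {z : C4} (hz : z ∈ spheres) : P.etaC z (P.gen z) = 0 := by
  rw [etaC_apply, formA_gen hz, formB_gen, formB_gen, P.wt_zero, P.wt_one, yFun_eq hz,
    norm_snd_one hz]
  linear_combination (P.p : ℝ) * coeff_eta_gen hq (‖z.2 0‖ ^ 2)

lemma chiR_gen (hq : 0 < P.q) {z : C4} (hz : z ∈ spheres) :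
    P.chiR z (P.gen z) = -(P.kap z * (P.wt 1 - P.wt 0)) := by
  have hy := (y₃_sub_yFun_pos (P := P) hz).ne'
  rw [chiR, formA_gen hz, formB_gen, formB_gen, P.wt_zero, P.wt_one, kap,
    norm_snd_one hz]
  rw [yFun_eq hz] at hy ⊢
  linear_combination (P.p : ℝ) * coeff_chi_gen hq hy

lemma chiC_gen (hq : 0 < P.q) {z : C4} (hz : z ∈ spheres) : P.chiC z (P.gen z) = 0 := by
  rw [chiC_apply, chiR_gen hq hz]
  simp only [gen]
  push_cast
  ring

/-! ### Equivariance -/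

lemma conj_circle_zpow (ζ : Circle) (n : ℤ) : conj ((ζ : ℂ) ^ n) * (ζ : ℂ) ^ n = 1 := by
  rw [conj_mul_self_eq, norm_zpow, Circle.norm_coe]; simp

lemma norm_circle_zpow (ζ : Circle) (n : ℤ) : ‖(ζ : ℂ) ^ n‖ = 1 := by
  rw [norm_zpow, Circle.norm_coe, one_zpow]

lemma yFun_act (ζ : Circle) (z : C4) : P.yFun (P.act ζ z) = P.yFun z := by
  simp only [yFun, act, norm_mul, norm_circle_zpow, one_mul]

lemma kap_act (ζ : Circle) (z : C4) : P.kap (P.act ζ z) = P.kap z := by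
  simp only [kap, yFun_act]

lemma formA_act (ζ : Circle) (z v : C4) : formA (P.act ζ z) (P.act ζ v) = formA z v := by
  rw [formA_apply, formA_apply]
  congr 1
  simp only [act, map_mul]
  linear_combination (conj (z.1 0) * v.1 0 + conj (z.1 1) * v.1 1) * conj_circle_zpow ζ P.p

lemma formB_act (j : Fin 2) (ζ : Circle) (z v : C4) :
    formB j (P.act ζ z) (P.act ζ v) = formB j z v := by
  rw [formB_apply, formB_apply]
  congr 1
  simp only [act, map_mul]
  linear_combination (conj (z.2 j) * v.2 j) * conj_circle_zpow ζ (-(P.wt j))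

lemma etaC_act (ζ : Circle) (z v : C4) : P.etaC (P.act ζ z) (P.act ζ v) = P.etaC z v := by
  simp only [etaC_apply, yFun_act, formA_act, formB_act]

lemma tauC_act (ζ : Circle) (z v : C4) :
    tauC (P.act ζ z) (P.act ζ v) = ((ζ : ℂ) ^ (P.p : ℤ)) ^ 2 * tauC z v := by
  simp only [tauC_apply, act]; ring

lemma chiC_act (ζ : Circle) (z v : C4) :
    P.chiC (P.act ζ z) (P.act ζ v)
      = ((ζ : ℂ) ^ (-(P.wt 0 : ℤ)) * (ζ : ℂ) ^ (-(P.wt 1 : ℤ))) * P.chiC z v := by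
  have h : P.chiR (P.act ζ z) (P.act ζ v) = P.chiR z v := by
    simp only [chiR, yFun_act, formA_act, formB_act]
  rw [chiC_apply, chiC_apply, h, kap_act]
  simp only [act]
  ring

lemma act_mem_spheres {ζ : Circle} {z : C4} (hz : z ∈ spheres) : P.act ζ z ∈ spheres := by
  simpa only [spheres, Set.mem_ofPred_eq, act, norm_mul, norm_circle_zpow, one_mul] using hz

lemma isTangent_act {ζ : Circle} {z v : C4} (hv : IsTangent z v) :
    IsTangent (P.act ζ z) (P.act ζ v) := by
  have h1 := conj_circle_zpow ζ P.p
  have h2 := conj_circle_zpow ζ (-(P.wt 0))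
  have h3 := conj_circle_zpow ζ (-(P.wt 1))
  refine ⟨Eq.trans ?_ hv.1, Eq.trans ?_ hv.2⟩ <;> congr 1
  · simp only [act, map_mul]
    linear_combination (conj (z.1 0) * v.1 0 + conj (z.1 1) * v.1 1) * h1
  · simp only [act, map_mul]
    linear_combination (conj (z.2 0) * v.2 0) * h2 + (conj (z.2 1) * v.2 1) * h3

/-! ### The structure equation -/

/-- For a point of the sphere, `(a, b)` and `(conj b, -conj a)` form a unitary basis of `ℂ²`.
Tangency makes the first coefficient imaginary, and the second is `b v - a w`. -/
lemma tangent_decomp {a b v w : ℂ} (hz : ‖a‖ ^ 2 + ‖b‖ ^ 2 = 1)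
    (h : (conj a * v + conj b * w).re = 0) :
    v = Complex.I * (conj a * v + conj b * w).im * a + (b * v - a * w) * conj b ∧
      w = Complex.I * (conj a * v + conj b * w).im * b - (b * v - a * w) * conj a := by
  have e : Complex.I * (conj a * v + conj b * w).im = conj a * v + conj b * w := by
    apply Complex.ext <;> simp at h ⊢
    linarith
  have ha := conj_mul_self_eq a
  have hb := conj_mul_self_eq b
  have hab : ((‖a‖ ^ 2 : ℝ) : ℂ) + ((‖b‖ ^ 2 : ℝ) : ℂ) = 1 := by exact_mod_cast hz
  rw [e]
  constructor
  · linear_combination (-v) * (ha + hb + hab)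
  · linear_combination (-w) * (ha + hb + hab)

/-- In the unitary basis of `tangent_decomp` the Hermitian product of `v` and `w` is a real number,
coming from the Hopf directions, plus `conj τ(v) · τ(w)`. -/
lemma formA_eq {z v w : C4} (hz : z ∈ spheres) (hv : IsTangent z v) (hw : IsTangent z w) :
    formA v w = (conj (tauC z v) * tauC z w).im := by
  obtain ⟨h1, h2⟩ := tangent_decomp hz.1 hv.1
  obtain ⟨h3, h4⟩ := tangent_decomp hz.1 hw.1
  simp only [← formA_apply z, ← tauC_apply z] at h1 h2 h3 h4
  have ha := conj_mul_self_eq (z.1 0)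
  have hb := conj_mul_self_eq (z.1 1)
  have hab : ((‖z.1 0‖ ^ 2 : ℝ) : ℂ) + ((‖z.1 1‖ ^ 2 : ℝ) : ℂ) = 1 := by exact_mod_cast hz.1
  have key : conj (v.1 0) * w.1 0 + conj (v.1 1) * w.1 1
      = ((formA z v * formA z w : ℝ) : ℂ) + conj (tauC z v) * tauC z w := by
    rw [h1, h2, h3, h4]
    simp only [map_add, map_sub, map_mul, Complex.conj_I, Complex.conj_ofReal, Complex.conj_conj]
    push_cast
    linear_combination (formA z v * formA z w + conj (tauC z v) * tauC z w) * (ha + hb + hab)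
      - formA z v * formA z w * (conj (z.1 0) * z.1 0 + conj (z.1 1) * z.1 1) * Complex.I_sq
  rw [formA_apply, key]
  simp

/-- The 1-form `z₃ dz₂ - z₂ dz₃`. -/
def sigC (z v : C4) : ℂ := z.2 1 * v.2 0 - z.2 0 * v.2 1

/-- The 1-form `|z₂|² dθ₂ + |z₃|² dθ₃`. -/
def formBB (z v : C4) : ℝ := (conj (z.2 0) * v.2 0 + conj (z.2 1) * v.2 1).im

/-- The complex 1-form `z̄₂ z̄₃ (z₃ dz₂ - z₂ dz₃)`. -/
def muC (z v : C4) : ℂ := conj (z.2 0) * conj (z.2 1) * sigC z v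

lemma snd_decomp {z v : C4} (hz : z ∈ spheres) (hv : IsTangent z v) :
    v.2 0 = Complex.I * formBB z v * z.2 0 + sigC z v * conj (z.2 1) ∧
      v.2 1 = Complex.I * formBB z v * z.2 1 - sigC z v * conj (z.2 0) :=
  tangent_decomp hz.2 hv.2

lemma conj_mul_snd {z v : C4} (hz : z ∈ spheres) (hv : IsTangent z v) :
    conj (z.2 0) * v.2 0 = ((formBB z v * ‖z.2 0‖ ^ 2 : ℝ) : ℂ) * Complex.I + muC z v ∧
    conj (z.2 1) * v.2 1 = ((formBB z v * (1 - ‖z.2 0‖ ^ 2) : ℝ) : ℂ) * Complex.I - muC z v := by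
  obtain ⟨h1, h2⟩ := snd_decomp hz hv
  have ha := conj_mul_self_eq (z.2 0)
  have hb := conj_mul_self_eq (z.2 1)
  rw [← norm_snd_one hz]
  constructor
  · conv_lhs => rw [h1]
    rw [Complex.ofReal_mul, muC, ← ha]
    ring
  · conv_lhs => rw [h2]
    rw [Complex.ofReal_mul, muC, ← hb]
    ring

lemma formB_zero_eq {z v : C4} (hz : z ∈ spheres) (hv : IsTangent z v) :
    formB 0 z v = formBB z v * ‖z.2 0‖ ^ 2 + (muC z v).im := by
  rw [formB_apply, (conj_mul_snd hz hv).1]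
  rw [Complex.add_im, Complex.im_ofReal_mul]; simp

lemma formB_one_eq {z v : C4} (hz : z ∈ spheres) (hv : IsTangent z v) :
    formB 1 z v = formBB z v * (1 - ‖z.2 0‖ ^ 2) - (muC z v).im := by
  rw [formB_apply, (conj_mul_snd hz hv).2]
  rw [Complex.sub_im, Complex.im_ofReal_mul]; simp

lemma dyC_eq {z v : C4} (hz : z ∈ spheres) (hv : IsTangent z v) :
    P.dyC z v = 2 * (P.y₂ - P.y₁) * (muC z v).re := by
  rw [dyC_apply, (conj_mul_snd hz hv).1, (conj_mul_snd hz hv).2,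
    Complex.add_re, Complex.sub_re, Complex.re_ofReal_mul, Complex.re_ofReal_mul]
  simp; ring

lemma formB_zero_tangent {z v w : C4} (hz : z ∈ spheres) (hv : IsTangent z v)
    (hw : IsTangent z w) :
    formB 0 v w = (1 - ‖z.2 0‖ ^ 2) * (conj (sigC z v) * sigC z w).im
      + ((muC z v).re * formBB z w - (muC z w).re * formBB z v) := by
  obtain ⟨h1, -⟩ := snd_decomp hz hv
  obtain ⟨h3, -⟩ := snd_decomp hz hw
  have hb := conj_mul_self_eq (z.2 1)
  have ha := conj_mul_self_eq (z.2 0)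
  rw [norm_snd_one hz] at hb
  have key : conj (v.2 0) * w.2 0
      = ((1 - ‖z.2 0‖ ^ 2 : ℝ) : ℂ) * (conj (sigC z v) * sigC z w)
        + ((formBB z v * formBB z w * ‖z.2 0‖ ^ 2 : ℝ) : ℂ)
        + Complex.I * (formBB z w * conj (muC z v) - formBB z v * muC z w) := by
    rw [← hb, Complex.ofReal_mul, ← ha, h1, h3]
    simp only [muC, map_add, map_mul, Complex.conj_I, Complex.conj_ofReal,
      Complex.conj_conj]
    push_cast
    linear_combination (-(formBB z v * formBB z w * (conj (z.2 0) * z.2 0))) * Complex.I_sq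
  rw [formB_apply, key]
  simp only [Complex.add_im, Complex.sub_im, Complex.im_ofReal_mul, Complex.ofReal_im,
    Complex.mul_im Complex.I, Complex.I_re, Complex.I_im, Complex.sub_re, Complex.re_ofReal_mul,
    Complex.conj_re]
  ring

lemma formB_one_tangent {z v w : C4} (hz : z ∈ spheres) (hv : IsTangent z v)
    (hw : IsTangent z w) :
    formB 1 v w = ‖z.2 0‖ ^ 2 * (conj (sigC z v) * sigC z w).im
      - ((muC z v).re * formBB z w - (muC z w).re * formBB z v) := by
  obtain ⟨-, h1⟩ := snd_decomp hz hv
  obtain ⟨-, h3⟩ := snd_decomp hz hw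
  have hb := conj_mul_self_eq (z.2 1)
  have ha := conj_mul_self_eq (z.2 0)
  have key : conj (v.2 1) * w.2 1
      = ((‖z.2 0‖ ^ 2 : ℝ) : ℂ) * (conj (sigC z v) * sigC z w)
        + ((formBB z v * formBB z w * ‖z.2 1‖ ^ 2 : ℝ) : ℂ)
        - Complex.I * (formBB z w * conj (muC z v) - formBB z v * muC z w) := by
    rw [← ha, Complex.ofReal_mul, ← hb, h1, h3]
    simp only [muC, map_sub, map_mul, Complex.conj_I, Complex.conj_ofReal,
      Complex.conj_conj]
    push_cast
    linear_combination (-(formBB z v * formBB z w * (conj (z.2 1) * z.2 1))) * Complex.I_sq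
  rw [formB_apply, key]
  simp only [Complex.add_im, Complex.sub_im, Complex.im_ofReal_mul, Complex.ofReal_im,
    Complex.mul_im Complex.I, Complex.I_re, Complex.I_im, Complex.sub_re, Complex.re_ofReal_mul,
    Complex.conj_re]
  ring

/-- `μ` is `σ` times a factor of squared modulus `|z₂|² |z₃|²`. This turns the products of real and
imaginary parts of `μ` in `dη` back into the `σ` term. -/
lemma muC_wedge {z : C4} (hz : z ∈ spheres) (v w : C4) :
    ‖z.2 0‖ ^ 2 * (1 - ‖z.2 0‖ ^ 2) * (conj (sigC z v) * sigC z w).im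
      = (muC z v).re * (muC z w).im - (muC z w).re * (muC z v).im := by
  have hb := conj_mul_self_eq (z.2 1)
  have ha := conj_mul_self_eq (z.2 0)
  rw [norm_snd_one hz] at hb
  have key : conj (muC z v) * muC z w
      = ((‖z.2 0‖ ^ 2 * (1 - ‖z.2 0‖ ^ 2) : ℝ) : ℂ) * (conj (sigC z v) * sigC z w) := by
    rw [Complex.ofReal_mul, ← ha, ← hb]
    simp only [muC, map_mul, Complex.conj_conj]
    ring
  have h := congrArg Complex.im key
  rw [Complex.im_ofReal_mul] at h
  rw [← h]
  simp
  ring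

lemma chiC_eq (z v : C4) : P.chiC z v = P.kap z * sigC z v +
    Complex.I * z.2 0 * z.2 1 * P.chiR z v := rfl

lemma chiC_wedge (z v w : C4) : (conj (P.chiC z v) * P.chiC z w).im
    = P.kap z ^ 2 * (conj (sigC z v) * sigC z w).im
      + P.kap z * ((muC z v).re * P.chiR z w - (muC z w).re * P.chiR z v) := by
  have hb := conj_mul_self_eq (z.2 1)
  have ha := conj_mul_self_eq (z.2 0)
  have key : conj (P.chiC z v) * P.chiC z w
      = ((P.kap z ^ 2 : ℝ) : ℂ) * (conj (sigC z v) * sigC z w)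
        + Complex.I * ((P.kap z * P.chiR z w : ℝ) * conj (muC z v)
          - (P.kap z * P.chiR z v : ℝ) * muC z w)
        + ((‖z.2 0‖ ^ 2 * ‖z.2 1‖ ^ 2 * (P.chiR z v * P.chiR z w) : ℝ) : ℂ) := by
    rw [Complex.ofReal_mul _ (P.chiR z v * P.chiR z w), Complex.ofReal_mul (‖z.2 0‖ ^ 2),
      ← ha, ← hb, chiC_eq, chiC_eq]
    simp only [muC, map_add, map_mul, Complex.conj_I, Complex.conj_ofReal, Complex.conj_conj]
    push_cast
    linear_combination (-(conj (z.2 0) * z.2 0 * (conj (z.2 1) * z.2 1) * P.chiR z v * P.chiR z w))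
      * Complex.I_sq
  rw [key]
  simp only [Complex.add_im, Complex.sub_im, Complex.im_ofReal_mul, Complex.ofReal_im,
    Complex.mul_im Complex.I, Complex.I_re, Complex.I_im, Complex.sub_re, Complex.re_ofReal_mul,
    Complex.conj_re]
  ring

/-- `dη` in terms of the forms `τ` and `χ`. -/
theorem omegaC_eq (hq : 0 < P.q) {z v w : C4} (hz : z ∈ spheres) (hv : IsTangent z v)
    (hw : IsTangent z w) :
    P.omegaC z v w = 8 / 3 * (1 - P.yFun z) * (conj (tauC z v) * tauC z w).im
      + 4 / P.kap z * (conj (P.chiC z v) * P.chiC z w).im := by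
  have hk := (kap_pos (P := P) hz).ne'
  have hy := (y₃_sub_yFun_pos (P := P) hz).ne'
  have hm := muC_wedge hz v w
  have ek : P.kap z = (1 - P.yFun z) / (P.y₃ - P.yFun z) := rfl
  rw [omegaC_apply, formA_eq hz hv hw, dyC_eq hz hv, dyC_eq hz hw,
    formB_zero_tangent hz hv hw, formB_one_tangent hz hv hw, chiC_wedge]
  have e : ∀ a b : ℝ, 4 / P.kap z * (P.kap z ^ 2 * a + P.kap z * b) = 4 * (P.kap z * a + b) := by
    intro a b; field_simp
  rw [e, chiR, chiR, formB_zero_eq hz hv, formB_zero_eq hz hw, formB_one_eq hz hv,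
    formB_one_eq hz hw, ek]
  rw [yFun_eq hz] at hy ⊢
  have c1 := coeff_mixed hq hy
  have c2 := coeff_diag hq hy
  -- Coefficients are compared for `Im (conj σ · σ)` (`c2`) and for the wedge of `Re μ` with
  -- `formBB` (`c1`); the products of `Re μ` and `Im μ` are converted by `hm`.
  linear_combination (conj (sigC z v) * sigC z w).im * c2
    - ((muC z v).re * formBB z w - (muC z w).re * formBB z v) * c1
    + 4 * ((P.y₂ - P.y₁) * (P.y₃ - 1) / (P.y₃ - (P.y₁ * (1 - ‖z.2 0‖ ^ 2) + P.y₂ * ‖z.2 0‖ ^ 2)))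
      * ((P.y₃ - P.y₁)⁻¹ - (P.y₃ - P.y₂)⁻¹) * hm

end YParam

namespace YParam

variable {P : YParam}

/-! ### The common kernel of `τ`, `χ` and `η` -/

/-- This number is the coefficient of the last unknown in the linear system that describes the
common kernel of `formA`, `η` and `χ`; only its being non-zero matters. The relation `y₃ + y₁ = 3/2
- y₂ > 0` gives `-y₁/y₃ ≤ 1`, which allows that ratio to be replaced by `1`. -/
lemma kernel_coeff_pos (hq : 0 < P.q) {t : ℝ} (h0 : 0 ≤ t) (h1 : t ≤ 1) :
    (1 - (P.y₁ * (1 - t) + P.y₂ * t)) * ((1 - t) * P.y₁ - t * P.y₂)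
      - t * (1 - t) * (P.y₂ - P.y₁) * (P.y₁ * P.y₂ / P.y₃) < 0 := by
  have a1 := y₁_neg hq
  have a2 := y₂_pos hq
  have a3 := P.y₂_lt_one
  have a4 := P.one_lt_y₃
  have a5 := P.y_sum
  have r1 : -P.y₁ / P.y₃ ≤ 1 := by rw [div_le_one (by linarith)]; linarith
  have r0 : 0 ≤ -P.y₁ / P.y₃ := div_nonneg (by linarith) (by linarith)
  have e : P.y₁ * P.y₂ / P.y₃ = -(P.y₂ * (-P.y₁ / P.y₃)) := by ring
  rw [e]
  generalize -P.y₁ / P.y₃ = r at *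
  have b1 : t * (1 - t) * (P.y₂ - P.y₁) * P.y₂ * r ≤ t * (1 - t) * (P.y₂ - P.y₁) * P.y₂ := by
    have : 0 ≤ t * (1 - t) * (P.y₂ - P.y₁) * P.y₂ := by
      have : 0 ≤ 1 - t := by linarith
      have : 0 ≤ P.y₂ - P.y₁ := by linarith
      positivity
    nlinarith
  -- Since `y + (1 - t)(y₂ - y₁) = y₂`, the terms containing the factor `t y₂` combine to `t y₂ (1 -
  -- y₂)`.
  have b2 : 0 < (1 - (P.y₁ * (1 - t) + P.y₂ * t)) * ((1 - t) * -P.y₁) + t * P.y₂ * (1 - P.y₂) := by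
    rcases h0.eq_or_lt with h | h
    · rw [← h]; nlinarith
    · have c1 : 0 ≤ (1 - (P.y₁ * (1 - t) + P.y₂ * t)) * ((1 - t) * -P.y₁) := by
        apply mul_nonneg <;> nlinarith
      have c2 : 0 < t * P.y₂ * (1 - P.y₂) := mul_pos (mul_pos h a2) (by linarith)
      linarith
  nlinarith

/-- If `formA` vanishes, `η = 0` forces `formB 0 = y₁ s` and `formB 1 = y₂ s` for one number `s`.
The equation `χ = 0` then becomes `s` times the non-zero coefficient of `kernel_coeff_pos`. -/
lemma snd_eq_zero (hq : 0 < P.q) {z v : C4} (hz : z ∈ spheres) (hv : IsTangent z v)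
    (hA : formA z v = 0) (hη : P.etaC z v = 0) (hχ : P.chiC z v = 0) :
    formBB z v = 0 ∧ sigC z v = 0 := by
  have hk := kap_pos (P := P) hz
  have hy := y₃_sub_yFun_pos (P := P) hz
  have a1 := y₁_neg hq
  have a2 := y₂_pos hq
  have a31 := y₃_sub_y₁_pos (P := P)
  have a32 := y₃_sub_y₂_pos (P := P)
  have ha := conj_mul_self_eq (z.2 0)
  have hb := conj_mul_self_eq (z.2 1)
  rw [norm_snd_one hz] at hb
  have hmu : ((P.kap z : ℝ) : ℂ) * muC z v
      = -(((‖z.2 0‖ ^ 2 * (1 - ‖z.2 0‖ ^ 2) * P.chiR z v : ℝ) : ℂ) * Complex.I) := by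
    rw [chiC_eq] at hχ
    rw [Complex.ofReal_mul, Complex.ofReal_mul, ← ha, ← hb, muC]
    linear_combination conj (z.2 0) * conj (z.2 1) * hχ
  have him : P.kap z * (muC z v).im = -(‖z.2 0‖ ^ 2 * (1 - ‖z.2 0‖ ^ 2) * P.chiR z v) := by
    have := congrArg Complex.im hmu
    rw [Complex.im_ofReal_mul, Complex.neg_im, Complex.im_ofReal_mul, Complex.I_im] at this
    linarith
  have hη' : P.y₂⁻¹ * formB 1 z v = P.y₁⁻¹ * formB 0 z v := by
    rw [etaC_apply, hA] at hη
    have : (P.y₂ - P.y₁) * (P.y₂⁻¹ * formB 1 z v - P.y₁⁻¹ * formB 0 z v) = 0 := by linarith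
    rcases mul_eq_zero.mp this with h | h <;> linarith
  obtain ⟨s, hs⟩ : ∃ s, s = P.y₁⁻¹ * formB 0 z v := ⟨_, rfl⟩
  have hb0 : formB 0 z v = P.y₁ * s := by rw [hs, mul_inv_cancel_left₀ a1.ne]
  have hb1 : formB 1 z v = P.y₂ * s := by
    rw [hs, ← hη', mul_inv_cancel_left₀ a2.ne']
  have hB : formBB z v = (P.y₁ + P.y₂) * s := by
    linarith [formB_zero_eq hz hv, formB_one_eq hz hv]
  have hι : (muC z v).im = s * ((1 - ‖z.2 0‖ ^ 2) * P.y₁ - ‖z.2 0‖ ^ 2 * P.y₂) := by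
    have := formB_zero_eq hz hv
    rw [hb0, hB] at this
    linarith
  have hR : P.chiR z v = -(s * ((P.y₂ - P.y₁) / (P.y₃ - P.yFun z)) * (P.y₁ * P.y₂ / P.y₃)) := by
    have e := y_rel' (P := P)
    have e2 := y₃_sub_mul (P := P)
    have h3 := P.one_lt_y₃
    have h3' : P.y₃ ≠ 0 := by linarith
    rw [chiR, hb0, hb1, hA]
    field_simp
    grind
  have ht0 : 0 ≤ ‖z.2 0‖ ^ 2 := by positivity
  have ht1 : ‖z.2 0‖ ^ 2 ≤ 1 := by linarith [hz.2, sq_nonneg ‖z.2 1‖]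
  have hneg := kernel_coeff_pos hq ht0 ht1
  have hs0 : s = 0 := by
    rw [hι, hR, kap] at him
    have : s * ((1 - P.yFun z) * ((1 - ‖z.2 0‖ ^ 2) * P.y₁ - ‖z.2 0‖ ^ 2 * P.y₂)
      - ‖z.2 0‖ ^ 2 * (1 - ‖z.2 0‖ ^ 2) * (P.y₂ - P.y₁) * (P.y₁ * P.y₂ / P.y₃)) = 0 := by
      have e : P.y₃ - P.yFun z ≠ 0 := hy.ne'
      field_simp at him
      linear_combination him
    rw [yFun_eq hz] at this
    rcases mul_eq_zero.mp this with h | h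
    · exact h
    · exact absurd h hneg.ne
  refine ⟨by rw [hB, hs0, mul_zero], ?_⟩
  have hR0 : P.chiR z v = 0 := by rw [hR, hs0]; ring
  rw [chiC_eq, hR0] at hχ
  have hk' : ((P.kap z : ℝ) : ℂ) ≠ 0 := by exact_mod_cast hk.ne'
  simpa [hk'] using hχ

lemma IsTangent.sub_smul {z v w : C4} (hv : IsTangent z v) (hw : IsTangent z w) (c : ℝ) :
    IsTangent z (v - c • w) := by
  obtain ⟨h1, h2⟩ := hv
  obtain ⟨h3, h4⟩ := hw
  constructor
  · have : conj (z.1 0) * (v - c • w).1 0 + conj (z.1 1) * (v - c • w).1 1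
      = (conj (z.1 0) * v.1 0 + conj (z.1 1) * v.1 1)
        - (c : ℂ) * (conj (z.1 0) * w.1 0 + conj (z.1 1) * w.1 1) := by
      simp; ring
    rw [this, Complex.sub_re, Complex.re_ofReal_mul, h1, h3]; ring
  · have : conj (z.2 0) * (v - c • w).2 0 + conj (z.2 1) * (v - c • w).2 1
      = (conj (z.2 0) * v.2 0 + conj (z.2 1) * v.2 1)
        - (c : ℂ) * (conj (z.2 0) * w.2 0 + conj (z.2 1) * w.2 1) := by
      simp; ring
    rw [this, Complex.sub_re, Complex.re_ofReal_mul, h2, h4]; ring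

/-- Subtracting the multiple of the generator with the same `formA` leaves a vector all of whose
components vanish in the decompositions of both spheres. -/
theorem eq_smul_gen (hq : 0 < P.q) {z v : C4} (hz : z ∈ spheres) (hv : IsTangent z v)
    (hτ : tauC z v = 0) (hη : P.etaC z v = 0) (hχ : P.chiC z v = 0) :
    ∃ c : ℝ, v = c • P.gen z := by
  have hp := P.p_pos'.ne'
  refine ⟨formA z v / P.p, ?_⟩
  set c := formA z v / P.p with hc
  have hw := hv.sub_smul (isTangent_gen (P := P) hz) c
  rw [← sub_eq_zero]
  set w := v - c • P.gen z with hwdef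
  have wA : formA z w = 0 := by
    rw [hwdef, map_sub, map_smul, formA_gen hz, smul_eq_mul, hc]; field_simp; ring
  have wη : P.etaC z w = 0 := by rw [hwdef, map_sub, map_smul, etaC_gen hq hz, hη]; simp
  have wχ : P.chiC z w = 0 := by rw [hwdef, map_sub, map_smul, chiC_gen hq hz, hχ]; simp
  have wτ : tauC z w = 0 := by rw [hwdef, map_sub, map_smul, tauC_gen, hτ]; simp
  obtain ⟨b, s⟩ := snd_eq_zero hq hz hw wA wη wχ
  obtain ⟨d1, d2⟩ := snd_decomp hz hw
  obtain ⟨e1, e2⟩ := tangent_decomp hz.1 hw.1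
  rw [← formA_apply, ← tauC_apply, wA, wτ] at e1 e2
  rw [b, s] at d1 d2
  refine Prod.ext (funext fun i => ?_) (funext fun i => ?_)
  · fin_cases i
    · simpa using e1
    · simpa using e2
  · fin_cases i
    · simpa using d1
    · simpa using d2

/-! ### Projection to the quotient -/

lemma rot_slice (κ : ChartIndex) {x : E5} (hx : x ∈ tgt) : P.rot κ (P.slice κ x) = 1 := by
  rw [rot, ph_slice_fst, ph_slice_snd, P.arg_inv_slice κ hx, div_self (P.angle_ne _ _)]
  simp

/-- The circle element that moves `z` into the slice. -/
def rotC (κ : ChartIndex) {z : C4} (hz : z ∈ P.dom κ) : Circle :=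
  ⟨P.rot κ z, mem_sphere_zero_iff_norm.mpr (P.norm_rot hz.1 hz.2.1)⟩

/-- `slice_coord` only asserts that some circle element moves `z` into the slice. It must be `rot κ
z`, because `rot` is `1` on the slice and is multiplied by `ζ⁻¹` under `ζ`; this explicit form can
be differentiated. -/
lemma act_rotC {κ : ChartIndex} {z : C4} (hs : z ∈ spheres) (hz : z ∈ P.dom κ) :
    P.act (rotC κ hz) z = P.slice κ (P.coord κ z) := by
  obtain ⟨ζ, h⟩ := P.slice_coord (κ := κ) (z := ⟨z, hs⟩) hz
  have h1 := P.rot_act κ ζ z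
  have h' : P.act ζ z = P.slice κ (P.coord κ z) := h
  rw [h', rot_slice κ (P.coord_tgt hz)] at h1
  have : rotC κ hz = ζ := by
    apply Circle.ext
    have := ζ.coe_ne_zero
    simp only [rotC]
    field_simp at h1
    exact h1.symm
  rw [this, h']

lemma differentiableAt_rot {κ : ChartIndex} {z : C4} (hz : z ∈ P.dom κ) :
    DifferentiableAt ℝ (P.rot κ) z := by
  obtain ⟨h1, h2, h3⟩ := hz
  have harg : ContDiffAt ℝ ∞ (fun y => (P.inv κ y).arg) z :=
    (P.contDiffAt_coord ⟨h1, h2, h3⟩).snd.snd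
  have hrot : ContDiffAt ℝ ∞ (P.rot κ) z := by
    unfold rot
    refine (contDiffAt_zpow' (contDiffAt_ph (contDiff_fst _).contDiffAt h1) (ph_ne h1) _).mul ?_
    exact contDiffAt_zpow' (f := fun y => ph (y.2 κ.j) / P.angle κ (P.inv κ y).arg)
      (contDiffAt_div' (contDiffAt_ph (contDiff_snd _).contDiffAt h2)
        ((P.contDiff_angle κ).contDiffAt.comp z harg) (P.angle_ne _ _))
      (div_ne_zero (ph_ne h2) (P.angle_ne _ _)) _
  exact hrot.differentiableAt (by simp)

lemma exists_deriv_of_norm_one {r : ℝ → ℂ} {r' : ℂ} (hr : HasDerivAt r r' 0)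
    (h1 : ∀ᶠ t in 𝓝 0, ‖r t‖ = 1) : ∃ c : ℝ, r' = c * Complex.I * r 0 := by
  have h0 : ‖r 0‖ = 1 := h1.self_of_nhds
  have hd : HasDerivAt (fun t => ‖r t‖ ^ 2) (2 * (conj (r 0) * r').re) 0 := by
    exact ((hasFDerivAt_sq_norm (r 0)).comp_hasDerivAt 0 hr).congr_deriv (by simp)
  have hc : HasDerivAt (fun t => ‖r t‖ ^ 2) 0 0 := by
    refine (hasDerivAt_const (0 : ℝ) (1 : ℝ)).congr_of_eventuallyEq ?_
    filter_upwards [h1] with t ht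
    rw [ht]; norm_num
  have hre : (conj (r 0) * r').re = 0 := by linarith [hd.unique hc]
  refine ⟨(conj (r 0) * r').im, ?_⟩
  have e : ((conj (r 0) * r').im : ℂ) * Complex.I = conj (r 0) * r' := by
    apply Complex.ext
    · simpa using hre.symm
    · simp
  have h2 := conj_mul_self_eq (r 0)
  rw [h0] at h2
  rw [e]
  push_cast at h2
  linear_combination (-r') * h2

/-- The slice point over `γ t` is `rot κ (γ t)` acting on `γ t`. The product rule gives the
transported velocity plus the velocity of the circle factor, a multiple of the generator. Forms that
vanish on the generator thus do not distinguish between lifts, apart from phases. -/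
theorem lift_curve {κ : ChartIndex} {γ : ℝ → C4} {w : C4} (hγ : HasDerivAt γ w 0)
    (hs : ∀ᶠ t in 𝓝 0, γ t ∈ spheres) (hd : γ 0 ∈ P.dom κ) :
    ∃ c : ℝ, fderiv ℝ (P.slice κ) (P.coord κ (γ 0)) (fderiv ℝ (P.coord κ) (γ 0) w)
      = P.act (rotC κ hd) w + c • P.gen (P.act (rotC κ hd) (γ 0)) := by
  have hdom : ∀ᶠ t in 𝓝 0, γ t ∈ P.dom κ :=
    hγ.continuousAt.eventually ((P.isOpen_dom κ).mem_nhds hd)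
  have hr : HasDerivAt (fun t => P.rot κ (γ t)) (fderiv ℝ (P.rot κ) (γ 0) w) 0 :=
    (differentiableAt_rot hd).hasFDerivAt.comp_hasDerivAt 0 hγ
  obtain ⟨c, hc⟩ := exists_deriv_of_norm_one hr (by
    filter_upwards [hdom] with t ht using P.norm_rot ht.1 ht.2.1)
  refine ⟨c, ?_⟩
  have hr0 : P.rot κ (γ 0) ≠ 0 :=
    norm_ne_zero_iff.mp (by rw [P.norm_rot hd.1 hd.2.1]; exact one_ne_zero)
  have hpow : ∀ n : ℤ, HasDerivAt (fun t => P.rot κ (γ t) ^ n)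
      (c * Complex.I * n * P.rot κ (γ 0) ^ n) 0 := by
    intro n
    have := (hasDerivAt_zpow n (P.rot κ (γ 0)) (Or.inl hr0)).comp_of_eq 0 hr rfl
    refine this.congr_deriv ?_
    rw [hc, zpow_sub_one₀ hr0]
    field_simp
  have lhs : HasDerivAt (fun t => P.slice κ (P.coord κ (γ t)))
      (fderiv ℝ (P.slice κ) (P.coord κ (γ 0)) (fderiv ℝ (P.coord κ) (γ 0) w)) 0 := by
    have h1 : HasDerivAt (fun t => P.coord κ (γ t)) (fderiv ℝ (P.coord κ) (γ 0) w) 0 :=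
      ((P.contDiffAt_coord hd).differentiableAt (by simp)).hasFDerivAt.comp_hasDerivAt 0 hγ
    exact ((P.contDiff_slice κ).differentiable (by simp) _).hasFDerivAt.comp_hasDerivAt 0 h1
  have hγ1 : ∀ i, HasDerivAt (fun t => (γ t).1 i) (w.1 i) 0 := fun i =>
    (dz i).hasFDerivAt.comp_hasDerivAt 0 hγ
  have hγ2 : ∀ i, HasDerivAt (fun t => (γ t).2 i) (w.2 i) 0 := fun i =>
    (dz' i).hasFDerivAt.comp_hasDerivAt 0 hγ
  have rhs : HasDerivAt (fun t => P.slice κ (P.coord κ (γ t)))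
      (P.act (rotC κ hd) w + c • P.gen (P.act (rotC κ hd) (γ 0))) 0 := by
    have e : (fun t => P.slice κ (P.coord κ (γ t))) =ᶠ[𝓝 0] fun t =>
        ((fun i => P.rot κ (γ t) ^ (P.p : ℤ) * (γ t).1 i,
          fun j => P.rot κ (γ t) ^ (-(P.wt j : ℤ)) * (γ t).2 j) : C4) := by
      filter_upwards [hdom, hs] with t h1 h2
      rw [← act_rotC h2 h1]
      rfl
    refine HasDerivAt.congr_of_eventuallyEq ?_ e
    have k1 : HasDerivAt (fun t i => P.rot κ (γ t) ^ (P.p : ℤ) * (γ t).1 i)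
        (P.act (rotC κ hd) w + c • P.gen (P.act (rotC κ hd) (γ 0))).1 0 := by
      refine hasDerivAt_pi.mpr fun i => ((hpow _).mul (hγ1 i)).congr_deriv ?_
      simp [act, gen, rotC]
      ring
    have k2 : HasDerivAt (fun t j => P.rot κ (γ t) ^ (-(P.wt j : ℤ)) * (γ t).2 j)
        (P.act (rotC κ hd) w + c • P.gen (P.act (rotC κ hd) (γ 0))).2 0 := by
      refine hasDerivAt_pi.mpr fun j => ((hpow _).mul (hγ2 j)).congr_deriv ?_
      simp [act, gen, rotC]
      ring
    exact k1.prodMk k2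
  exact lhs.unique rhs

end YParam

/-! ### Computing `g`, `η`, `dη` on `Y^{p,q}` from local lifts to `S³ × S³` -/

namespace YParam

variable {P : YParam}

lemma isTangent_of_hasDerivAt {γ : ℝ → C4} {w : C4} (hγ : HasDerivAt γ w 0)
    (hs : ∀ᶠ t in 𝓝 0, γ t ∈ spheres) : IsTangent (γ 0) w := by
  have hγ1 : ∀ i, HasDerivAt (fun t => (γ t).1 i) (w.1 i) 0 := fun i =>
    (dz i).hasFDerivAt.comp_hasDerivAt 0 hγ
  have hγ2 : ∀ i, HasDerivAt (fun t => (γ t).2 i) (w.2 i) 0 := fun i =>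
    (dz' i).hasFDerivAt.comp_hasDerivAt 0 hγ
  have hn : ∀ {r : ℝ → ℂ} {r' : ℂ}, HasDerivAt r r' 0 →
      HasDerivAt (fun t => ‖r t‖ ^ 2) (2 * (conj (r 0) * r').re) 0 := fun hr =>
    ((hasFDerivAt_sq_norm _).comp_hasDerivAt 0 hr).congr_deriv (by simp)
  have hc : HasDerivAt (fun _ : ℝ => (1 : ℝ)) 0 0 := hasDerivAt_const _ _
  constructor
  · have h := (hn (hγ1 0)).add (hn (hγ1 1))
    have h' := hc.congr_of_eventuallyEq (f₁ := (fun t => ‖(γ t).1 0‖ ^ 2) +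
      fun t => ‖(γ t).1 1‖ ^ 2) (by filter_upwards [hs] with t ht using ht.1)
    have := h.unique h'
    rw [Complex.add_re]; linarith
  · have h := (hn (hγ2 0)).add (hn (hγ2 1))
    have h' := hc.congr_of_eventuallyEq (f₁ := (fun t => ‖(γ t).2 0‖ ^ 2) +
      fun t => ‖(γ t).2 1‖ ^ 2) (by filter_upwards [hs] with t ht using ht.2)
    have := h.unique h'
    rw [Complex.add_re]; linarith

lemma rep_mem (m : P.Y) : P.rep m ∈ spheres := P.slice_mem _ _

section Lift

variable {E' : Type*} [NormedAddCommGroup E'] [NormedSpace ℝ E'] {Ψ : E' → C4} {D : E' →L[ℝ] C4}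
  {F : E' → P.Y} {q : E'}

lemma hasDerivAt_line (hΨ : HasFDerivAt Ψ D q) (v : E') :
    HasDerivAt (fun t : ℝ => Ψ (q + t • v)) (D v) 0 := by
  have h : HasDerivAt (fun t : ℝ => q + t • v) v 0 := by
    simpa using ((hasDerivAt_id (0 : ℝ)).smul_const v).const_add q
  exact HasFDerivAt.comp_hasDerivAt (x := (0 : ℝ)) (l := Ψ) (l' := D) (by simpa using hΨ) h

lemma eventually_line {s : E' → Prop} (hs : ∀ᶠ q' in 𝓝 q, s q') (v : E') :
    ∀ᶠ t : ℝ in 𝓝 0, s (q + t • v) := by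
  have : Filter.Tendsto (fun t : ℝ => q + t • v) (𝓝 0) (𝓝 q) := by
    have h : Continuous fun t : ℝ => q + t • v := by fun_prop
    simpa using h.tendsto 0
  exact this.eventually hs

lemma isTangent_of_hasFDerivAt (hΨ : HasFDerivAt Ψ D q) (hs : ∀ᶠ q' in 𝓝 q, Ψ q' ∈ spheres)
    (v : E') : IsTangent (Ψ q) (D v) := by
  simpa using isTangent_of_hasDerivAt (hasDerivAt_line hΨ v) (eventually_line hs v)

/-- `F` is locally the projection to `Y^{p,q}` of the differentiable map `Ψ` into `S³ × S³`. -/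
structure IsLift (F : E' → P.Y) (Ψ : E' → C4) (D : E' →L[ℝ] C4) (q : E') : Prop where
  deriv : HasFDerivAt Ψ D q
  proj : ∀ᶠ q' in 𝓝 q, ∃ h : Ψ q' ∈ spheres, F q' = P.proj ⟨Ψ q', h⟩

lemma IsLift.mem_spheres (h : IsLift F Ψ D q) : ∀ᶠ q' in 𝓝 q, Ψ q' ∈ spheres := by
  filter_upwards [h.proj] with q' hq' using hq'.1

lemma IsLift.isTangent (h : IsLift F Ψ D q) (v : E') : IsTangent (Ψ q) (D v) :=
  isTangent_of_hasFDerivAt h.deriv h.mem_spheres v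

lemma IsLift.mem_spheres' (h : IsLift F Ψ D q) : Ψ q ∈ spheres := h.mem_spheres.self_of_nhds

lemma IsLift.mem_dom (h : IsLift F Ψ D q) : Ψ q ∈ P.dom (P.idx (F q)) := by
  obtain ⟨hs, hF⟩ := h.proj.self_of_nhds
  have := (P.exists_chart (F q)).choose_spec
  have h2 : F q ∈ P.domY (P.idx (F q)) := this
  rw [hF] at h2 ⊢
  exact h2

lemma IsLift.coord_eq (h : IsLift F Ψ D q) :
    P.chart (P.idx (F q)) (F q) = P.coord (P.idx (F q)) (Ψ q) := by
  obtain ⟨hs, hF⟩ := h.proj.self_of_nhds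
  generalize P.idx (F q) = κ
  rw [hF]; rfl

/-- The derivative of a map into `Y^{p,q}`. -/
def dmap (F : E' → P.Y) (q : E') : E' →L[ℝ] TangentSpace 𝓘(ℝ, E5) (F q) :=
  mfderiv 𝓘(ℝ, E') 𝓘(ℝ, E5) F q

lemma IsLift.hasMFDerivAt (h : IsLift F Ψ D q) :
    HasMFDerivAt 𝓘(ℝ, E') 𝓘(ℝ, E5) F q
      ((fderiv ℝ (P.coord (P.idx (F q))) (Ψ q)).comp D : E' →L[ℝ] E5) := by
  have hd := h.mem_dom
  obtain ⟨κ, hκ⟩ : ∃ κ, κ = P.idx (F q) := ⟨_, rfl⟩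
  rw [← hκ] at hd ⊢
  have hco : HasFDerivAt (fun q' => P.coord κ (Ψ q')) ((fderiv ℝ (P.coord κ) (Ψ q)).comp D) q :=
    HasFDerivAt.comp q ((P.contDiffAt_coord hd).differentiableAt (by simp)).hasFDerivAt h.deriv
  have hdom : ∀ᶠ q' in 𝓝 q, Ψ q' ∈ P.dom κ :=
    h.deriv.continuousAt.eventually ((P.isOpen_dom κ).mem_nhds hd)
  constructor
  · have e : F =ᶠ[𝓝 q] fun q' => (P.chart κ).symm (P.coord κ (Ψ q')) := by
      filter_upwards [h.proj, hdom] with q' hq' hd'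
      obtain ⟨hs', hF'⟩ := hq'
      rw [hF']
      exact ((P.chart κ).left_inv (x := P.proj ⟨Ψ q', hs'⟩) hd').symm
    refine ContinuousAt.congr ?_ e.symm
    refine ContinuousAt.comp (g := (P.chart κ).symm) ?_ hco.continuousAt
    exact (P.chart κ).symm.continuousAt (P.coord_tgt hd)
  · have hco' : HasFDerivAt (fun q' => P.coordY κ (F q')) ((fderiv ℝ (P.coord κ) (Ψ q)).comp D) q := by
      refine hco.congr_of_eventuallyEq ?_
      filter_upwards [h.proj] with q' hq'
      obtain ⟨hs', hF'⟩ := hq'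
      rw [hF']
      rfl
    have e : writtenInExtChartAt 𝓘(ℝ, E') 𝓘(ℝ, E5) q F = fun q' => P.coordY κ (F q') := by
      rw [hκ]; rfl
    have := hco'.hasFDerivWithinAt (s := range 𝓘(ℝ, E'))
    rw [← e] at this
    exact this

lemma IsLift.dmap_apply (h : IsLift F Ψ D q) (v : E') :
    dmap F q v = fderiv ℝ (P.coord (P.idx (F q))) (Ψ q) (D v) :=
  DFunLike.congr_fun h.hasMFDerivAt.mfderiv v

/-- The circle element depends only on the point; only the correction along the generator depends on
`v`. -/
lemma IsLift.lift_eq (h : IsLift F Ψ D q) : ∃ ζ : Circle, P.rep (F q) = P.act ζ (Ψ q) ∧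
    ∀ v, ∃ c : ℝ, P.lift (F q) (dmap F q v)
      = P.act ζ (D v) + c • P.gen (P.act ζ (Ψ q)) := by
  have hd := h.mem_dom
  have hc := h.coord_eq
  refine ⟨rotC _ hd, ?_, fun v => ?_⟩
  · rw [rep, hc, act_rotC h.mem_spheres' hd]
  · obtain ⟨γ, hγ⟩ : ∃ γ : ℝ → C4, γ = fun t => Ψ (q + t • v) := ⟨_, rfl⟩
    have h0 : Ψ q = γ 0 := by simp [hγ]
    have hd' : HasDerivAt γ (D v) 0 := hγ ▸ hasDerivAt_line h.deriv v
    have hs : ∀ᶠ t in 𝓝 0, γ t ∈ spheres := hγ ▸ eventually_line h.mem_spheres v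
    rw [h.dmap_apply, lift, hc]
    revert hd
    rw [h0]
    exact fun hd => lift_curve hd' hs hd

lemma metricC_apply (z v w : C4) : P.metricC z v w =
    8 / 3 * (1 - P.yFun z) * (conj (tauC z v) * tauC z w).re
      + 4 / P.kap z * (conj (P.chiC z v) * P.chiC z w).re + P.etaC z v * P.etaC z w := by
  have : P.metricC z v w = 8 / 3 * (1 - P.yFun z) *
      ((tauC z v).re * (tauC z w).re + (tauC z v).im * (tauC z w).im)
      + 4 / P.kap z * ((P.chiC z v).re * (P.chiC z w).re + (P.chiC z v).im * (P.chiC z w).im)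
      + P.etaC z v * P.etaC z w := rfl
  rw [this]
  simp

lemma g_apply (m : P.Y) (v w : TangentSpace 𝓘(ℝ, E5) m) : P.contactMetric.g m v w
    = P.metricC (P.rep m) (P.lift m v) (P.lift m w) := rfl

lemma eta_apply (m : P.Y) (v : TangentSpace 𝓘(ℝ, E5) m) : P.contactMetric.η m v
    = P.etaC (P.rep m) (P.lift m v) := rfl

lemma deta_apply (m : P.Y) (v w : TangentSpace 𝓘(ℝ, E5) m) : P.contactMetric.dη m v w
    = P.omegaC (P.rep m) (P.lift m v) (P.lift m w) := rfl

/-- The forms `τ`, `χ` at a point of `Y^{p,q}` agree up to phases with those on `S³ × S³`. -/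
lemma IsLift.forms (h : IsLift F Ψ D q) (hq : 0 < P.q) :
    P.yFun (P.rep (F q)) = P.yFun (Ψ q) ∧
    (∀ v, P.contactMetric.η (F q) (dmap F q v) = P.etaC (Ψ q) (D v)) ∧
    ∃ a b : ℂ, ‖a‖ = 1 ∧ ‖b‖ = 1 ∧
    (∀ v, tauC (P.rep (F q)) (P.lift (F q) (dmap F q v))
      = a * tauC (Ψ q) (D v)) ∧
    (∀ v, P.chiC (P.rep (F q)) (P.lift (F q) (dmap F q v))
      = b * P.chiC (Ψ q) (D v)) ∧
    ∀ v, IsTangent (P.rep (F q)) (P.lift (F q) (dmap F q v)) := by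
  obtain ⟨ζ, hr, hl⟩ := h.lift_eq
  have hm := h.mem_spheres'
  have ha := act_mem_spheres (P := P) (ζ := ζ) hm
  refine ⟨by rw [hr, yFun_act], fun v => ?_, ((ζ : ℂ) ^ (P.p : ℤ)) ^ 2,
    (ζ : ℂ) ^ (-(P.wt 0 : ℤ)) * (ζ : ℂ) ^ (-(P.wt 1 : ℤ)), ?_, ?_, fun v => ?_, fun v => ?_,
    fun v => ?_⟩
  · obtain ⟨c, hc⟩ := hl v
    rw [eta_apply, hc, hr, map_add, map_smul, etaC_gen hq ha, etaC_act]; simp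
  · rw [norm_pow, norm_circle_zpow, one_pow]
  · rw [norm_mul, norm_circle_zpow, norm_circle_zpow, one_mul]
  · obtain ⟨c, hc⟩ := hl v
    rw [hc, hr, map_add, map_smul, tauC_gen, tauC_act]; simp
  · obtain ⟨c, hc⟩ := hl v
    rw [hc, hr, map_add, map_smul, chiC_gen hq ha, chiC_act]; simp
  · obtain ⟨c, hc⟩ := hl v
    have := (isTangent_act (P := P) (ζ := ζ) (h.isTangent v)).sub_smul (isTangent_gen (P := P) ha) (-c)
    rw [hc, hr]
    simpa using this

lemma conj_mul_phase {a x y : ℂ} (ha : ‖a‖ = 1) : conj (a * x) * (a * y) = conj x * y := by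
  have := conj_mul_self_eq a
  rw [ha] at this
  push_cast at this
  rw [map_mul]
  linear_combination (conj x * y) * this

lemma IsLift.eta (h : IsLift F Ψ D q) (hq : 0 < P.q) (v : E') :
    P.contactMetric.η (F q) (dmap F q v) = P.etaC (Ψ q) (D v) :=
  (h.forms hq).2.1 v

lemma IsLift.metric (h : IsLift F Ψ D q) (hq : 0 < P.q) (v w : E') :
    P.contactMetric.g (F q) (dmap F q v) (dmap F q w)
      = P.metricC (Ψ q) (D v) (D w) := by
  obtain ⟨hy, he, a, b, ha, hb, ht, hc, -⟩ := h.forms hq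
  simp only [eta_apply] at he
  have hk : P.kap (P.rep (F q)) = P.kap (Ψ q) := by rw [kap, kap, hy]
  rw [g_apply, metricC_apply, metricC_apply, he, he, hy, hk, ht, ht, hc, hc, conj_mul_phase ha,
    conj_mul_phase hb]

/-- `omegaC` is a derivative taken on all of `ℂ⁴`. On vectors tangent to the spheres `omegaC_eq`
expresses it by Hermitian products of `τ` and of `χ`, in which the phases cancel. -/
lemma IsLift.deta (h : IsLift F Ψ D q) (hq : 0 < P.q) (v w : E') :
    P.contactMetric.dη (F q) (dmap F q v)
      (dmap F q w)
      = 8 / 3 * (1 - P.yFun (Ψ q)) * (conj (tauC (Ψ q) (D v)) * tauC (Ψ q) (D w)).im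
      + 4 / P.kap (Ψ q) * (conj (P.chiC (Ψ q) (D v)) * P.chiC (Ψ q) (D w)).im := by
  obtain ⟨hy, he, a, b, ha, hb, ht, hc, htan⟩ := h.forms hq
  have hk : P.kap (P.rep (F q)) = P.kap (Ψ q) := by rw [kap, kap, hy]
  rw [deta_apply, omegaC_eq hq (rep_mem _) (htan v) (htan w), hy, hk, ht, ht, hc, hc,
    conj_mul_phase ha, conj_mul_phase hb]

end Lift

end YParam

/-! ### Coframes in local coordinates and the sections of `∧⁻H*` they define -/

namespace ContactMetricData

variable {E M : Type*} [NormedAddCommGroup E] [NormedSpace ℝ E]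
    [TopologicalSpace M] [ChartedSpace E M] {C : ContactMetricData E M}

/-- Four forms that express `g` and `dη` in the standard way form a coframe. -/
lemma exists_isCoframe (hE : Module.finrank ℝ E = 5) {x : M}
    {l : Fin 4 → TangentSpace 𝓘(ℝ, E) x →L[ℝ] ℝ}
    (metric : ∀ v w, C.g x v w = ∑ i, l i v * l i w + C.η x v * C.η x w)
    (deta : ∀ v w, C.dη x v w = (l 0 v * l 1 w - l 0 w * l 1 v) + (l 2 v * l 3 w - l 2 w * l 3 v))
    (xi : ∀ i, l i (C.ξ x) = 0) (eta_xi : C.η x (C.ξ x) = 1)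
    (nondeg : ∀ v, (∀ i, l i v = 0) → C.η x v = 0 → v = 0) : ∃ b, C.IsCoframe x l b := by
  let T : TangentSpace 𝓘(ℝ, E) x →ₗ[ℝ] (Fin 4 → ℝ) × ℝ :=
    (LinearMap.pi fun i => (l i : TangentSpace 𝓘(ℝ, E) x →ₗ[ℝ] ℝ)).prod
      (C.η x : TangentSpace 𝓘(ℝ, E) x →ₗ[ℝ] ℝ)
  have hT : ∀ v, T v = (fun i => l i v, C.η x v) := fun _ => rfl
  have hfin : Module.finrank ℝ (TangentSpace 𝓘(ℝ, E) x) = 5 := hE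
  have : FiniteDimensional ℝ (TangentSpace 𝓘(ℝ, E) x) :=
    Module.finite_of_finrank_pos (by rw [hfin]; norm_num)
  have inj : Function.Injective T := by
    rw [injective_iff_map_eq_zero]
    intro v hv
    rw [hT, Prod.mk_eq_zero] at hv
    exact nondeg v (fun i => congrFun hv.1 i) hv.2
  have surj : Function.Surjective T :=
    (LinearMap.injective_iff_surjective_of_finrank_eq_finrank (by rw [hfin]; simp)).mp inj
  choose b hb using fun j : Fin 4 => surj (Pi.single j 1, 0)
  simp only [hT, Prod.mk.injEq] at hb
  have hd : ∀ i j, l i (b j) = if i = j then 1 else 0 := fun i j => by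
    have := congrFun (hb j).1 i
    rw [this, Pi.single_apply]
  refine ⟨b, metric, deta, xi, hd, fun j => (hb j).2, fun v => inj ?_⟩
  rw [hT, hT]
  refine Prod.ext (funext fun i => ?_) ?_
  · simp [hd, xi]
  · simp [(hb _).2, eta_xi]

end ContactMetricData

namespace LocalCoord

variable {E E' M : Type*} [NormedAddCommGroup E] [NormedSpace ℝ E]
    [NormedAddCommGroup E'] [NormedSpace ℝ E'] [TopologicalSpace M] [ChartedSpace E M]
    {Θ : LocalCoord E E' M} {C : ContactMetricData E M}

/-- The coframe on `M` given by the forms `L` in the coordinates. -/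
def coframe (Θ : LocalCoord E E' M) (L : Fin 4 → E' → E' →L[ℝ] ℝ) (x : M) (i : Fin 4) :
    TangentSpace 𝓘(ℝ, E) x →L[ℝ] ℝ :=
  (L i (Θ.coords x)).comp (mfderiv 𝓘(ℝ, E) 𝓘(ℝ, E') Θ.coords x)

lemma coframe_param {q : E'} (hq : q ∈ Θ.target) (L : Fin 4 → E' → E' →L[ℝ] ℝ) (i : Fin 4)
    (v : E') : Θ.coframe L (Θ.param q) i (Θ.dparam q v) = L i q v := by
  have h1 : Θ.coframe L (Θ.param q) i (Θ.dparam q v)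
      = L i (Θ.coords (Θ.param q)) (Θ.dcoords q (Θ.dparam q v)) := rfl
  rw [h1, dcoords_dparam hq, coords_param hq]

/-- The forms `L` express, in the coordinates, a smooth coframe of `H`. -/
structure IsCoframeExpr (Θ : LocalCoord E E' M) (C : ContactMetricData E M)
    (L : Fin 4 → E' → E' →L[ℝ] ℝ) : Prop where
  smooth : ∀ i, ∀ q ∈ Θ.target, ContDiffAt ℝ ∞ (L i) q
  coframe : ∀ q ∈ Θ.target, ∃ b, C.IsCoframe (Θ.param q) (Θ.coframe L (Θ.param q)) b

variable {L : Fin 4 → E' → E' →L[ℝ] ℝ}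

lemma IsCoframeExpr.exists_isCoframe (h : Θ.IsCoframeExpr C L) {x : M} (hx : x ∈ Θ.source) :
    ∃ b, C.IsCoframe x (Θ.coframe L x) b := by
  have := h.coframe _ (coords_mem hx)
  rwa [param_coords hx] at this

open Classical in
/-- The section of `∧⁻H*` with coefficients `t` in the coframe `L`, extended by zero. -/
def IsCoframeExpr.toSection (h : Θ.IsCoframeExpr C L) (t : E' → Fin 3 → ℝ) (x : M) : C.asd x :=
  if hx : x ∈ Θ.source then
    ⟨asdForm (Θ.coframe L x) (t (Θ.coords x)), (h.exists_isCoframe hx).choose_spec.asdForm_mem _⟩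
  else 0

lemma IsCoframeExpr.toSection_of_mem (h : Θ.IsCoframeExpr C L) (t : E' → Fin 3 → ℝ) {x : M}
    (hx : x ∈ Θ.source) : (h.toSection t x).1 = asdForm (Θ.coframe L x) (t (Θ.coords x)) := by
  rw [IsCoframeExpr.toSection, dif_pos hx]

lemma IsCoframeExpr.toSection_param (h : Θ.IsCoframeExpr C L) (t : E' → Fin 3 → ℝ) {q : E'}
    (hq : q ∈ Θ.target) (v w : E') :
    (h.toSection t (Θ.param q)).1 ![Θ.dparam q v, Θ.dparam q w]
      = asdForm (fun i => L i q) (t q) ![v, w] := by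
  rw [h.toSection_of_mem t (param_mem hq), asdForm_apply, asdForm_apply, coords_param hq]
  simp only [coframe_param hq]

lemma IsCoframeExpr.exists_toSection_eq (h : Θ.IsCoframeExpr C L) {x : M} (hx : x ∈ Θ.source)
    (α : C.asd x) : ∃ t : Fin 3 → ℝ, h.toSection (fun _ => t) x = α := by
  obtain ⟨b, hb⟩ := h.exists_isCoframe hx
  refine ⟨![α.1 ![b 0, b 1], α.1 ![b 0, b 2], α.1 ![b 0, b 3]], Subtype.ext ?_⟩
  rw [h.toSection_of_mem _ hx]
  exact (hb.eq_asdForm α).symm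

lemma IsCoframeExpr.smoothFormAt_toSection [IsManifold 𝓘(ℝ, E) 1 M] [CompleteSpace E']
    (h : Θ.IsCoframeExpr C L) {t : E' → Fin 3 → ℝ} {q : E'} (hq : q ∈ Θ.target)
    (ht : ContDiffAt ℝ ∞ t q) : C.SmoothFormAt (h.toSection t) (Θ.param q) := by
  intro X Y hX hY
  refine contMDiffAt_of_comp_param hq ?_
  have hX' := contDiffAt_hat hq hX
  have hY' := contDiffAt_hat hq hY
  have hL : ∀ i, ContDiffAt ℝ ∞ (fun q' => L i q' (Θ.hat X q')) q := fun i =>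
    (h.smooth i q hq).clm_apply hX'
  have hL' : ∀ i, ContDiffAt ℝ ∞ (fun q' => L i q' (Θ.hat Y q')) q := fun i =>
    (h.smooth i q hq).clm_apply hY'
  have ht' : ∀ i, ContDiffAt ℝ ∞ (fun q' => t q' i) q := contDiffAt_pi.mp ht
  have e : (fun y => (h.toSection t y).1 ![X y, Y y]) ∘ Θ.param =ᶠ[𝓝 q]
      fun q' => asdForm (fun i => L i q') (t q') ![Θ.hat X q', Θ.hat Y q'] := by
    filter_upwards [Θ.open_target.mem_nhds hq] with q' hq'
    rw [← h.toSection_param t hq', dparam_hat hq', dparam_hat hq']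
    rfl
  refine ContDiffAt.congr_of_eventuallyEq ?_ e
  simp only [asdForm_apply]
  refine ContDiffAt.add (ContDiffAt.add ?_ ?_) ?_
  · exact (ht' 0).mul ((((hL 0).mul (hL' 1)).sub ((hL' 0).mul (hL 1))).sub
      (((hL 2).mul (hL' 3)).sub ((hL' 2).mul (hL 3))))
  · exact (ht' 1).mul ((((hL 0).mul (hL' 2)).sub ((hL' 0).mul (hL 2))).add
      (((hL 1).mul (hL' 3)).sub ((hL' 1).mul (hL 3))))
  · exact (ht' 2).mul ((((hL 0).mul (hL' 3)).sub ((hL' 0).mul (hL 3))).sub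
      (((hL 1).mul (hL' 2)).sub ((hL' 1).mul (hL 2))))

end LocalCoord

namespace YParam

variable {P : YParam}

/-! ### Nondegeneracy and the Reeb field -/

lemma hasDerivAt_act (z : C4) : HasDerivAt (fun t : ℝ => P.act (Circle.exp t) z) (P.gen z) 0 := by
  have hpow : ∀ n : ℤ, HasDerivAt (fun t : ℝ => ((Circle.exp t : Circle) : ℂ) ^ n)
      (Complex.I * n) 0 := by
    intro n
    have e : (fun t : ℝ => ((Circle.exp t : Circle) : ℂ) ^ n)
        = fun t : ℝ => Complex.exp ((t : ℂ) * (Complex.I * n)) := by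
      funext t
      rw [Circle.coe_exp, ← Complex.exp_int_mul]
      congr 1; ring
    rw [e]
    have h : HasDerivAt (fun t : ℝ => (t : ℂ) * (Complex.I * n)) (1 * (Complex.I * n)) 0 :=
      (Complex.ofRealCLM.hasDerivAt (x := (0 : ℝ))).mul_const _
    have h2 := h.cexp
    refine h2.congr_deriv ?_
    simp
  have k1 : HasDerivAt (fun (t : ℝ) i => ((Circle.exp t : Circle) : ℂ) ^ (P.p : ℤ) * z.1 i)
      (P.gen z).1 0 := by
    refine hasDerivAt_pi.mpr fun i => ((hpow _).mul_const _).congr_deriv ?_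
    simp [gen]
  have k2 : HasDerivAt (fun (t : ℝ) j => ((Circle.exp t : Circle) : ℂ) ^ (-(P.wt j : ℤ)) * z.2 j)
      (P.gen z).2 0 := by
    refine hasDerivAt_pi.mpr fun i => ((hpow _).mul_const _).congr_deriv ?_
    simp [gen]
  exact k1.prodMk k2

lemma fderiv_coord_gen {κ : ChartIndex} {z : C4} (hz : z ∈ P.dom κ) :
    fderiv ℝ (P.coord κ) z (P.gen z) = 0 := by
  have h1 : HasFDerivAt (P.coord κ) (fderiv ℝ (P.coord κ) z) (P.act (Circle.exp 0) z) := by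
    have : P.act (Circle.exp 0) z = z := by simp [act]
    rw [this]
    exact ((P.contDiffAt_coord hz).differentiableAt (by simp)).hasFDerivAt
  have h2 := h1.comp_hasDerivAt 0 (hasDerivAt_act (P := P) z)
  have e : P.coord κ ∘ (fun t : ℝ => P.act (Circle.exp t) z) = fun _ => P.coord κ z := by
    funext t
    exact P.coord_act κ _ z
  rw [e] at h2
  exact h2.unique (hasDerivAt_const _ _)

lemma fderiv_coord_slice (κ : ChartIndex) {x : E5} (hx : x ∈ tgt) (v : E5) :
    fderiv ℝ (P.coord κ) (P.slice κ x) (fderiv ℝ (P.slice κ) x v) = v := by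
  have h1 := ((P.contDiffAt_coord (P.slice_dom κ hx)).differentiableAt (by simp)).hasFDerivAt
  have h2 := ((P.contDiff_slice κ).differentiable (by simp) x).hasFDerivAt
  have h := h1.comp x h2
  have e : P.coord κ ∘ P.slice κ =ᶠ[𝓝 x] id := by
    filter_upwards [isOpen_tgt.mem_nhds hx] with y hy using P.coord_slice κ hy
  have h' := h.congr_of_eventuallyEq e.symm
  exact DFunLike.congr_fun (h'.unique (hasFDerivAt_id x)) v

lemma chart_mem_tgt (m : P.Y) : P.chart (P.idx m) m ∈ tgt :=
  (P.chart (P.idx m)).map_source (P.exists_chart m).choose_spec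

lemma isTangent_lift (m : P.Y) (v : E5) : IsTangent (P.rep m) (P.lift m v) :=
  isTangent_of_hasFDerivAt ((P.contDiff_slice _).differentiable (by simp) _).hasFDerivAt
    (Filter.Eventually.of_forall fun _ => P.slice_mem _ _) v

/-- By `eq_smul_gen` the lift of `v` is a multiple of the circle generator. The differential of the
coordinates kills the generator and is a left inverse of the lift. -/
lemma eq_zero_of_forms (hq : 0 < P.q) {m : P.Y} {v : TangentSpace 𝓘(ℝ, E5) m}
    (hτ : tauC (P.rep m) (P.lift m v) = 0) (hχ : P.chiC (P.rep m) (P.lift m v) = 0)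
    (hη : P.contactMetric.η m v = 0) : v = 0 := by
  obtain ⟨c, hc⟩ := eq_smul_gen hq (rep_mem m) (isTangent_lift m v) hτ hη hχ
  have h := fderiv_coord_slice (P := P) (P.idx m) (chart_mem_tgt m) v
  have hc' : fderiv ℝ (P.slice (P.idx m)) (P.chart (P.idx m) m) v
    = c • P.gen (P.slice (P.idx m) (P.chart (P.idx m) m)) := hc
  rw [hc', map_smul, fderiv_coord_gen (P.slice_dom _ (chart_mem_tgt m)), smul_zero] at h
  exact h.symm

/-- The flow lifts to rotations of `z₂`, `z₃` with speeds `s`, `r`. These are chosen so that `η` of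
the velocity is `|z₂|² + |z₃|² = 1`, while the two terms of `χ` cancel. -/
lemma reeb_forms (hq : 0 < P.q) (m : P.Y) :
    tauC (P.rep m) (P.lift m (P.reeb m)) = 0 ∧ P.chiC (P.rep m) (P.lift m (P.reeb m)) = 0 ∧
      P.contactMetric.η m (P.reeb m) = 1 := by
  obtain ⟨z, rfl⟩ : ∃ z : S3S3, P.proj z = m := Quotient.exists_rep m
  obtain ⟨s, hs⟩ : ∃ s, s = -3 * P.y₁ / (2 * (P.y₂ - P.y₁)) := ⟨_, rfl⟩
  obtain ⟨r, hr⟩ : ∃ r, r = 3 * P.y₂ / (2 * (P.y₂ - P.y₁)) := ⟨_, rfl⟩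
  let w : C4 := (0, ![s * Complex.I * z.1.2 0, r * Complex.I * z.1.2 1])
  have hexp : ∀ c : ℝ, ∀ a : ℂ, HasDerivAt (fun t : ℝ => ((Circle.exp (t * c) : Circle) : ℂ) * a)
      (c * Complex.I * a) 0 := by
    intro c a
    have h : HasDerivAt (fun t : ℝ => (t : ℂ) * (c * Complex.I)) (1 * (c * Complex.I)) 0 :=
      (Complex.ofRealCLM.hasDerivAt (x := (0 : ℝ))).mul_const _
    have h2 := h.cexp.mul_const a
    refine (h2.congr_deriv (by simp)).congr_of_eventuallyEq (Filter.Eventually.of_forall fun t => ?_)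
    simp only [Circle.coe_exp]
    push_cast
    ring_nf
  have hd : HasDerivAt (fun t : ℝ => (rotS (t * s) (t * r) z).1) w 0 := by
    refine HasDerivAt.prodMk (hasDerivAt_const _ _) (hasDerivAt_pi.mpr fun j => ?_)
    fin_cases j
    · exact hexp s _
    · exact hexp r _
  have hl : IsLift (P := P) (fun t : ℝ => P.reebFlow t (P.proj z))
      (fun t : ℝ => (rotS (t * s) (t * r) z).1) (ContinuousLinearMap.toSpanSingleton ℝ w) 0 := by
    refine ⟨hd.hasFDerivAt, Filter.Eventually.of_forall fun t => ⟨(rotS (t * s) (t * r) z).2, ?_⟩⟩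
    rw [hs, hr]; rfl
  have h0 : P.reebFlow 0 (P.proj z) = P.proj z := by
    have : rotS 0 0 z = z := by
      apply Subtype.ext
      refine Prod.ext rfl (funext fun k => ?_)
      fin_cases k <;> simp [rotS]
    have h2 : P.reebFlow 0 (P.proj z) = P.proj (rotS 0 0 z) := by
      simp only [reebFlow, zero_mul]; rfl
    rw [h2, this]
  have z0 : (rotS (0 * s) (0 * r) z).1 = z.1 := by
    refine Prod.ext rfl (funext fun k => ?_)
    fin_cases k <;> simp [rotS]
  obtain ⟨-, he, a, b, -, -, ht, hc, -⟩ := hl.forms hq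
  have hw : ContinuousLinearMap.toSpanSingleton ℝ w (1 : ℝ) = w := by simp
  -- The velocity is attached to `reebFlow 0 (proj z)`, which is `proj z` only propositionally; this
  -- transports the three forms.
  have key : ∀ (m m' : P.Y) (v : E5), m' = m →
      tauC (P.rep m) (P.lift m v) = tauC (P.rep m') (P.lift m' v) ∧
      P.chiC (P.rep m) (P.lift m v) = P.chiC (P.rep m') (P.lift m' v) ∧
      P.etaC (P.rep m) (P.lift m v) = P.etaC (P.rep m') (P.lift m' v) := by
    rintro m _ v rfl; exact ⟨rfl, rfl, rfl⟩
  obtain ⟨k1, k2, k3⟩ := key _ _ (P.reeb (P.proj z)) h0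
  have y1 := (y₁_neg hq).ne
  have y2 := (y₂_pos hq).ne'
  have y21 := (y_sub_pos hq).ne'
  have n1 := norm_snd_one z.2
  have b0 : formB 0 z.1 w = s * ‖z.1.2 0‖ ^ 2 := by
    have h := conj_mul_self_eq (z.1.2 0)
    have e : conj (z.1.2 0) * w.2 0 = ((s * ‖z.1.2 0‖ ^ 2 : ℝ) : ℂ) * Complex.I := by
      push_cast at h ⊢
      rw [← h]; simp [w]; ring
    rw [formB_apply, e]; simp [-Complex.ofReal_mul]
  have b1 : formB 1 z.1 w = r * ‖z.1.2 1‖ ^ 2 := by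
    have h := conj_mul_self_eq (z.1.2 1)
    have e : conj (z.1.2 1) * w.2 1 = ((r * ‖z.1.2 1‖ ^ 2 : ℝ) : ℂ) * Complex.I := by
      push_cast at h ⊢
      rw [← h]; simp [w]; ring
    rw [formB_apply, e]; simp [-Complex.ofReal_mul]
  have a0 : formA z.1 w = 0 := by simp [formA_apply, w]
  refine ⟨k1.trans ((ht 1).trans ?_), k2.trans ((hc 1).trans ?_), k3.trans ((he 1).trans ?_)⟩
  · rw [hw]; simp [tauC_apply, w]
  · rw [hw]
    simp only [z0]
    have hR : P.chiR z.1 w = P.kap z.1 * (r - s) := by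
      have g1 := (y₃_sub_yFun_pos (P := P) z.2).ne'
      rw [chiR, kap, b0, b1, a0, n1, yFun_eq z.2] at *
      have e := y_rel' (P := P)
      have e1 := y_sum P
      have e2 := y₃_sub_mul (P := P)
      have g2 := (y₃_sub_y₁_pos (P := P)).ne'
      have g3 := (y₃_sub_y₂_pos (P := P)).ne'
      rw [hs, hr]
      field_simp
      grind
    rw [chiC_apply, hR]
    simp [w]
    right
    ring
  · rw [hw]
    simp only [z0]
    rw [etaC_apply, b0, b1, a0, n1, hs, hr]
    field_simp
    ring

end YParam

namespace YParam

variable {P : YParam}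

/-! ### Coframes from lifts to `S³ × S³` -/

lemma finrank_E5 : Module.finrank ℝ E5 = 5 := by
  simp [E5, Complex.finrank_real_complex]

section Lift

variable {E' : Type*} [NormedAddCommGroup E'] [NormedSpace ℝ E'] {Ψ : E' → C4}
  {D : E' → E' →L[ℝ] C4} {L : Fin 4 → E' → E' →L[ℝ] ℝ}

/-- The real forms `L` are, up to complex factors, the real and imaginary parts of `τ` and `χ`. -/
def IsPolar (P : YParam) (z : C4) (D : E' →L[ℝ] C4) (l : Fin 4 → E' →L[ℝ] ℝ) : Prop :=
  ∃ a b : ℂ, 8 / 3 * (1 - P.yFun z) * ‖a‖ ^ 2 = 1 ∧ 4 / P.kap z * ‖b‖ ^ 2 = 1 ∧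
    ∀ v, tauC z (D v) = a * (l 0 v + l 1 v * Complex.I) ∧
      P.chiC z (D v) = b * (l 2 v + l 3 v * Complex.I)

lemma conj_mul_polar (a : ℂ) (x y x' y' : ℝ) :
    conj (a * (x + y * Complex.I)) * (a * (x' + y' * Complex.I))
      = ((‖a‖ ^ 2 * (x * x' + y * y') : ℝ) : ℂ)
        + ((‖a‖ ^ 2 * (x * y' - x' * y) : ℝ) : ℂ) * Complex.I := by
  have h := conj_mul_self_eq a
  rw [Complex.ofReal_mul, Complex.ofReal_mul, ← h]
  simp only [map_mul, map_add, Complex.conj_ofReal, Complex.conj_I]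
  push_cast
  linear_combination -(conj a * a * y * y') * Complex.I_mul_I

lemma re_conj_mul_polar (a : ℂ) (x y x' y' : ℝ) :
    (conj (a * (x + y * Complex.I)) * (a * (x' + y' * Complex.I))).re
      = ‖a‖ ^ 2 * (x * x' + y * y') := by
  rw [conj_mul_polar]; simp [-Complex.ofReal_mul]

lemma im_conj_mul_polar (a : ℂ) (x y x' y' : ℝ) :
    (conj (a * (x + y * Complex.I)) * (a * (x' + y' * Complex.I))).im
      = ‖a‖ ^ 2 * (x * y' - x' * y) := by
  rw [conj_mul_polar]; simp [-Complex.ofReal_mul]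

lemma IsPolar.metric {z : C4} {D : E' →L[ℝ] C4} {l : Fin 4 → E' →L[ℝ] ℝ} (h : IsPolar P z D l)
    (v w : E') : P.metricC z (D v) (D w)
      = ∑ i, l i v * l i w + P.etaC z (D v) * P.etaC z (D w) := by
  obtain ⟨a, b, ha, hb, hl⟩ := h
  rw [metricC_apply, (hl v).1, (hl v).2, (hl w).1, (hl w).2, re_conj_mul_polar, re_conj_mul_polar,
    Fin.sum_univ_four]
  linear_combination (l 0 v * l 0 w + l 1 v * l 1 w) * ha + (l 2 v * l 2 w + l 3 v * l 3 w) * hb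

lemma IsPolar.deta {z : C4} {D : E' →L[ℝ] C4} {l : Fin 4 → E' →L[ℝ] ℝ} (h : IsPolar P z D l)
    (v w : E') : 8 / 3 * (1 - P.yFun z) * (conj (tauC z (D v)) * tauC z (D w)).im
      + 4 / P.kap z * (conj (P.chiC z (D v)) * P.chiC z (D w)).im
      = (l 0 v * l 1 w - l 0 w * l 1 v) + (l 2 v * l 3 w - l 2 w * l 3 v) := by
  obtain ⟨a, b, ha, hb, hl⟩ := h
  rw [(hl v).1, (hl v).2, (hl w).1, (hl w).2, im_conj_mul_polar, im_conj_mul_polar]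
  linear_combination (l 0 v * l 1 w - l 0 w * l 1 v) * ha + (l 2 v * l 3 w - l 2 w * l 3 v) * hb

lemma ofReal_add_mul_I_eq_zero {x y : ℝ} : (x : ℂ) + y * Complex.I = 0 ↔ x = 0 ∧ y = 0 := by
  rw [Complex.ext_iff]; simp

lemma IsPolar.eq_zero_iff {z : C4} {D : E' →L[ℝ] C4} {l : Fin 4 → E' →L[ℝ] ℝ}
    (h : IsPolar P z D l) (v : E') :
    (∀ i, l i v = 0) ↔ tauC z (D v) = 0 ∧ P.chiC z (D v) = 0 := by
  obtain ⟨a, b, ha, hb, hl⟩ := h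
  have a0 : a ≠ 0 := by rintro rfl; simp at ha
  have b0 : b ≠ 0 := by rintro rfl; simp at hb
  rw [(hl v).1, (hl v).2, mul_eq_zero, mul_eq_zero, or_iff_right a0, or_iff_right b0,
    ofReal_add_mul_I_eq_zero, ofReal_add_mul_I_eq_zero, Fin.forall_fin_succ]
  simp [Fin.forall_fin_succ]
  tauto

lemma IsLift.eq_zero_iff {F : E' → P.Y} {D : E' →L[ℝ] C4} {q : E'} (h : IsLift F Ψ D q)
    (hq : 0 < P.q) (v : E') : (tauC (P.rep (F q)) (P.lift (F q) (dmap F q v)) = 0 ∧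
      P.chiC (P.rep (F q)) (P.lift (F q) (dmap F q v)) = 0)
      ↔ tauC (Ψ q) (D v) = 0 ∧ P.chiC (Ψ q) (D v) = 0 := by
  obtain ⟨-, -, a, b, ha, hb, ht, hc, -⟩ := h.forms hq
  have a0 : a ≠ 0 := by rintro rfl; simp at ha
  have b0 : b ≠ 0 := by rintro rfl; simp at hb
  rw [ht, hc, mul_eq_zero, mul_eq_zero, or_iff_right a0, or_iff_right b0]

/-- Every tangent vector is an image under `dparam`, where `g`, `η`, `dη` are read off from the
lift. The normalization in `IsPolar` gives `g` and `dη` their standard form, and the values of `τ`,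
`χ`, `η` on `ξ` come from `reeb_forms`. -/
theorem isCoframeExpr_of_lift (hq : 0 < P.q) {Θ : LocalCoord E5 E' P.Y}
    (hl : ∀ q ∈ Θ.target, IsLift Θ.param Ψ (D q) q)
    (hL : ∀ i, ∀ q ∈ Θ.target, ContDiffAt ℝ ∞ (L i) q)
    (hp : ∀ q ∈ Θ.target, IsPolar P (Ψ q) (D q) fun i => L i q) :
    Θ.IsCoframeExpr P.contactMetric L := by
  refine ⟨hL, fun q hqt => ?_⟩
  have h := hl q hqt
  have hp' := hp q hqt
  have hsurj : ∀ v : TangentSpace 𝓘(ℝ, E5) (Θ.param q), ∃ w, v = Θ.dparam q w :=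
    fun v => ⟨_, (LocalCoord.dparam_dcoords hqt v).symm⟩
  obtain ⟨r1, r2, r3⟩ := reeb_forms hq (Θ.param q)
  refine ContactMetricData.exists_isCoframe finrank_E5 (fun v w => ?_) (fun v w => ?_) ?_ r3
    (fun v hv hv' => ?_)
  · obtain ⟨v, rfl⟩ := hsurj v
    obtain ⟨w, rfl⟩ := hsurj w
    simp only [LocalCoord.coframe_param hqt]
    have e1 := h.metric hq v w
    have e2 := h.eta hq v
    have e3 := h.eta hq w
    rw [hp'.metric, ← e2, ← e3] at e1
    exact e1
  · obtain ⟨v, rfl⟩ := hsurj v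
    obtain ⟨w, rfl⟩ := hsurj w
    simp only [LocalCoord.coframe_param hqt]
    have e1 := h.deta hq v w
    rw [hp'.deta] at e1
    exact e1
  · obtain ⟨w, hw⟩ := hsurj (P.contactMetric.ξ (Θ.param q))
    have e : (P.contactMetric.ξ (Θ.param q)) = P.reeb (Θ.param q) := rfl
    rw [hw]
    simp only [LocalCoord.coframe_param hqt]
    refine (hp'.eq_zero_iff w).mpr ((h.eq_zero_iff hq w).mp ?_)
    rw [← e, hw] at r1 r2
    exact ⟨r1, r2⟩
  · obtain ⟨v, rfl⟩ := hsurj v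
    simp only [LocalCoord.coframe_param hqt] at hv
    obtain ⟨k1, k2⟩ := (h.eq_zero_iff hq v).mpr ((hp'.eq_zero_iff v).mp hv)
    exact eq_zero_of_forms hq k1 k2 hv'

/-- The difference of the two vectors is annihilated by `τ`, `χ` and `η`, so `eq_zero_of_forms`
applies. -/
lemma reeb_eq_of_lift (hq : 0 < P.q) {Θ : LocalCoord E5 E' P.Y} {q : E'} {D : E' →L[ℝ] C4}
    (h : IsLift Θ.param Ψ D q) {r : E'} (hτ : tauC (Ψ q) (D r) = 0) (hχ : P.chiC (Ψ q) (D r) = 0)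
    (hη : P.etaC (Ψ q) (D r) = 1) : P.contactMetric.ξ (Θ.param q) = Θ.dparam q r := by
  obtain ⟨r1, r2, r3⟩ := reeb_forms hq (Θ.param q)
  obtain ⟨k1, k2⟩ := (h.eq_zero_iff hq r).mpr ⟨hτ, hχ⟩
  have k3 : P.contactMetric.η (Θ.param q) (Θ.dparam q r) = 1 := (h.eta hq r).trans hη
  rw [← sub_eq_zero]
  refine eq_zero_of_forms hq ?_ ?_ ?_
  · refine (congrArg _ (map_sub (P.lift (Θ.param q)) (P.reeb _) (Θ.dparam q r))).trans ?_
    refine (map_sub (tauC (P.rep (Θ.param q))) _ _).trans ?_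
    exact sub_eq_zero.mpr (r1.trans k1.symm)
  · refine (congrArg _ (map_sub (P.lift (Θ.param q)) (P.reeb _) (Θ.dparam q r))).trans ?_
    refine (map_sub (P.chiC (P.rep (Θ.param q))) _ _).trans ?_
    exact sub_eq_zero.mpr (r2.trans k2.symm)
  · rw [map_sub, k3, sub_eq_zero]
    exact r3

end Lift

/-! ### The charts of the atlas -/

/-- The charts of the atlas as smooth coordinates. -/
def chartCoord (P : YParam) (κ : ChartIndex) : LocalCoord E5 E5 P.Y where
  toOpenPartialHomeomorph := P.chart κ
  smooth_toFun := contMDiffOn_of_mem_maximalAtlas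
    (IsManifold.subset_maximalAtlas (show P.chart κ ∈ atlas E5 P.Y from ⟨κ, rfl⟩))
  smooth_invFun := contMDiffOn_symm_of_mem_maximalAtlas
    (IsManifold.subset_maximalAtlas (show P.chart κ ∈ atlas E5 P.Y from ⟨κ, rfl⟩))

lemma isLift_chartCoord (κ : ChartIndex) (x : E5) :
    IsLift (P.chartCoord κ).param (P.slice κ) (fderiv ℝ (P.slice κ) x) x :=
  ⟨((P.contDiff_slice κ).differentiable (by simp) x).hasFDerivAt,
    Filter.Eventually.of_forall fun _ => ⟨P.slice_mem κ _, rfl⟩⟩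

lemma contDiff_coordinate (j : Fin 2) : ContDiff ℝ ∞ (fun z : C4 => z.2 j) := (dz' j).contDiff

lemma contDiff_coordinate' (j : Fin 2) : ContDiff ℝ ∞ (fun z : C4 => z.1 j) := (dz j).contDiff

lemma contDiff_yFun : ContDiff ℝ ∞ P.yFun :=
  (((contDiff_coordinate 1).norm_sq ℝ).const_smul P.y₁).add
    (((contDiff_coordinate 0).norm_sq ℝ).const_smul P.y₂)

lemma contDiffAt_kap {z : C4} (hz : z ∈ spheres) : ContDiffAt ℝ ∞ P.kap z :=
  (contDiffAt_const.sub contDiff_yFun.contDiffAt).div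
    (contDiffAt_const.sub contDiff_yFun.contDiffAt) (y₃_sub_yFun_pos hz).ne'

lemma contDiff_tauC : ContDiff ℝ ∞ tauC :=
  ((contDiff_coordinate' 1).smul contDiff_const).sub ((contDiff_coordinate' 0).smul contDiff_const)

lemma contDiffAt_chiC {z : C4} (hz : z ∈ spheres) : ContDiffAt ℝ ∞ P.chiC z := by
  have hk := contDiffAt_kap (P := P) hz
  have h0 := (contDiff_coordinate 0).contDiffAt (x := z)
  have h1 := (contDiff_coordinate 1).contDiffAt (x := z)
  have hA : ContDiffAt ℝ ∞ formA z := formAL.contDiff.contDiffAt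
  have hB : ∀ j, ContDiffAt ℝ ∞ (formB j) z := fun j => (formBL j).contDiff.contDiffAt
  have hy : ContDiffAt ℝ ∞ (fun z => (P.y₂ - P.y₁) * (P.y₃ - 1) / (P.y₃ - P.yFun z)) z :=
    contDiffAt_const.div (contDiffAt_const.sub contDiff_yFun.contDiffAt) (y₃_sub_yFun_pos hz).ne'
  have hR := (hy.smul (((hB 0).const_smul (P.y₃ - P.y₁)⁻¹).add
    ((hB 1).const_smul (P.y₃ - P.y₂)⁻¹))).sub (hA.const_smul (2 / 3 * (P.y₂ - P.y₁)))
  have hk' : ContDiffAt ℝ ∞ (fun z => (P.kap z : ℂ)) z :=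
    Complex.ofRealCLM.contDiff.contDiffAt.comp z hk
  exact (hk'.smul ((h1.smul contDiffAt_const).sub (h0.smul contDiffAt_const))).add
    (((contDiffAt_const.mul h0).mul h1).smul (contDiffAt_const.clm_comp hR))

/-- The coframe given by `τ` and `χ` in a chart of the atlas. -/
def chartForms (P : YParam) (κ : ChartIndex) (i : Fin 4) (x : E5) : E5 →L[ℝ] ℝ :=
  ![√(8 / 3 * (1 - P.yFun (P.slice κ x))) •
      Complex.reCLM.comp ((tauC (P.slice κ x)).comp (fderiv ℝ (P.slice κ) x)),
    √(8 / 3 * (1 - P.yFun (P.slice κ x))) •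
      Complex.imCLM.comp ((tauC (P.slice κ x)).comp (fderiv ℝ (P.slice κ) x)),
    √(4 / P.kap (P.slice κ x)) •
      Complex.reCLM.comp ((P.chiC (P.slice κ x)).comp (fderiv ℝ (P.slice κ) x)),
    √(4 / P.kap (P.slice κ x)) •
      Complex.imCLM.comp ((P.chiC (P.slice κ x)).comp (fderiv ℝ (P.slice κ) x))] i

/-- Toric coordinates fail where some `zₖ` vanishes. This coframe exists around every point and
supplies the smooth local sections for the passage to the limit. -/
lemma isCoframeExpr_chartCoord (hq : 0 < P.q) (κ : ChartIndex) :
    (P.chartCoord κ).IsCoframeExpr P.contactMetric (P.chartForms κ) := by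
  refine isCoframeExpr_of_lift (Ψ := P.slice κ) (D := fderiv ℝ (P.slice κ)) hq
    (fun x _ => isLift_chartCoord κ x) (fun i x _ => ?_) (fun x _ => ?_)
  · have hs := P.slice_mem κ x
    have h1 : ContDiffAt ℝ ∞ (P.slice κ) x := (P.contDiff_slice κ).contDiffAt
    have h2 : ContDiffAt ℝ ∞ (fderiv ℝ (P.slice κ)) x :=
      ((P.contDiff_slice κ).fderiv_right (m := ∞) (by simp)).contDiffAt
    have ht := (contDiff_tauC.contDiffAt.comp x h1).clm_comp h2
    have hc := ((contDiffAt_chiC (P := P) hs).comp x h1).clm_comp h2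
    have y0 := one_sub_yFun_pos (P := P) hs
    have k0 := kap_pos (P := P) hs
    have s1 : ContDiffAt ℝ ∞ (fun x => √(8 / 3 * (1 - P.yFun (P.slice κ x)))) x :=
      (contDiffAt_const.mul (contDiffAt_const.sub
        (contDiff_yFun.contDiffAt.comp x h1))).sqrt (by simp only [Function.comp]; positivity)
    have s2 : ContDiffAt ℝ ∞ (fun x => √(4 / P.kap (P.slice κ x))) x :=
      (contDiffAt_const.div ((contDiffAt_kap hs).comp x h1) k0.ne').sqrt
        (div_pos four_pos k0).ne'
    fin_cases i
    · exact s1.smul (contDiffAt_const.clm_comp ht)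
    · exact s1.smul (contDiffAt_const.clm_comp ht)
    · exact s2.smul (contDiffAt_const.clm_comp hc)
    · exact s2.smul (contDiffAt_const.clm_comp hc)
  · have hs := P.slice_mem κ x
    have y0 := one_sub_yFun_pos (P := P) hs
    have k0 := kap_pos (P := P) hs
    have key : ∀ c : ℝ, 0 < c → c * ‖(((√c)⁻¹ : ℝ) : ℂ)‖ ^ 2 = 1 := by
      intro c hc
      rw [Complex.norm_real, Real.norm_eq_abs, sq_abs, inv_pow, Real.sq_sqrt hc.le,
        mul_inv_cancel₀ hc.ne']
    have key2 : ∀ c : ℝ, 0 < c → ∀ w : ℂ,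
        w = (((√c)⁻¹ : ℝ) : ℂ) * ((√c * w.re : ℝ) + (√c * w.im : ℝ) * Complex.I) := by
      intro c hc w
      have : ((√c : ℝ) : ℂ) ≠ 0 := by exact_mod_cast (Real.sqrt_pos.mpr hc).ne'
      conv_lhs => rw [← Complex.re_add_im w]
      push_cast
      field_simp
    refine ⟨_, _, key (8 / 3 * (1 - P.yFun (P.slice κ x))) (by positivity),
      key (4 / P.kap (P.slice κ x)) (by positivity), fun v => ⟨?_, ?_⟩⟩
    · exact key2 _ (by positivity) _
    · exact key2 _ (by positivity) _

end YParam

/-- The space of the coordinates `(x, φ, y, β, ψ)` with `x = cos θ`. -/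
abbrev R5 : Type := Fin 5 → ℝ

namespace YParam

variable {P : YParam}

/-! ### Toric coordinates on the dense open set where no coordinate vanishes -/

/-- The coordinate forms on `R5`. -/
def pr (i : Fin 5) : R5 →L[ℝ] ℝ := ContinuousLinearMap.proj i

@[simp] lemma pr_apply (i : Fin 5) (v : R5) : pr i v = v i := rfl

/-- `θ₂` as a function of `β`, `ψ`. -/
def argTwo (P : YParam) : R5 →L[ℝ] ℝ :=
  (-(P.y₂ - P.y₁)⁻¹) • ((P.y₁ * P.y₂) • pr 3 + P.y₁ • pr 4)

/-- `θ₃` as a function of `β`, `ψ`. -/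
def argThree (P : YParam) : R5 →L[ℝ] ℝ :=
  ((P.y₂ - P.y₁)⁻¹) • ((P.y₁ * P.y₂) • pr 3 + P.y₂ • pr 4)

/-- The complex number with given squared absolute value and argument. -/
def polar (r t : ℝ) : ℂ := (√r : ℝ) * Complex.exp (t * Complex.I)

lemma norm_polar {r : ℝ} (hr : 0 ≤ r) (t : ℝ) : ‖polar r t‖ ^ 2 = r := by
  rw [polar, norm_mul, Complex.norm_exp_ofReal_mul_I, mul_one, Complex.norm_real,
    Real.norm_eq_abs, sq_abs, Real.sq_sqrt hr]

/-- The range of the toric coordinates. -/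
def toricDom (P : YParam) : Set R5 := {q | -1 < q 0 ∧ q 0 < 1 ∧ P.y₁ < q 2 ∧ q 2 < P.y₂}

lemma isOpen_toricDom : IsOpen P.toricDom := by
  refine IsOpen.inter ?_ (IsOpen.inter ?_ (IsOpen.inter ?_ ?_))
  · exact isOpen_lt continuous_const (continuous_apply _)
  · exact isOpen_lt (continuous_apply _) continuous_const
  · exact isOpen_lt continuous_const (continuous_apply _)
  · exact isOpen_lt (continuous_apply _) continuous_const

/-- The point of `S³ × S³` with given toric coordinates. -/
def toric (P : YParam) (q : R5) : C4 :=
  -- The circle action is used to normalize `θ₀ + θ₁ = 0`, so `θ₀ = φ/2` and `θ₁ = -φ/2`. Then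
  -- `argTwo` and `argThree` solve `ψ = θ₂ + θ₃` and `β = -θ₂/y₁ - θ₃/y₂`.
  (![polar ((1 - q 0) / 2) (q 1 / 2), polar ((1 + q 0) / 2) (-q 1 / 2)],
   ![polar ((q 2 - P.y₁) / (P.y₂ - P.y₁)) (P.argTwo q),
     polar ((P.y₂ - q 2) / (P.y₂ - P.y₁)) (P.argThree q)])

lemma norm_toric {q : R5} (hq : 0 < P.q) (h : q ∈ P.toricDom) :
    ‖(P.toric q).1 0‖ ^ 2 = (1 - q 0) / 2 ∧ ‖(P.toric q).1 1‖ ^ 2 = (1 + q 0) / 2 ∧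
    ‖(P.toric q).2 0‖ ^ 2 = (q 2 - P.y₁) / (P.y₂ - P.y₁) ∧
    ‖(P.toric q).2 1‖ ^ 2 = (P.y₂ - q 2) / (P.y₂ - P.y₁) := by
  obtain ⟨h1, h2, h3, h4⟩ := h
  have h5 := y_sub_pos hq
  exact ⟨norm_polar (by linarith) _, norm_polar (by linarith) _,
    norm_polar (div_nonneg (by linarith) h5.le) _, norm_polar (div_nonneg (by linarith) h5.le) _⟩

lemma toric_mem {q : R5} (hq : 0 < P.q) (h : q ∈ P.toricDom) : P.toric q ∈ spheres := by
  obtain ⟨h1, h2, h3, h4⟩ := norm_toric hq h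
  have h5 := (y_sub_pos hq).ne'
  refine ⟨by rw [h1, h2]; ring, by rw [h3, h4]; field_simp; ring⟩

lemma yFun_toric {q : R5} (hq : 0 < P.q) (h : q ∈ P.toricDom) : P.yFun (P.toric q) = q 2 := by
  obtain ⟨h1, h2, h3, h4⟩ := norm_toric hq h
  have h5 := (y_sub_pos hq).ne'
  rw [yFun, h3, h4]; field_simp; ring

lemma contDiffAt_polar {f g : R5 → ℝ} {q : R5} (hf : ContDiffAt ℝ ∞ f q)
    (hg : ContDiffAt ℝ ∞ g q) (h0 : 0 < f q) : ContDiffAt ℝ ∞ (fun q => polar (f q) (g q)) q := by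
  have h1 : ContDiffAt ℝ ∞ (fun q => ((√(f q) : ℝ) : ℂ)) q :=
    Complex.ofRealCLM.contDiff.contDiffAt.comp q (hf.sqrt h0.ne')
  have h2 : ContDiffAt ℝ ∞ (fun q => ((g q : ℝ) : ℂ)) q :=
    Complex.ofRealCLM.contDiff.contDiffAt.comp q hg
  exact h1.mul (h2.mul contDiffAt_const).cexp

lemma hasFDerivAt_polar {f g : R5 → ℝ} {f' g' : R5 →L[ℝ] ℝ} {q : R5} (hf : HasFDerivAt f f' q)
    (hg : HasFDerivAt g g' q) (h0 : 0 < f q) :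
    HasFDerivAt (fun q => polar (f q) (g q))
      (polar (f q) (g q) • (Complex.ofRealCLM.comp ((2 * f q)⁻¹ • f')
        + Complex.I • Complex.ofRealCLM.comp g')) q := by
  have h1 : HasFDerivAt (fun q => ((√(f q) : ℝ) : ℂ))
      (Complex.ofRealCLM.comp ((1 / (2 * √(f q))) • f')) q :=
    Complex.ofRealCLM.hasFDerivAt.comp q (hf.sqrt h0.ne')
  have h2 : HasFDerivAt (fun q => ((g q : ℝ) : ℂ)) (Complex.ofRealCLM.comp g') q :=
    Complex.ofRealCLM.hasFDerivAt.comp q hg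
  refine (h1.mul (h2.mul_const Complex.I).cexp).congr_fderiv ?_
  refine ContinuousLinearMap.ext fun v => ?_
  have hs := Real.sqrt_pos.mpr h0
  have hs' : ((√(f q) : ℝ) : ℂ) ≠ 0 := by exact_mod_cast hs.ne'
  have e : ((f q : ℝ) : ℂ) = (√(f q) : ℝ) ^ 2 := by
    rw [← Complex.ofReal_pow, Real.sq_sqrt h0.le]
  simp [polar]
  rw [e]
  field_simp
  ring

lemma contDiffAt_pr (i : Fin 5) (q : R5) : ContDiffAt ℝ ∞ (fun q : R5 => q i) q :=
  (pr i).contDiff.contDiffAt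

lemma contDiffAt_toric {q : R5} (hq : 0 < P.q) (h : q ∈ P.toricDom) :
    ContDiffAt ℝ ∞ P.toric q := by
  obtain ⟨h1, h2, h3, h4⟩ := h
  have h5 := y_sub_pos hq
  have c := contDiffAt_pr (q := q)
  refine ContDiffAt.prodMk (contDiffAt_pi.mpr fun i => ?_) (contDiffAt_pi.mpr fun i => ?_)
  · fin_cases i
    · exact contDiffAt_polar (f := fun q => (1 - q 0) / 2) (g := fun q => q 1 / 2)
        ((contDiffAt_const.sub (c 0)).div_const 2) ((c 1).div_const 2) (by linarith)
    · exact contDiffAt_polar (f := fun q => (1 + q 0) / 2) (g := fun q => -q 1 / 2)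
        ((contDiffAt_const.add (c 0)).div_const 2) ((c 1).neg.div_const 2) (by linarith)
  · fin_cases i
    · exact contDiffAt_polar (f := fun q => (q 2 - P.y₁) / (P.y₂ - P.y₁)) (g := P.argTwo)
        (((c 2).sub contDiffAt_const).div_const _) P.argTwo.contDiff.contDiffAt
        (div_pos (by linarith) h5)
    · exact contDiffAt_polar (f := fun q => (P.y₂ - q 2) / (P.y₂ - P.y₁)) (g := P.argThree)
        ((contDiffAt_const.sub (c 2)).div_const _) P.argThree.contDiff.contDiffAt
        (div_pos (by linarith) h5)

/-- The logarithmic derivative of a component of `toric`. -/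
lemma fderiv_toric {q : R5} (hq : 0 < P.q) (h : q ∈ P.toricDom) (v : R5) :
    (fderiv ℝ P.toric q v).1 0
      = (P.toric q).1 0 * ((-(v 0 / (2 * (1 - q 0))) : ℝ) + Complex.I * (v 1 / 2 : ℝ)) ∧
    (fderiv ℝ P.toric q v).1 1
      = (P.toric q).1 1 * ((v 0 / (2 * (1 + q 0)) : ℝ) + Complex.I * (-(v 1 / 2) : ℝ)) ∧
    (fderiv ℝ P.toric q v).2 0
      = (P.toric q).2 0 * ((v 2 / (2 * (q 2 - P.y₁)) : ℝ) + Complex.I * (P.argTwo v : ℝ)) ∧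
    (fderiv ℝ P.toric q v).2 1
      = (P.toric q).2 1 * ((-(v 2 / (2 * (P.y₂ - q 2))) : ℝ) + Complex.I * (P.argThree v : ℝ)) := by
  have hd := ((contDiffAt_toric hq h).differentiableAt (by simp)).hasFDerivAt
  obtain ⟨h1, h2, h3, h4⟩ := h
  have h5 := y_sub_pos hq
  have c : ∀ i, HasFDerivAt (fun q : R5 => q i) (pr i) q := fun i => (pr i).hasFDerivAt
  have hd1 : ∀ i, HasFDerivAt (fun q => (P.toric q).1 i) ((dz i).comp (fderiv ℝ P.toric q)) q :=
    fun i => (dz i).hasFDerivAt.comp q hd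
  have hd2 : ∀ i, HasFDerivAt (fun q => (P.toric q).2 i) ((dz' i).comp (fderiv ℝ P.toric q)) q :=
    fun i => (dz' i).hasFDerivAt.comp q hd
  have d0 := hasFDerivAt_polar (((c 0).const_sub 1).mul_const (1 / 2))
    ((c 1).mul_const (1 / 2)) (by linarith)
  have d1 := hasFDerivAt_polar (((c 0).const_add 1).mul_const (1 / 2))
    ((c 1).neg.mul_const (1 / 2)) (by linarith)
  have d2 := hasFDerivAt_polar (((c 2).sub_const P.y₁).mul_const (P.y₂ - P.y₁)⁻¹)
    P.argTwo.hasFDerivAt (mul_pos (by linarith) (inv_pos.mpr h5))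
  have d3 := hasFDerivAt_polar (((c 2).const_sub P.y₂).mul_const (P.y₂ - P.y₁)⁻¹)
    P.argThree.hasFDerivAt (mul_pos (by linarith) (inv_pos.mpr h5))
  have n0 : 1 - q 0 ≠ 0 := by linarith
  have n1 : 1 + q 0 ≠ 0 := by linarith
  have n2 : q 2 - P.y₁ ≠ 0 := by linarith
  have n3 : P.y₂ - q 2 ≠ 0 := by linarith
  have n5 := h5.ne'
  have u0 := DFunLike.congr_fun ((hd1 0).unique (d0.congr_of_eventuallyEq
    (Filter.Eventually.of_forall fun q => by simp [toric, div_eq_mul_inv]))) v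
  have u1 := DFunLike.congr_fun ((hd1 1).unique (d1.congr_of_eventuallyEq
    (Filter.Eventually.of_forall fun q => by simp [toric, div_eq_mul_inv]))) v
  have u2 := DFunLike.congr_fun ((hd2 0).unique (d2.congr_of_eventuallyEq
    (Filter.Eventually.of_forall fun q => by simp [toric, div_eq_mul_inv]))) v
  have u3 := DFunLike.congr_fun ((hd2 1).unique (d3.congr_of_eventuallyEq
    (Filter.Eventually.of_forall fun q => by simp [toric, div_eq_mul_inv]))) v
  refine ⟨u0.trans ?_, u1.trans ?_, u2.trans ?_, u3.trans ?_⟩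
  · rw [show (P.toric q).1 0 = polar ((1 - q 0) * (1 / 2)) (q 1 * (1 / 2)) by
      simp [toric, div_eq_mul_inv]]
    have : (2 * ((1 - q 0) * (1 / 2)))⁻¹ * (1 / 2 * -v 0) = -(v 0 / (2 * (1 - q 0))) := by
      field_simp
    rw [← this]
    simp
    ring
  · rw [show (P.toric q).1 1 = polar ((1 + q 0) * (1 / 2)) (-q 1 * (1 / 2)) by
      simp [toric, div_eq_mul_inv]]
    have : (2 * ((1 + q 0) * (1 / 2)))⁻¹ * (1 / 2 * v 0) = v 0 / (2 * (1 + q 0)) := by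
      field_simp
    rw [← this]
    simp
    ring
  · rw [show (P.toric q).2 0 = polar ((q 2 - P.y₁) * (P.y₂ - P.y₁)⁻¹) (P.argTwo q) by
      simp [toric, div_eq_mul_inv]]
    have : (2 * ((q 2 - P.y₁) * (P.y₂ - P.y₁)⁻¹))⁻¹ * ((P.y₂ - P.y₁)⁻¹ * v 2)
        = v 2 / (2 * (q 2 - P.y₁)) := by
      field_simp
    rw [← this]
    simp
    ring
  · rw [show (P.toric q).2 1 = polar ((P.y₂ - q 2) * (P.y₂ - P.y₁)⁻¹) (P.argThree q) by
      simp [toric, div_eq_mul_inv]]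
    have : (2 * ((P.y₂ - q 2) * (P.y₂ - P.y₁)⁻¹))⁻¹ * ((P.y₂ - P.y₁)⁻¹ * -v 2)
        = -(v 2 / (2 * (P.y₂ - q 2))) := by
      field_simp
    rw [← this]
    simp
    ring

/-- The 1-form `dβ + cos θ dφ`. -/
def lamFour (q : R5) : R5 →L[ℝ] ℝ := pr 3 + q 0 • pr 1

/-- The 1-form `3η/2 = dψ - cos θ dφ + y (dβ + cos θ dφ)`. -/
def lamFive (q : R5) : R5 →L[ℝ] ℝ := pr 4 - q 0 • pr 1 + q 2 • lamFour q

lemma lamFour_apply (q v : R5) : lamFour q v = v 3 + q 0 * v 1 := rfl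

lemma lamFive_apply (q v : R5) : lamFive q v = v 4 - q 0 * v 1 + q 2 * (v 3 + q 0 * v 1) := rfl

lemma conj_mul_log (z : ℂ) (a b : ℝ) :
    conj z * (z * (a + Complex.I * b)) = ((‖z‖ ^ 2 * a : ℝ) : ℂ) + ((‖z‖ ^ 2 * b : ℝ) : ℂ) * Complex.I := by
  have h := conj_mul_self_eq z
  rw [Complex.ofReal_mul, Complex.ofReal_mul, ← h]; ring

lemma im_conj_mul_log (z : ℂ) (a b : ℝ) :
    (conj z * (z * (a + Complex.I * b))).im = ‖z‖ ^ 2 * b := by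
  rw [conj_mul_log]; simp [-Complex.ofReal_mul]

lemma etaC_toric {q : R5} (hq : 0 < P.q) (h : q ∈ P.toricDom) (v : R5) :
    P.etaC (P.toric q) (fderiv ℝ P.toric q v) = 2 / 3 * lamFive q v := by
  obtain ⟨d0, d1, d2, d3⟩ := fderiv_toric hq h v
  obtain ⟨n0, n1, n2, n3⟩ := norm_toric hq h
  have y1 := (y₁_neg hq).ne
  have y2 := (y₂_pos hq).ne'
  have y21 := (y_sub_pos hq).ne'
  rw [etaC_apply, formA_apply, formB_apply, formB_apply, Complex.add_im, d0, d1, d2, d3,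
    im_conj_mul_log, im_conj_mul_log, im_conj_mul_log, im_conj_mul_log, n0, n1, n2, n3,
    yFun_toric hq h, lamFive_apply]
  simp [argTwo, argThree]
  field_simp
  ring

lemma tauC_toric {q : R5} (hq : 0 < P.q) (h : q ∈ P.toricDom) (v : R5) :
    tauC (P.toric q) (fderiv ℝ P.toric q v) = (P.toric q).1 0 * (P.toric q).1 1 *
      ((-(v 0 / (1 - q 0 ^ 2)) : ℝ) + Complex.I * v 1) := by
  obtain ⟨d0, d1, -, -⟩ := fderiv_toric hq h v
  obtain ⟨h1, h2, h3, h4⟩ := h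
  have e : -(v 0 / (1 - q 0 ^ 2)) = -(v 0 / (2 * (1 - q 0))) - v 0 / (2 * (1 + q 0)) := by
    have n0 : 1 - q 0 ≠ 0 := by linarith
    have n1 : 1 + q 0 ≠ 0 := by linarith
    rw [show 1 - q 0 ^ 2 = (1 - q 0) * (1 + q 0) by ring]
    field_simp; ring
  rw [tauC_apply, d0, d1, e]
  push_cast
  ring

lemma chiC_toric {q : R5} (hq : 0 < P.q) (h : q ∈ P.toricDom) (v : R5) :
    P.chiC (P.toric q) (fderiv ℝ P.toric q v) = (P.toric q).2 0 * (P.toric q).2 1 *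
      (((1 - q 2) / (P.y₃ - q 2) * (P.y₂ - P.y₁) / (2 * (q 2 - P.y₁) * (P.y₂ - q 2)) * v 2 : ℝ)
        + Complex.I * ((P.y₂ - P.y₁) / 3 * lamFour q v : ℝ)) := by
  obtain ⟨d0, d1, d2, d3⟩ := fderiv_toric hq h v
  obtain ⟨n0, n1, n2, n3⟩ := norm_toric hq h
  have hy := yFun_toric hq h
  have hk : P.kap (P.toric q) = (1 - q 2) / (P.y₃ - q 2) := by rw [kap, hy]
  have y3 := y₃_sub_yFun_pos (P := P) (toric_mem hq h)
  rw [hy] at y3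
  -- The correction term in `chiC` contains exactly the multiple of `dθ₂ - dθ₃` that cancels the
  -- angular part of `z₃ dz₂ - z₂ dz₃`; what is left is proportional to `dβ + x dφ`.
  have hR : P.chiR (P.toric q) (fderiv ℝ P.toric q v) = (P.y₂ - P.y₁) / 3 * lamFour q v
      - (1 - q 2) / (P.y₃ - q 2) * (P.argTwo v - P.argThree v) := by
    rw [chiR, formA_apply, formB_apply, formB_apply, Complex.add_im, d0, d1, d2, d3,
      im_conj_mul_log, im_conj_mul_log, im_conj_mul_log, im_conj_mul_log, n0, n1, n2, n3, hy,
      lamFour_apply]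
    have e := y_rel' (P := P)
    have e1 := y_sum P
    have e2 := y₃_sub_mul (P := P)
    have g2 := (y₃_sub_y₁_pos (P := P)).ne'
    have g3 := (y₃_sub_y₂_pos (P := P)).ne'
    have y21 := (y_sub_pos hq).ne'
    have y3' := y3.ne'
    simp [argTwo, argThree]
    field_simp
    grind
  obtain ⟨h1, h2, h3, h4⟩ := h
  have e : (1 - q 2) / (P.y₃ - q 2) * (P.y₂ - P.y₁) / (2 * (q 2 - P.y₁) * (P.y₂ - q 2)) * v 2
      = (1 - q 2) / (P.y₃ - q 2) * (v 2 / (2 * (q 2 - P.y₁)) + v 2 / (2 * (P.y₂ - q 2))) := by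
    have n2 : q 2 - P.y₁ ≠ 0 := by linarith
    have n3 : P.y₂ - q 2 ≠ 0 := by linarith
    have y3' := y3.ne'
    field_simp
    ring
  rw [chiC_apply, hR, d2, d3, e, hk]
  push_cast
  ring

end YParam

/-! ### The orthonormal coframe and the metric in toric coordinates -/

namespace YParam

variable {P : YParam}

/-- The function `k(y)`, in factored form. -/
def kfun (P : YParam) (y : ℝ) : ℝ :=
  4 * (y - P.y₁) * (P.y₂ - y) * (P.y₃ - y) / (1 - y)

lemma toricDom_pos {q : R5} (h : q ∈ P.toricDom) : 0 < 1 - q 2 ∧ 0 < 1 - q 0 ^ 2 ∧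
    0 < q 2 - P.y₁ ∧ 0 < P.y₂ - q 2 ∧ 0 < P.y₃ - q 2 := by
  obtain ⟨h1, h2, h3, h4⟩ := h
  have := P.y₂_lt_one
  have := P.one_lt_y₃
  refine ⟨by linarith, by nlinarith, by linarith, by linarith, by linarith⟩

lemma kfun_pos {q : R5} (h : q ∈ P.toricDom) : 0 < P.kfun (q 2) := by
  obtain ⟨h1, h2, h3, h4, h5⟩ := toricDom_pos h
  unfold kfun; positivity

/-- The length of `∂/∂x`. -/
def lenX (q : R5) : ℝ := √(2 * (1 - q 2) / (3 * (1 - q 0 ^ 2)))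

/-- The length of `∂/∂y`. -/
def lenY (P : YParam) (q : R5) : ℝ := √(4 / P.kfun (q 2))

lemma lenX_sq {q : R5} (h : q ∈ P.toricDom) :
    lenX q ^ 2 = 2 * (1 - q 2) / (3 * (1 - q 0 ^ 2)) := by
  obtain ⟨h1, h2, -, -, -⟩ := toricDom_pos h
  exact Real.sq_sqrt (by positivity)

lemma lenX_pos {q : R5} (h : q ∈ P.toricDom) : 0 < lenX q := by
  obtain ⟨h1, h2, -, -, -⟩ := toricDom_pos h
  exact Real.sqrt_pos.mpr (by positivity)

lemma lenY_sq {q : R5} (h : q ∈ P.toricDom) : P.lenY q ^ 2 = 4 / P.kfun (q 2) := by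
  have := kfun_pos h
  exact Real.sq_sqrt (by positivity)

lemma lenY_pos {q : R5} (h : q ∈ P.toricDom) : 0 < P.lenY q := by
  have := kfun_pos h
  exact Real.sqrt_pos.mpr (by positivity)

lemma contDiffAt_kfun {q : R5} (h : q ∈ P.toricDom) :
    ContDiffAt ℝ ∞ (fun q : R5 => P.kfun (q 2)) q := by
  have c := contDiffAt_pr 2 q
  exact (((contDiffAt_const.mul (c.sub contDiffAt_const)).mul (contDiffAt_const.sub c)).mul
    (contDiffAt_const.sub c)).div (contDiffAt_const.sub c) (toricDom_pos h).1.ne'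

lemma contDiffAt_lenX {q : R5} (h : q ∈ P.toricDom) : ContDiffAt ℝ ∞ lenX q := by
  obtain ⟨h1, h2, -, -, -⟩ := toricDom_pos h
  refine ContDiffAt.sqrt ((contDiffAt_const.mul (contDiffAt_const.sub (contDiffAt_pr 2 q))).div
    (contDiffAt_const.mul (contDiffAt_const.sub ((contDiffAt_pr 0 q).pow 2))) ?_) ?_
  · positivity
  · positivity

lemma contDiffAt_lenY {q : R5} (h : q ∈ P.toricDom) : ContDiffAt ℝ ∞ P.lenY q := by
  have h1 := kfun_pos h
  exact ContDiffAt.sqrt (contDiffAt_const.div (contDiffAt_kfun h) h1.ne') (by positivity)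

lemma contDiffAt_lamFour (q : R5) : ContDiffAt ℝ ∞ lamFour q :=
  contDiffAt_const.add ((contDiffAt_pr 0 q).smul contDiffAt_const)

lemma contDiffAt_lamFive (q : R5) : ContDiffAt ℝ ∞ lamFive q :=
  (contDiffAt_const.sub ((contDiffAt_pr 0 q).smul contDiffAt_const)).add
    ((contDiffAt_pr 2 q).smul (contDiffAt_lamFour q))

/-- The coframe in toric coordinates. -/
def toricForms (P : YParam) (i : Fin 4) (q : R5) : R5 →L[ℝ] ℝ :=
  ![(-lenX q) • pr 0, ((1 - q 0 ^ 2) * lenX q) • pr 1, P.lenY q • pr 2,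
    (2 / (3 * P.lenY q)) • lamFour q] i

lemma toricForms_apply (q v : R5) :
    P.toricForms 0 q v = -(lenX q * v 0) ∧ P.toricForms 1 q v = (1 - q 0 ^ 2) * lenX q * v 1 ∧
    P.toricForms 2 q v = P.lenY q * v 2 ∧
    P.toricForms 3 q v = 2 / (3 * P.lenY q) * lamFour q v := by
  refine ⟨?_, rfl, rfl, rfl⟩
  simp [toricForms]

lemma contDiffAt_toricForms {q : R5} (h : q ∈ P.toricDom) (i : Fin 4) :
    ContDiffAt ℝ ∞ (P.toricForms i) q := by
  have hx := contDiffAt_lenX h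
  have hy := contDiffAt_lenY h
  fin_cases i
  · exact hx.neg.smul contDiffAt_const
  · exact ((contDiffAt_const.sub ((contDiffAt_pr 0 q).pow 2)).mul hx).smul contDiffAt_const
  · exact hy.smul contDiffAt_const
  · exact (contDiffAt_const.div (contDiffAt_const.mul hy)
      (mul_pos three_pos (lenY_pos h)).ne').smul (contDiffAt_lamFour q)

lemma isPolar_toric (hq : 0 < P.q) {q : R5} (h : q ∈ P.toricDom) :
    IsPolar P (P.toric q) (fderiv ℝ P.toric q) fun i => P.toricForms i q := by
  obtain ⟨h1, h2, h3, h4, h5⟩ := toricDom_pos h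
  obtain ⟨n0, n1, n2, n3⟩ := norm_toric hq h
  have y21 := y_sub_pos hq
  have hA := lenX_pos h
  have hB := lenY_pos h
  have hA2 := lenX_sq h
  have hB2 := lenY_sq h
  have hy := yFun_toric hq h
  -- The two complex factors are the common factors of real and imaginary parts in `tauC_toric` and
  -- `chiC_toric`; the lengths `lenX` and `lenY` are such that their moduli satisfy the
  -- normalization of `IsPolar`.
  refine ⟨(P.toric q).1 0 * (P.toric q).1 1 * ((((1 - q 0 ^ 2) * lenX q)⁻¹ : ℝ) : ℂ),
    (P.toric q).2 0 * (P.toric q).2 1 * (((P.y₂ - P.y₁) * P.lenY q / 2 : ℝ) : ℂ), ?_, ?_,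
    fun v => ⟨?_, ?_⟩⟩
  · rw [norm_mul, norm_mul, mul_pow, mul_pow, n0, n1, Complex.norm_real, Real.norm_eq_abs, sq_abs,
      inv_pow, mul_pow, hA2, hy]
    field_simp
    ring
  · rw [norm_mul, norm_mul, mul_pow, mul_pow, n2, n3, Complex.norm_real, Real.norm_eq_abs, sq_abs,
      div_pow, mul_pow, hB2, kap, hy, kfun]
    field_simp
    ring
  · obtain ⟨f0, f1, f2, f3⟩ := toricForms_apply (P := P) q v
    rw [tauC_toric hq h, f0, f1, mul_assoc _ (((_ : ℝ)) : ℂ)]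
    congr 1
    have e : -(v 0 / (1 - q 0 ^ 2)) = ((1 - q 0 ^ 2) * lenX q)⁻¹ * -(lenX q * v 0) := by
      field_simp
    have e2 : v 1 = ((1 - q 0 ^ 2) * lenX q)⁻¹ * ((1 - q 0 ^ 2) * lenX q * v 1) := by
      field_simp
    rw [e]
    conv_lhs => rw [e2]
    push_cast
    ring
  · obtain ⟨f0, f1, f2, f3⟩ := toricForms_apply (P := P) q v
    rw [chiC_toric hq h, f2, f3, mul_assoc _ (((_ : ℝ)) : ℂ)]
    congr 1
    have e : (1 - q 2) / (P.y₃ - q 2) * (P.y₂ - P.y₁) / (2 * (q 2 - P.y₁) * (P.y₂ - q 2)) * v 2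
        = (P.y₂ - P.y₁) * P.lenY q / 2 * (P.lenY q * v 2) := by
      have : (P.y₂ - P.y₁) * P.lenY q / 2 * (P.lenY q * v 2)
        = (P.y₂ - P.y₁) * P.lenY q ^ 2 / 2 * v 2 := by ring
      rw [this, hB2, kfun]
      field_simp
    have e2 : (P.y₂ - P.y₁) / 3 * lamFour q v
        = (P.y₂ - P.y₁) * P.lenY q / 2 * (2 / (3 * P.lenY q) * lamFour q v) := by
      field_simp
    rw [e, e2]
    push_cast
    ring

/-- The metric in toric coordinates. -/
def toricMetric (P : YParam) (q : R5) : R5 →L[ℝ] R5 →L[ℝ] ℝ :=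
  (2 * (1 - q 2) / (3 * (1 - q 0 ^ 2))) • (pr 0).smulRight (pr 0)
    + (2 * (1 - q 2) * (1 - q 0 ^ 2) / 3) • (pr 1).smulRight (pr 1)
    + (4 / P.kfun (q 2)) • (pr 2).smulRight (pr 2)
    + (P.kfun (q 2) / 9) • (lamFour q).smulRight (lamFour q)
    + (4 / 9 : ℝ) • (lamFive q).smulRight (lamFive q)

lemma toricMetric_apply (q v w : R5) : P.toricMetric q v w =
    2 * (1 - q 2) / (3 * (1 - q 0 ^ 2)) * (v 0 * w 0)
    + 2 * (1 - q 2) * (1 - q 0 ^ 2) / 3 * (v 1 * w 1)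
    + 4 / P.kfun (q 2) * (v 2 * w 2) + P.kfun (q 2) / 9 * (lamFour q v * lamFour q w)
    + 4 / 9 * (lamFive q v * lamFive q w) := rfl

lemma metricC_toric (hq : 0 < P.q) {q : R5} (h : q ∈ P.toricDom) (v w : R5) :
    P.metricC (P.toric q) (fderiv ℝ P.toric q v) (fderiv ℝ P.toric q w)
      = P.toricMetric q v w := by
  obtain ⟨h1, h2, h3, h4, h5⟩ := toricDom_pos h
  obtain ⟨f0, f1, f2, f3⟩ := toricForms_apply (P := P) q v
  obtain ⟨g0, g1, g2, g3⟩ := toricForms_apply (P := P) q w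
  have hA := lenX_pos h
  have hB := lenY_pos h
  have hA2 := lenX_sq h
  have hB2 := lenY_sq h
  have hk := kfun_pos h
  rw [(isPolar_toric hq h).metric, etaC_toric hq h, etaC_toric hq h, Fin.sum_univ_four,
    toricMetric_apply, f0, f1, f2, f3, g0, g1, g2, g3]
  have e1 : 2 * (1 - q 2) * (1 - q 0 ^ 2) / 3 = ((1 - q 0 ^ 2) * lenX q) ^ 2 := by
    rw [mul_pow, hA2]; field_simp
  have e2 : P.kfun (q 2) / 9 = (2 / (3 * P.lenY q)) ^ 2 := by
    rw [div_pow, mul_pow, hB2]; field_simp; ring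
  rw [e1, e2, ← hA2, ← hB2]
  ring

lemma toricMetric_pos {q : R5} (h : q ∈ P.toricDom) {v : R5} (hv : v ≠ 0) :
    0 < P.toricMetric q v v := by
  obtain ⟨h1, h2, h3, h4, h5⟩ := toricDom_pos h
  have hk := kfun_pos h
  rw [toricMetric_apply]
  by_contra hn
  have c0 : 0 < 2 * (1 - q 2) / (3 * (1 - q 0 ^ 2)) := by positivity
  have c1 : 0 < 2 * (1 - q 2) * (1 - q 0 ^ 2) / 3 := by positivity
  have c2 : 0 < 4 / P.kfun (q 2) := by positivity
  have c3 : 0 < P.kfun (q 2) / 9 := by positivity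
  have z : ∀ x : ℝ, x * x = 0 → x = 0 := fun x hx => mul_self_eq_zero.mp hx
  have s0 := mul_nonneg c0.le (mul_self_nonneg (v 0))
  have s1 := mul_nonneg c1.le (mul_self_nonneg (v 1))
  have s2 := mul_nonneg c2.le (mul_self_nonneg (v 2))
  have s3 := mul_nonneg c3.le (mul_self_nonneg (lamFour q v))
  have s4 := mul_self_nonneg (lamFive q v)
  have v0 : v 0 = 0 := z _ ((mul_eq_zero.mp (by linarith)).resolve_left c0.ne')
  have v1 : v 1 = 0 := z _ ((mul_eq_zero.mp (by linarith)).resolve_left c1.ne')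
  have v2 : v 2 = 0 := z _ ((mul_eq_zero.mp (by linarith)).resolve_left c2.ne')
  have v3 : lamFour q v = 0 := z _ ((mul_eq_zero.mp (by linarith)).resolve_left c3.ne')
  have v4 : lamFive q v = 0 := z _ (by linarith)
  rw [lamFour_apply, v1] at v3
  rw [lamFive_apply, v1] at v4
  have v3' : v 3 = 0 := by linarith
  rw [v3'] at v4
  have v4' : v 4 = 0 := by linarith
  apply hv
  funext i
  fin_cases i <;> assumption

lemma contDiffAt_toricMetric {q : R5} (h : q ∈ P.toricDom) : ContDiffAt ℝ ∞ P.toricMetric q := by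
  obtain ⟨h1, h2, h3, h4, h5⟩ := toricDom_pos h
  have hk := kfun_pos h
  have k := contDiffAt_kfun h
  have cx : ContDiffAt ℝ ∞ (fun q : R5 => 1 - q 0 ^ 2) q :=
    contDiffAt_const.sub ((contDiffAt_pr 0 q).pow 2)
  have cy : ContDiffAt ℝ ∞ (fun q : R5 => 1 - q 2) q := contDiffAt_const.sub (contDiffAt_pr 2 q)
  exact (((((((contDiffAt_const.mul cy).div (contDiffAt_const.mul cx)
      (mul_pos three_pos h2).ne').smul contDiffAt_const).add
    ((((contDiffAt_const.mul cy).mul cx).div_const 3).smul contDiffAt_const)).add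
    ((contDiffAt_const.div k hk.ne').smul contDiffAt_const))).add
    ((k.div_const 9).smul ((contDiffAt_lamFour q).smulRight (contDiffAt_lamFour q)))).add
    (((contDiffAt_lamFive q).smulRight (contDiffAt_lamFive q)).const_smul (4 / 9 : ℝ))

/-! ### Toric coordinates as coordinates on `Y^{p,q}` -/

/-- By `lift_curve`, a vector killed by the differential lifts to a multiple of the circle
generator. Then `τ`, `χ`, `η` vanish on the lift, so `toricMetric q v v = 0`, against positivity. -/
lemma toric_coord_injective (hq : 0 < P.q) {q : R5} (h : q ∈ P.toricDom) {κ : ChartIndex}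
    (hd : P.toric q ∈ P.dom κ) {v : R5}
    (hv : fderiv ℝ (P.coord κ) (P.toric q) (fderiv ℝ P.toric q v) = 0) : v = 0 := by
  have hdif := ((contDiffAt_toric hq h).differentiableAt (by simp)).hasFDerivAt
  have hs : ∀ᶠ q' in 𝓝 q, P.toric q' ∈ spheres := by
    filter_upwards [isOpen_toricDom.mem_nhds h] with q' hq' using toric_mem hq hq'
  obtain ⟨ζ, c, hc⟩ : ∃ (ζ : Circle) (c : ℝ), (0 : C4) = P.act ζ (fderiv ℝ P.toric q v)
      + c • P.gen (P.act ζ (P.toric q)) := by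
    obtain ⟨γ, hγ⟩ : ∃ γ : ℝ → C4, γ = fun t => P.toric (q + t • v) := ⟨_, rfl⟩
    have h0 : P.toric q = γ 0 := by simp [hγ]
    have hd' : HasDerivAt γ (fderiv ℝ P.toric q v) 0 := hγ ▸ hasDerivAt_line hdif v
    have hs : ∀ᶠ t in 𝓝 0, γ t ∈ spheres := hγ ▸ eventually_line hs v
    rw [h0] at hv hd
    obtain ⟨c, hc⟩ := lift_curve hd' hs hd
    rw [hv, map_zero] at hc
    exact ⟨rotC κ hd, c, by rw [h0]; exact hc⟩
  have hm := toric_mem hq h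
  have ha := act_mem_spheres (P := P) (ζ := ζ) hm
  have hw : P.act ζ (fderiv ℝ P.toric q v) = (-c) • P.gen (P.act ζ (P.toric q)) := by
    rw [neg_smul]; exact eq_neg_of_add_eq_zero_left hc.symm
  have ht : tauC (P.toric q) (fderiv ℝ P.toric q v) = 0 := by
    have := tauC_act (P := P) ζ (P.toric q) (fderiv ℝ P.toric q v)
    rw [hw, map_smul, tauC_gen, smul_zero] at this
    exact (mul_eq_zero.mp this.symm).resolve_left
      (pow_ne_zero _ (zpow_ne_zero _ ζ.coe_ne_zero))
  have hx : P.chiC (P.toric q) (fderiv ℝ P.toric q v) = 0 := by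
    have := chiC_act (P := P) ζ (P.toric q) (fderiv ℝ P.toric q v)
    rw [hw, map_smul, chiC_gen hq ha, smul_zero] at this
    exact (mul_eq_zero.mp this.symm).resolve_left
      (mul_ne_zero (zpow_ne_zero _ ζ.coe_ne_zero) (zpow_ne_zero _ ζ.coe_ne_zero))
  have he : P.etaC (P.toric q) (fderiv ℝ P.toric q v) = 0 := by
    have := etaC_act (P := P) ζ (P.toric q) (fderiv ℝ P.toric q v)
    rw [hw, map_smul, etaC_gen hq ha, smul_zero] at this
    exact this.symm
  by_contra hv0
  have := toricMetric_pos h hv0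
  rw [← metricC_toric hq h, metricC_apply, ht, hx, he] at this
  simp at this

/-- Coordinates on `Y^{p,q}` inverse to the parametrization `toric`. -/
structure IsToric (P : YParam) (Θ : LocalCoord E5 R5 P.Y) : Prop where
  target : Θ.target ⊆ P.toricDom
  param : ∀ q ∈ Θ.target, ∃ h : P.toric q ∈ spheres, Θ.param q = P.proj ⟨P.toric q, h⟩

/-- The inverse function theorem is applied to `coord κ ∘ toric`, a map between five-dimensional
spaces whose differential is injective by `toric_coord_injective`. -/
theorem exists_isToric (hq : 0 < P.q) {q₀ : R5} (h₀ : q₀ ∈ P.toricDom) :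
    ∃ Θ : LocalCoord E5 R5 P.Y, IsToric P Θ ∧ q₀ ∈ Θ.target := by
  obtain ⟨κ, hκ⟩ := P.exists_chart (P.proj ⟨P.toric q₀, toric_mem hq h₀⟩)
  have hκ' : P.toric q₀ ∈ P.dom κ := hκ
  let f : R5 → E5 := fun q => P.coord κ (P.toric q)
  have hfs : ∀ q ∈ P.toricDom, P.toric q ∈ P.dom κ → ContDiffAt ℝ ∞ f q := fun q h1 h2 =>
    (P.contDiffAt_coord h2).comp q (contDiffAt_toric hq h1)
  have hinj : ∀ q ∈ P.toricDom, P.toric q ∈ P.dom κ →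
      ∃ T : R5 ≃L[ℝ] E5, HasFDerivAt f (T : R5 →L[ℝ] E5) q := by
    intro q h1 h2
    have hd : HasFDerivAt f ((fderiv ℝ (P.coord κ) (P.toric q)).comp (fderiv ℝ P.toric q)) q :=
      HasFDerivAt.comp q ((P.contDiffAt_coord h2).differentiableAt (by simp)).hasFDerivAt
        ((contDiffAt_toric hq h1).differentiableAt (by simp)).hasFDerivAt
    let T₀ : R5 →ₗ[ℝ] E5 :=
      ((fderiv ℝ (P.coord κ) (P.toric q)).comp (fderiv ℝ P.toric q) : R5 →L[ℝ] E5)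
    have inj : Function.Injective T₀ := by
      rw [injective_iff_map_eq_zero]
      exact fun v hv => toric_coord_injective hq h1 h2 hv
    let T : R5 ≃ₗ[ℝ] E5 := LinearEquiv.ofInjectiveOfFinrankEq T₀ inj (by rw [finrank_E5]; simp)
    refine ⟨T.toContinuousLinearEquiv, hd.congr_fderiv ?_⟩
    exact ContinuousLinearMap.ext fun v => rfl
  obtain ⟨T, hT⟩ := hinj q₀ h₀ hκ'
  have hc₀ := hfs q₀ h₀ hκ'
  -- On all of `W`, not only at `q₀`, the differential is invertible; after restriction to `W` the
  -- local inverse is smooth at every point of its domain.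
  let W : Set R5 := P.toricDom ∩ P.toric ⁻¹' P.dom κ
  have hW : IsOpen W := by
    refine ContinuousOn.isOpen_inter_preimage (fun q hq' =>
      (contDiffAt_toric hq hq').continuousAt.continuousWithinAt) isOpen_toricDom (P.isOpen_dom κ)
  let e := (hc₀.toOpenPartialHomeomorph f hT (by simp)).restrOpen W hW
  have he : ∀ q, e q = f q := fun _ => rfl
  have heW : e.source ⊆ W := by
    intro q hq'
    rw [OpenPartialHomeomorph.restrOpen_source] at hq'
    exact hq'.2
  have he₀ : q₀ ∈ e.source := by
    rw [OpenPartialHomeomorph.restrOpen_source]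
    exact ⟨hc₀.mem_toOpenPartialHomeomorph_source hT (by simp), h₀, hκ'⟩
  let Θ₀ : OpenPartialHomeomorph P.Y R5 := (P.chart κ).trans e.symm
  have htgt : Θ₀.target ⊆ e.source := by
    intro q hq'
    exact hq'.1
  have hs : ∀ q ∈ e.source, ContDiffAt ℝ ∞ e q := fun q hq' => hfs q (heW hq').1 (heW hq').2
  have hsymm : ∀ x ∈ e.target, ContDiffAt ℝ ∞ e.symm x := by
    intro x hx
    obtain ⟨T, hT⟩ := hinj _ (heW (e.map_target hx)).1 (heW (e.map_target hx)).2
    exact e.contDiffAt_symm hx hT (hs _ (e.map_target hx))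
  refine ⟨⟨Θ₀, ?_, ?_⟩, ⟨fun q hq' => (heW (htgt hq')).1, fun q hq' => ?_⟩, ?_⟩
  · intro y hy
    have h1 : ContMDiffAt 𝓘(ℝ, E5) 𝓘(ℝ, E5) ∞ (P.chart κ) y :=
      (P.chartCoord κ).smooth_toFun.contMDiffAt ((P.chart κ).open_source.mem_nhds hy.1)
    have h2 : ContMDiffAt 𝓘(ℝ, E5) 𝓘(ℝ, R5) ∞ e.symm (P.chart κ y) :=
      (hsymm _ hy.2).contMDiffAt
    exact (h2.comp y h1).contMDiffWithinAt
  · intro q hq'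
    have h1 : ContMDiffAt 𝓘(ℝ, R5) 𝓘(ℝ, E5) ∞ e q := (hs q (htgt hq')).contMDiffAt
    have h2 : ContMDiffAt 𝓘(ℝ, E5) 𝓘(ℝ, E5) ∞ (P.chart κ).symm (e q) :=
      (P.chartCoord κ).smooth_invFun.contMDiffAt ((P.chart κ).open_target.mem_nhds hq'.2)
    exact (h2.comp q h1).contMDiffWithinAt
  · have h1 := heW (htgt hq')
    refine ⟨toric_mem hq h1.1, ?_⟩
    exact (P.chart κ).left_inv (x := P.proj ⟨P.toric q, toric_mem hq h1.1⟩) h1.2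
  · refine ⟨he₀, ?_⟩
    exact P.coord_tgt hκ'

variable {Θ : LocalCoord E5 R5 P.Y}

lemma IsToric.isLift (h : IsToric P Θ) (hq : 0 < P.q) {q : R5} (hqt : q ∈ Θ.target) :
    IsLift Θ.param P.toric (fderiv ℝ P.toric q) q := by
  refine ⟨((contDiffAt_toric hq (h.target hqt)).differentiableAt (by simp)).hasFDerivAt, ?_⟩
  filter_upwards [Θ.open_target.mem_nhds hqt] with q' hq' using h.param q' hq'

lemma IsToric.isCoframeExpr (h : IsToric P Θ) (hq : 0 < P.q) :
    Θ.IsCoframeExpr P.contactMetric P.toricForms :=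
  isCoframeExpr_of_lift hq (fun _ hqt => h.isLift hq hqt)
    (fun i _ hqt => contDiffAt_toricForms (h.target hqt) i)
    (fun _ hqt => isPolar_toric hq (h.target hqt))

lemma IsToric.isMetricExpr (h : IsToric P Θ) (hq : 0 < P.q) :
    Θ.IsMetricExpr P.contactMetric P.toricMetric where
  eq q hqt v w := ((h.isLift hq hqt).metric hq v w).trans (metricC_toric hq (h.target hqt) v w)
  diff q hqt := (contDiffAt_toricMetric (h.target hqt)).differentiableAt (by simp)
  symm q hqt v w := by rw [toricMetric_apply, toricMetric_apply]; ring
  pos q hqt v hv := toricMetric_pos (h.target hqt) hv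

/-- The Reeb field in toric coordinates. -/
def toricReeb : R5 := ![0, 0, 0, 0, 3 / 2]

lemma IsToric.isContactExpr (h : IsToric P Θ) (hq : 0 < P.q) :
    Θ.IsContactExpr P.contactMetric (fun q => (2 / 3 : ℝ) • lamFive q) (fun _ => toricReeb) where
  eta q hqt v := ((h.isLift hq hqt).eta hq v).trans (etaC_toric hq (h.target hqt) v)
  xi q hqt := by
    have hd := h.target hqt
    refine reeb_eq_of_lift hq (h.isLift hq hqt) ?_ ?_ ?_
    · rw [tauC_toric hq hd]; simp [toricReeb]
    · rw [chiC_toric hq hd, lamFour_apply]; simp [toricReeb]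
    · rw [etaC_toric hq hd, lamFive_apply]; simp [toricReeb]
  eta_smooth q _ := (contDiffAt_lamFive q).const_smul (2 / 3 : ℝ)
  xi_smooth _ _ := contDiffAt_const
  eta_xi q _ := by simp [lamFive_apply, toricReeb]

end YParam

namespace YParam

variable {P : YParam}

/-! ### The transverse Levi-Civita connection in toric coordinates -/

/-- The derivative of `k`. -/
def kder (P : YParam) (y : ℝ) : ℝ := deriv P.kfun y

lemma hasDerivAt_kfun {y : ℝ} (hy : 1 - y ≠ 0) : HasDerivAt P.kfun (P.kder y) y := by
  refine DifferentiableAt.hasDerivAt ?_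
  unfold kfun
  fun_prop (disch := assumption)

/-- The wedge product of two linear forms, as a bilinear map. -/
def wedgeL (a b : R5 →L[ℝ] ℝ) : R5 →L[ℝ] R5 →L[ℝ] ℝ := a.smulRight b - b.smulRight a

lemma wedgeL_apply (a b : R5 →L[ℝ] ℝ) (v w : R5) : wedgeL a b v w = a v * b w - b v * a w := rfl

/-- A frame of the bundle of anti-self-dual forms. -/
def toricASD (P : YParam) (i : Fin 3) (q : R5) : R5 →L[ℝ] R5 →L[ℝ] ℝ :=
  -- Up to signs, order and scale these are the three anti-self-dual forms of the orthonormal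
  -- coframe `toricForms`; the scaling removes the square roots `lenX` and `lenY`.
  ![(2 / 3 * (1 - q 2)) • wedgeL (pr 0) (pr 1) + (2 / 3 : ℝ) • wedgeL (pr 2) (lamFour q),
    (2 * (1 - q 0 ^ 2)) • wedgeL (pr 1) (pr 2) + (P.kfun (q 2) / 3) • wedgeL (pr 0) (lamFour q),
    ((1 - q 0 ^ 2) * P.kfun (q 2) / 3) • wedgeL (pr 1) (lamFour q)
      - (2 : ℝ) • wedgeL (pr 0) (pr 2)] i

lemma toricASD_zero (q v w : R5) : P.toricASD 0 q v w =
    2 / 3 * (1 - q 2) * (v 0 * w 1 - v 1 * w 0)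
      + 2 / 3 * (v 2 * (w 3 + q 0 * w 1) - (v 3 + q 0 * v 1) * w 2) := rfl

lemma toricASD_one (q v w : R5) : P.toricASD 1 q v w =
    2 * (1 - q 0 ^ 2) * (v 1 * w 2 - v 2 * w 1)
      + P.kfun (q 2) / 3 * (v 0 * (w 3 + q 0 * w 1) - (v 3 + q 0 * v 1) * w 0) := rfl

lemma toricASD_two (q v w : R5) : P.toricASD 2 q v w =
    (1 - q 0 ^ 2) * P.kfun (q 2) / 3 * (v 1 * (w 3 + q 0 * w 1) - (v 3 + q 0 * v 1) * w 1)
      - 2 * (v 0 * w 2 - v 2 * w 0) := rfl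

lemma contDiffAt_smul_of_normed {F : Type*} [NormedAddCommGroup F] [NormedSpace ℝ F] {c : R5 → ℝ}
    {f : R5 → F} {q : R5} (hc : ContDiffAt ℝ ∞ c q) (hf : ContDiffAt ℝ ∞ f q) :
    ContDiffAt ℝ ∞ (fun q => c q • f q) q := hc.smul hf

lemma contDiffAt_smul_wedgeL {c : R5 → ℝ} {a b : R5 → R5 →L[ℝ] ℝ} {q : R5}
    (hc : ContDiffAt ℝ ∞ c q) (ha : ContDiffAt ℝ ∞ a q) (hb : ContDiffAt ℝ ∞ b q) :
    ContDiffAt ℝ ∞ (fun q => c q • wedgeL (a q) (b q)) q :=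
  contDiffAt_smul_of_normed hc ((ha.smulRight hb).sub (hb.smulRight ha))

lemma contDiffAt_toricASD {q : R5} (h : q ∈ P.toricDom) (i : Fin 3) :
    ContDiffAt ℝ ∞ (P.toricASD i) q := by
  have k := contDiffAt_kfun h
  have l4 := contDiffAt_lamFour q
  have c : ∀ i, ContDiffAt ℝ ∞ (fun _ : R5 => pr i) q := fun i => contDiffAt_const
  have cx : ContDiffAt ℝ ∞ (fun q : R5 => 1 - q 0 ^ 2) q :=
    contDiffAt_const.sub ((contDiffAt_pr 0 q).pow 2)
  have cy : ContDiffAt ℝ ∞ (fun q : R5 => 1 - q 2) q := contDiffAt_const.sub (contDiffAt_pr 2 q)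
  fin_cases i
  · exact (contDiffAt_smul_wedgeL (contDiffAt_const.mul cy) (c 0) (c 1)).add
      (contDiffAt_smul_wedgeL contDiffAt_const (c 2) l4)
  · exact (contDiffAt_smul_wedgeL (contDiffAt_const.mul cx) (c 1) (c 2)).add
      (contDiffAt_smul_wedgeL (k.div_const 3) (c 0) l4)
  · exact (contDiffAt_smul_wedgeL ((cx.mul k).div_const 3) (c 1) l4).sub
      (contDiffAt_smul_wedgeL contDiffAt_const (c 0) (c 2))

/-- Reduces the derivative of a family of bilinear forms to one-variable derivatives of its entries
along a line. -/
lemma fderiv_bilinear_eq {B : R5 → R5 →L[ℝ] R5 →L[ℝ] ℝ} {q u v w : R5} {d : ℝ}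
    (hB : DifferentiableAt ℝ B q) (h : HasDerivAt (fun s : ℝ => B (q + s • u) v w) d 0) :
    fderiv ℝ B q u v w = d := by
  have hl : HasDerivAt (fun s : ℝ => q + s • u) u 0 := by
    simpa using ((hasDerivAt_id (0 : ℝ)).smul_const u).const_add q
  have h1 : HasDerivAt (fun s : ℝ => B (q + s • u)) (fderiv ℝ B q u) 0 :=
    HasFDerivAt.comp_hasDerivAt (x := (0 : ℝ)) (l := B) (l' := fderiv ℝ B q)
      (by simpa using hB.hasFDerivAt) hl
  have h2 := (h1.clm_apply (hasDerivAt_const 0 v)).clm_apply (hasDerivAt_const 0 w)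
  have := h2.unique h
  simpa using this

section Derivatives

variable {q : R5} (u : R5)

lemma hasDerivAt_coordinate (i : Fin 5) :
    HasDerivAt (fun s : ℝ => (q + s • u) i) (u i) 0 := by
  simpa using ((hasDerivAt_id (0 : ℝ)).mul_const (u i)).const_add (q i)

lemma hasDerivAt_kfun_line (h : q ∈ P.toricDom) :
    HasDerivAt (fun s : ℝ => P.kfun ((q + s • u) 2)) (P.kder (q 2) * u 2) 0 := by
  have := hasDerivAt_kfun (P := P) (toricDom_pos h).1.ne'
  exact HasDerivAt.comp (0 : ℝ) (h₂ := P.kfun) (by simpa using this) (hasDerivAt_coordinate u 2)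

lemma hasDerivAt_lamFour (v : R5) :
    HasDerivAt (fun s : ℝ => lamFour (q + s • u) v) (u 0 * v 1) 0 :=
  ((hasDerivAt_coordinate u 0).mul_const (v 1)).const_add (v 3)

lemma hasDerivAt_lamFive (v : R5) :
    HasDerivAt (fun s : ℝ => lamFive (q + s • u) v)
      (-(u 0 * v 1) + (u 2 * lamFour q v + q 2 * (u 0 * v 1))) 0 := by
  have := (((hasDerivAt_coordinate (q := q) u 0).mul_const (v 1)).const_sub (v 4)).add
    ((hasDerivAt_coordinate (q := q) u 2).mul (hasDerivAt_lamFour (q := q) u v))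
  refine this.congr_deriv ?_
  simp

lemma fderiv_toricMetric (h : q ∈ P.toricDom) (v w : R5) :
    fderiv ℝ P.toricMetric q u v w =
      (4 * (1 - q 2) * q 0 * u 0 / (3 * (1 - q 0 ^ 2) ^ 2) - 2 * u 2 / (3 * (1 - q 0 ^ 2)))
        * (v 0 * w 0)
      + (-(2 * u 2 * (1 - q 0 ^ 2)) / 3 - 4 * (1 - q 2) * q 0 * u 0 / 3) * (v 1 * w 1)
      - 4 * P.kder (q 2) * u 2 / P.kfun (q 2) ^ 2 * (v 2 * w 2)
      + P.kder (q 2) * u 2 / 9 * (lamFour q v * lamFour q w)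
      + P.kfun (q 2) / 9 * (u 0 * v 1 * lamFour q w + lamFour q v * (u 0 * w 1))
      + 4 / 9 * ((-(u 0 * v 1) + (u 2 * lamFour q v + q 2 * (u 0 * v 1))) * lamFive q w
        + lamFive q v * (-(u 0 * w 1) + (u 2 * lamFour q w + q 2 * (u 0 * w 1)))) := by
  obtain ⟨h1, h2, h3, h4, h5⟩ := toricDom_pos h
  have hk := kfun_pos h
  refine fderiv_bilinear_eq ((contDiffAt_toricMetric h).differentiableAt (by simp)) ?_
  have X := hasDerivAt_coordinate (q := q) u 0
  have Y := hasDerivAt_coordinate (q := q) u 2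
  have K := hasDerivAt_kfun_line u h
  have m := ((X.pow 2).const_sub 1)
  have p := Y.const_sub 1
  have t0 := ((p.const_mul 2).div (m.const_mul 3) (by simpa using h2.ne')).mul_const (v 0 * w 0)
  have t1 := (((p.const_mul 2).mul m).div_const 3).mul_const (v 1 * w 1)
  have t2 := ((hasDerivAt_const (0 : ℝ) (4 : ℝ)).div K (by simpa using hk.ne')).mul_const (v 2 * w 2)
  have t3 := (K.div_const 9).mul ((hasDerivAt_lamFour (q := q) u v).mul
    (hasDerivAt_lamFour (q := q) u w))
  have t4 := (((hasDerivAt_lamFive (q := q) u v).mul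
    (hasDerivAt_lamFive (q := q) u w))).const_mul (4 / 9)
  refine ((((t0.add t1).add t2).add t3).add t4).congr_deriv ?_
  simp
  field_simp
  ring

lemma fderiv_toricASD_zero (h : q ∈ P.toricDom) (v w : R5) :
    fderiv ℝ (P.toricASD 0) q u v w =
      -(2 / 3 * u 2 * (v 0 * w 1 - v 1 * w 0))
      + 2 / 3 * (v 2 * (u 0 * w 1) - u 0 * v 1 * w 2) := by
  refine fderiv_bilinear_eq ((contDiffAt_toricASD h 0).differentiableAt (by simp)) ?_
  have Y := hasDerivAt_coordinate (q := q) u 2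
  have t0 := ((Y.const_sub 1).const_mul (2 / 3)).mul_const (v 0 * w 1 - v 1 * w 0)
  have t1 := (((hasDerivAt_lamFour (q := q) u w).const_mul (v 2)).sub
    ((hasDerivAt_lamFour (q := q) u v).mul_const (w 2))).const_mul (2 / 3)
  refine (t0.add t1).congr_deriv ?_
  ring

lemma fderiv_toricASD_one (h : q ∈ P.toricDom) (v w : R5) :
    fderiv ℝ (P.toricASD 1) q u v w =
      -(4 * q 0 * u 0 * (v 1 * w 2 - v 2 * w 1))
      + P.kder (q 2) * u 2 / 3 * (v 0 * (w 3 + q 0 * w 1) - (v 3 + q 0 * v 1) * w 0)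
      + P.kfun (q 2) / 3 * (v 0 * (u 0 * w 1) - u 0 * v 1 * w 0) := by
  refine fderiv_bilinear_eq ((contDiffAt_toricASD h 1).differentiableAt (by simp)) ?_
  have X := hasDerivAt_coordinate (q := q) u 0
  have K := hasDerivAt_kfun_line u h
  have t0 := (((X.pow 2).const_sub 1).const_mul 2).mul_const (v 1 * w 2 - v 2 * w 1)
  have t1 := (K.div_const 3).mul (((hasDerivAt_lamFour (q := q) u w).const_mul (v 0)).sub
    ((hasDerivAt_lamFour (q := q) u v).mul_const (w 0)))
  refine (t0.add t1).congr_deriv ?_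
  simp [lamFour_apply]
  ring

lemma fderiv_toricASD_two (h : q ∈ P.toricDom) (v w : R5) :
    fderiv ℝ (P.toricASD 2) q u v w =
      (-(2 * q 0 * u 0 * P.kfun (q 2)) + (1 - q 0 ^ 2) * (P.kder (q 2) * u 2)) / 3
        * (v 1 * (w 3 + q 0 * w 1) - (v 3 + q 0 * v 1) * w 1)
      + (1 - q 0 ^ 2) * P.kfun (q 2) / 3 * (v 1 * (u 0 * w 1) - u 0 * v 1 * w 1) := by
  refine fderiv_bilinear_eq ((contDiffAt_toricASD h 2).differentiableAt (by simp)) ?_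
  have X := hasDerivAt_coordinate (q := q) u 0
  have K := hasDerivAt_kfun_line u h
  have t0 := ((((X.pow 2).const_sub 1).mul K).div_const 3).mul
    (((hasDerivAt_lamFour (q := q) u w).const_mul (v 1)).sub
    ((hasDerivAt_lamFour (q := q) u v).mul_const (w 1)))
  refine (t0.sub_const (2 * (v 0 * w 2 - v 2 * w 0))).congr_deriv ?_
  simp [lamFour_apply]

end Derivatives

/-- The horizontal fields `∂/∂x`, `∂/∂y` and `∂/∂β - y ∂/∂ψ`. -/
def toricField (i : Fin 3) (q : R5) : R5 :=
  ![![1, 0, 0, 0, 0], ![0, 0, 1, 0, 0], ![0, 0, 0, 1, -q 2]] i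

/-- The vector with given values of the forms `dx`, `dφ`, `dy`, `dβ + x dφ` and `3η/2`. -/
def ofForms (q : R5) (a b c d e : ℝ) : R5 := ![a, b, c, d - q 0 * b, e + q 0 * b - q 2 * d]

/-- The Christoffel symbols in the directions of the fields `toricField`. -/
def toricGamma (P : YParam) (i : Fin 3) (q v : R5) : R5 :=
  ![ofForms q (q 0 / (1 - q 0 ^ 2) * v 0 - v 2 / (2 * (1 - q 2)))
      (-(q 0 / (1 - q 0 ^ 2)) * v 1 + (P.kfun (q 2) * lamFour q v - 4 * (1 - q 2) * lamFive q v)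
        / (12 * (1 - q 2) * (1 - q 0 ^ 2)))
      (P.kfun (q 2) * v 0 / (12 * (1 - q 0 ^ 2))) (v 1 / 2) (-((1 - q 2) * v 1 / 2)),
    ofForms q (-(v 0 / (2 * (1 - q 2)))) (-(v 1 / (2 * (1 - q 2))))
      (-(P.kder (q 2) / (2 * P.kfun (q 2)) * v 2))
      (P.kder (q 2) / (2 * P.kfun (q 2)) * lamFour q v + 2 * lamFive q v / P.kfun (q 2))
      (lamFour q v / 2),
    ofForms q (-(P.kfun (q 2) * (1 - q 0 ^ 2) * v 1 / (12 * (1 - q 2))))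
      (P.kfun (q 2) * v 0 / (12 * (1 - q 2) * (1 - q 0 ^ 2)))
      (-(P.kfun (q 2) * P.kder (q 2) / 72 * lamFour q v) - P.kfun (q 2) / 18 * lamFive q v)
      (P.kder (q 2) / (2 * P.kfun (q 2)) * v 2) (v 2 / 2)] i

/-- Because `toricMetric` is positive definite, this identity characterizes `toricGamma`. The
components in `ofForms` refer to the forms that diagonalize the metric, so each of them can be
checked separately. -/
lemma toricGamma_spec {q : R5} (h : q ∈ P.toricDom) (i : Fin 3) (v w : R5) :
    2 * P.toricMetric q (P.toricGamma i q v) w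
      = LocalCoord.christoffel P.toricMetric q (toricField i q) v w := by
  obtain ⟨h1, h2, h3, h4, h5⟩ := toricDom_pos h
  have hk := (kfun_pos h).ne'
  have h1' := h1.ne'
  have h2' := h2.ne'
  rw [LocalCoord.christoffel, fderiv_toricMetric _ h, fderiv_toricMetric _ h,
    fderiv_toricMetric _ h, toricMetric_apply]
  simp only [lamFour_apply, lamFive_apply]
  fin_cases i
  · simp [toricGamma, toricField, ofForms, lamFour_apply, lamFive_apply]
    field_simp
    ring
  · simp [toricGamma, toricField, ofForms, lamFour_apply, lamFive_apply]
    field_simp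
    ring
  · simp [toricGamma, toricField, ofForms, lamFour_apply, lamFive_apply]
    field_simp
    ring

/-- The connection matrices of the frame `toricASD`. -/
def toricConn (P : YParam) (i : Fin 3) (q : R5) : Matrix (Fin 3) (Fin 3) ℝ :=
  ![!![0, P.kfun (q 2) / (2 * (1 - q 2)), 0;
      -(1 / (3 * (1 - q 0 ^ 2))), -(q 0 / (1 - q 0 ^ 2)), 0;
      0, 0, -(q 0 / (1 - q 0 ^ 2))],
    !![0, 0, 0;
      0, 1 / 2 * (P.kder (q 2) / P.kfun (q 2) + 1 / (1 - q 2)), 0;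
      0, 0, 1 / 2 * (P.kder (q 2) / P.kfun (q 2) + 1 / (1 - q 2))],
    !![0, 0, 0;
      0, 0, -((P.kfun (q 2) / (1 - q 2) + P.kder (q 2)) / 12);
      0, (P.kfun (q 2) / (1 - q 2) + P.kder (q 2)) / 12, 0]] i

/-- Column `j` of `toricConn i` lists the coefficients of the derivative of the `j`-th frame form
along the `i`-th field. The equality is needed only on `H`, where the `lamFive` terms of the
Christoffel symbols drop out. -/
lemma toricASD_covDeriv {q : R5} (h : q ∈ P.toricDom) (i j : Fin 3) {v w : R5}
    (hv : lamFive q v = 0) (hw : lamFive q w = 0) :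
    fderiv ℝ (P.toricASD j) q (toricField i q) v w - P.toricASD j q (P.toricGamma i q v) w
        - P.toricASD j q v (P.toricGamma i q w)
      = ∑ c, P.toricConn i q c j * P.toricASD c q v w := by
  obtain ⟨h1, h2, h3, h4, h5⟩ := toricDom_pos h
  have hk := (kfun_pos h).ne'
  have h1' := h1.ne'
  have h2' := h2.ne'
  rw [Fin.sum_univ_three, toricASD_zero, toricASD_one, toricASD_two]
  fin_cases j
  · simp only [Fin.zero_eta, fderiv_toricASD_zero _ h, toricASD_zero]
    fin_cases i <;> simp [toricGamma, toricField, ofForms, toricConn, hv, hw, lamFour_apply] <;>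
      field_simp <;> ring
  · simp only [Fin.mk_one, fderiv_toricASD_one _ h, toricASD_one]
    fin_cases i <;> simp [toricGamma, toricField, ofForms, toricConn, hv, hw, lamFour_apply] <;>
      field_simp <;> ring
  · simp only [Fin.reduceFinMk, fderiv_toricASD_two _ h, toricASD_two]
    fin_cases i <;> simp [toricGamma, toricField, ofForms, toricConn, hv, hw, lamFour_apply] <;>
      field_simp <;> ring

end YParam

namespace YParam

variable {P : YParam} {Θ : LocalCoord E5 R5 P.Y}

/-! ### Sections of `∧⁻H*` in toric coordinates -/

/-- The coefficients of the frame `toricASD` in the orthonormal coframe. -/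
def toricCoef (P : YParam) (j : Fin 3) (q : R5) : Fin 3 → ℝ :=
  ![![-1, 0, 0], ![0, 0, -(2 / (lenX q * P.lenY q))], ![0, 2 / (lenX q * P.lenY q), 0]] j

lemma contDiffAt_toricCoef {q : R5} (h : q ∈ P.toricDom) (j : Fin 3) :
    ContDiffAt ℝ ∞ (P.toricCoef j) q := by
  have hc : ContDiffAt ℝ ∞ (fun q => 2 / (lenX q * P.lenY q)) q :=
    contDiffAt_const.div ((contDiffAt_lenX h).mul (contDiffAt_lenY h))
      (mul_pos (lenX_pos h) (lenY_pos h)).ne'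
  refine contDiffAt_pi.mpr fun i => ?_
  fin_cases j <;> fin_cases i <;> first | exact contDiffAt_const | exact hc | exact hc.neg

lemma asdForm_toric {q : R5} (h : q ∈ P.toricDom) (t : Fin 3 → ℝ) (v w : R5) :
    asdForm (fun i => P.toricForms i q) t ![v, w]
      = -t 0 * P.toricASD 0 q v w - t 2 * (lenX q * P.lenY q / 2) * P.toricASD 1 q v w
        + t 1 * (lenX q * P.lenY q / 2) * P.toricASD 2 q v w := by
  obtain ⟨h1, h2, h3, h4, h5⟩ := toricDom_pos h
  obtain ⟨f0, f1, f2, f3⟩ := toricForms_apply (P := P) q v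
  obtain ⟨g0, g1, g2, g3⟩ := toricForms_apply (P := P) q w
  have hA := lenX_pos h
  have hB := lenY_pos h
  have hk := kfun_pos h
  have hA2 : (1 - q 2) = 3 * (1 - q 0 ^ 2) * lenX q ^ 2 / 2 := by
    rw [lenX_sq h]; field_simp
  have hB2 : P.kfun (q 2) = 4 / P.lenY q ^ 2 := by
    rw [lenY_sq h]; field_simp
  rw [asdForm_apply, f0, f1, f2, f3, g0, g1, g2, g3, toricASD_zero, toricASD_one, toricASD_two,
    hB2, hA2]
  simp only [lamFour_apply]
  field_simp
  ring

/-- The sections `toricASD` of `∧⁻H*`. -/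
def IsToric.frame (h : IsToric P Θ) (hq : 0 < P.q) (j : Fin 3) : ∀ x : P.Y, P.contactMetric.asd x :=
  (h.isCoframeExpr hq).toSection (P.toricCoef j)

lemma IsToric.frame_param (h : IsToric P Θ) (hq : 0 < P.q) (j : Fin 3) {q : R5}
    (hqt : q ∈ Θ.target) (v w : R5) :
    (h.frame hq j (Θ.param q)).1 ![Θ.dparam q v, Θ.dparam q w] = P.toricASD j q v w := by
  have hA := lenX_pos (h.target hqt)
  have hB := lenY_pos (h.target hqt)
  rw [IsToric.frame, LocalCoord.IsCoframeExpr.toSection_param _ _ hqt, asdForm_toric (h.target hqt)]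
  fin_cases j
  · simp [toricCoef]
  · simp [toricCoef]
    field_simp
  · simp [toricCoef]
    field_simp

lemma IsToric.smoothFormAt_frame (h : IsToric P Θ) (hq : 0 < P.q) (j : Fin 3) {q : R5}
    (hqt : q ∈ Θ.target) : P.contactMetric.SmoothFormAt (h.frame hq j) (Θ.param q) :=
  LocalCoord.IsCoframeExpr.smoothFormAt_toSection _ hqt (contDiffAt_toricCoef (h.target hqt) j)

lemma toricField_apply (q : R5) : toricField 0 q = ![1, 0, 0, 0, 0] ∧
    toricField 1 q = ![0, 0, 1, 0, 0] ∧ toricField 2 q = ![0, 0, 0, 1, -q 2] := ⟨rfl, rfl, rfl⟩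

lemma lamFive_toricField (i : Fin 3) (q : R5) : lamFive q (toricField i q) = 0 := by
  fin_cases i <;> simp [lamFive_apply, toricField]

lemma contDiffAt_toricField (i : Fin 3) (q : R5) : ContDiffAt ℝ ∞ (toricField i) q := by
  refine contDiffAt_pi.mpr fun j => ?_
  fin_cases i <;> fin_cases j <;>
    first | exact contDiffAt_const | exact (contDiffAt_pr 2 q).neg

/-- The coefficients of a section in the frame `toricASD`. -/
def toricCoeff (Θ : LocalCoord E5 R5 P.Y) (α : ∀ x : P.Y, P.contactMetric.asd x) (c : Fin 3)
    (q : R5) : ℝ :=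
  ![3 / 2 * (α (Θ.param q)).1 ![Θ.dparam q (toricField 1 q), Θ.dparam q (toricField 2 q)],
    3 / P.kfun (q 2) *
      (α (Θ.param q)).1 ![Θ.dparam q (toricField 0 q), Θ.dparam q (toricField 2 q)],
    -(1 / 2) * (α (Θ.param q)).1 ![Θ.dparam q (toricField 0 q), Θ.dparam q (toricField 1 q)]] c

/-- Each pair among the three fields pairs non-trivially with exactly one frame form. Three
horizontal fields therefore suffice to read off all coefficients, which is how `toricCoeff` is
normalized. -/
lemma toricASD_toricField (s : Fin 3 → ℝ) (q : R5) :
    (∑ c, s c * P.toricASD c q (toricField 1 q) (toricField 2 q) = 2 / 3 * s 0) ∧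
    (∑ c, s c * P.toricASD c q (toricField 0 q) (toricField 2 q) = P.kfun (q 2) / 3 * s 1) ∧
    (∑ c, s c * P.toricASD c q (toricField 0 q) (toricField 1 q) = -2 * s 2) := by
  obtain ⟨e0, e1, e2⟩ := toricField_apply q
  simp only [Fin.sum_univ_three, toricASD_zero, toricASD_one, toricASD_two, e0, e1, e2]
  refine ⟨?_, ?_, ?_⟩ <;> simp <;> ring

lemma toricASD_independent {q : R5} (h : q ∈ P.toricDom) {s s' : Fin 3 → ℝ}
    (hs : ∀ v w, lamFive q v = 0 → lamFive q w = 0 →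
      ∑ c, s c * P.toricASD c q v w = ∑ c, s' c * P.toricASD c q v w) : s = s' := by
  have hk := (kfun_pos h).ne'
  obtain ⟨a0, a1, a2⟩ := toricASD_toricField (P := P) s q
  obtain ⟨b0, b1, b2⟩ := toricASD_toricField (P := P) s' q
  have z := fun i => lamFive_toricField i q
  rw [hs _ _ (z 1) (z 2), b0] at a0
  rw [hs _ _ (z 0) (z 2), b1] at a1
  rw [hs _ _ (z 0) (z 1), b2] at a2
  funext c
  fin_cases c
  · show s 0 = s' 0
    linarith
  · show s 1 = s' 1
    exact (mul_left_cancel₀ (div_ne_zero hk three_ne_zero) a1).symm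
  · show s 2 = s' 2
    linarith

lemma toricCoeff_eq {q : R5} (h : q ∈ P.toricDom) {α : ∀ x : P.Y, P.contactMetric.asd x}
    {s : Fin 3 → ℝ} (hs : ∀ v w, (α (Θ.param q)).1 ![Θ.dparam q v, Θ.dparam q w]
      = ∑ c, s c * P.toricASD c q v w) (c : Fin 3) : toricCoeff Θ α c q = s c := by
  have hk := (kfun_pos h).ne'
  obtain ⟨a0, a1, a2⟩ := toricASD_toricField (P := P) s q
  fin_cases c
  · simp only [toricCoeff, hs, a0, a1, a2]
    simp
    ring
  · simp only [toricCoeff, hs, a0, a1, a2]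
    simp
    field_simp
  · simp only [toricCoeff, hs, a0, a1, a2]
    simp

lemma IsToric.exists_coeff (h : IsToric P Θ) (hq : 0 < P.q) {q : R5} (hqt : q ∈ Θ.target)
    (α : P.contactMetric.asd (Θ.param q)) : ∃ s : Fin 3 → ℝ, ∀ v w,
      α.1 ![Θ.dparam q v, Θ.dparam q w] = ∑ c, s c * P.toricASD c q v w := by
  obtain ⟨t, rfl⟩ := (h.isCoframeExpr hq).exists_toSection_eq (LocalCoord.param_mem hqt) α
  refine ⟨![-t 0, -t 2 * (lenX q * P.lenY q / 2), t 1 * (lenX q * P.lenY q / 2)], fun v w => ?_⟩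
  rw [LocalCoord.IsCoframeExpr.toSection_param _ _ hqt, asdForm_toric (h.target hqt),
    Fin.sum_univ_three]
  simp
  ring

lemma IsToric.expand (h : IsToric P Θ) (hq : 0 < P.q) {q : R5} (hqt : q ∈ Θ.target)
    (α : ∀ x : P.Y, P.contactMetric.asd x) (v w : R5) :
    (α (Θ.param q)).1 ![Θ.dparam q v, Θ.dparam q w]
      = ∑ c, toricCoeff Θ α c q * P.toricASD c q v w := by
  obtain ⟨s, hs⟩ := h.exists_coeff hq hqt (α (Θ.param q))
  rw [hs]
  simp only [toricCoeff_eq (h.target hqt) hs]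

lemma ext_asd {E' : Type*} [NormedAddCommGroup E'] [NormedSpace ℝ E'] {Θ : LocalCoord E5 E' P.Y}
    {q : E'} (hqt : q ∈ Θ.target)
    {α β : P.contactMetric.asd (Θ.param q)}
    (hs : ∀ v w, α.1 ![Θ.dparam q v, Θ.dparam q w] = β.1 ![Θ.dparam q v, Θ.dparam q w]) :
    α = β := by
  apply Subtype.ext
  ext v
  have e : v = ![Θ.dparam q (Θ.dcoords q (v 0)), Θ.dparam q (Θ.dcoords q (v 1))] := by
    rw [LocalCoord.dparam_dcoords hqt, LocalCoord.dparam_dcoords hqt]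
    funext i; fin_cases i <;> rfl
  rw [e]
  exact hs _ _

lemma IsToric.contDiffAt_toricCoeff (h : IsToric P Θ) {q : R5} (hqt : q ∈ Θ.target)
    {α : ∀ x : P.Y, P.contactMetric.asd x} (hα : P.contactMetric.SmoothFormAt α (Θ.param q))
    (c : Fin 3) : ContDiffAt ℝ ∞ (toricCoeff Θ α c) q := by
  have key : ∀ i j : Fin 3, ContDiffAt ℝ ∞ (fun q => (α (Θ.param q)).1
      ![Θ.dparam q (toricField i q), Θ.dparam q (toricField j q)]) q := by
    intro i j
    have h1 := hα (Θ.push (toricField i)) (Θ.push (toricField j))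
      (LocalCoord.smoothFieldAt_push hqt (contDiffAt_toricField i q))
      (LocalCoord.smoothFieldAt_push hqt (contDiffAt_toricField j q))
    refine (LocalCoord.contDiffAt_comp_param hqt h1).congr_of_eventuallyEq ?_
    filter_upwards [Θ.open_target.mem_nhds hqt] with q' hq'
    simp only [Function.comp, LocalCoord.push_param hq']
  have hk : ContDiffAt ℝ ∞ (fun q : R5 => 3 / P.kfun (q 2)) q :=
    contDiffAt_const.div (contDiffAt_kfun (h.target hqt)) (kfun_pos (h.target hqt)).ne'
  fin_cases c
  · exact contDiffAt_const.mul (key 1 2)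
  · exact hk.mul (key 0 2)
  · exact contDiffAt_const.mul (key 0 1)

lemma toricCoeff_frame (h : IsToric P Θ) (hq : 0 < P.q) {q : R5} (hqt : q ∈ Θ.target)
    (a c : Fin 3) : toricCoeff Θ (h.frame hq a) c q = if c = a then 1 else 0 := by
  refine toricCoeff_eq (h.target hqt) (s := fun c => if c = a then 1 else 0) (fun v w => ?_) c
  rw [h.frame_param hq a hqt]
  simp

lemma fderiv_sum_smul {F : Type*} [NormedAddCommGroup F] [NormedSpace ℝ F] {c : Fin 3 → R5 → ℝ}
    {f : Fin 3 → R5 → F} {q : R5} (hc : ∀ i, DifferentiableAt ℝ (c i) q)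
    (hf : ∀ i, DifferentiableAt ℝ (f i) q) (u : R5) :
    DifferentiableAt ℝ (fun q => ∑ i, c i q • f i q) q ∧
    fderiv ℝ (fun q => ∑ i, c i q • f i q) q u
      = ∑ i, (fderiv ℝ (c i) q u • f i q + c i q • fderiv ℝ (f i) q u) := by
  have h : HasFDerivAt (fun q => ∑ i, c i q • f i q) _ q :=
    HasFDerivAt.fun_sum fun i _ => (hc i).hasFDerivAt.smul (hf i).hasFDerivAt
  refine ⟨h.differentiableAt, ?_⟩
  rw [h.fderiv]
  simp [add_comm]

/-- This is the Leibniz rule in the frame `toricASD`: the coefficients are differentiated, and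
`toricASD_covDeriv` gives the derivatives of the frame. -/
theorem IsToric.hasCovDerivAt_iff (h : IsToric P Θ) (hq : 0 < P.q) {q : R5} (hqt : q ∈ Θ.target)
    {α : ∀ x : P.Y, P.contactMetric.asd x} (hα : ∀ c, DifferentiableAt ℝ (toricCoeff Θ α c) q)
    (i : Fin 3) (β : P.contactMetric.asd (Θ.param q)) :
    P.contactMetric.HasCovDerivAt α (Θ.push (toricField i)) (Θ.param q) β ↔
      ∀ v w, lamFive q v = 0 → lamFive q w = 0 → β.1 ![Θ.dparam q v, Θ.dparam q w]
        = ∑ c, (fderiv ℝ (toricCoeff Θ α c) q (toricField i q)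
          + ∑ b, P.toricConn i q c b * toricCoeff Θ α b q) * P.toricASD c q v w := by
  have hd := h.target hqt
  have hC := h.isContactExpr hq
  obtain ⟨ha, hfd⟩ := fderiv_sum_smul hα
    (fun c => (contDiffAt_toricASD (P := P) hd c).differentiableAt (by simp)) (toricField i q)
  have hX0 : ∀ y, P.contactMetric.η y (Θ.push (toricField i) y) = 0 := by
    intro y
    by_cases hy : y ∈ Θ.source
    · rw [← LocalCoord.param_coords hy, LocalCoord.push_param (LocalCoord.coords_mem hy),
        hC.eta _ (LocalCoord.coords_mem hy)]
      simp [lamFive_toricField]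
    · rw [LocalCoord.push_of_notMem hy, map_zero]
  rw [(h.isMetricExpr hq).hasCovDerivAt_iff hC hqt
    (LocalCoord.smoothFieldAt_push hqt (contDiffAt_toricField i q)) hX0 ha
    (fun q' hq' v w => by
      rw [h.expand hq hq']
      simp [Fin.sum_univ_three])
    (Γ := P.toricGamma i q)
    (fun v w => by rw [LocalCoord.hat_push hqt]; exact toricGamma_spec hd i v w)]
  rw [LocalCoord.hat_push hqt]
  have h5 : ∀ v, ((2 / 3 : ℝ) • lamFive q) v = 0 ↔ lamFive q v = 0 := fun v => by simp
  simp only [h5]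
  have key : ∀ v w, lamFive q v = 0 → lamFive q w = 0 →
      fderiv ℝ (fun q => ∑ c, toricCoeff Θ α c q • P.toricASD c q) q (toricField i q) v w
        - (∑ c, toricCoeff Θ α c q • P.toricASD c q) (P.toricGamma i q v) w
        - (∑ c, toricCoeff Θ α c q • P.toricASD c q) v (P.toricGamma i q w)
      = ∑ c, (fderiv ℝ (toricCoeff Θ α c) q (toricField i q)
          + ∑ b, P.toricConn i q c b * toricCoeff Θ α b q) * P.toricASD c q v w := by
    intro v w hv hw
    rw [hfd]
    have k0 := toricASD_covDeriv hd i 0 hv hw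
    have k1 := toricASD_covDeriv hd i 1 hv hw
    have k2 := toricASD_covDeriv hd i 2 hv hw
    simp [Fin.sum_univ_three] at k0 k1 k2 ⊢
    linear_combination toricCoeff Θ α 0 q * k0 + toricCoeff Θ α 1 q * k1 + toricCoeff Θ α 2 q * k2
  constructor
  · intro H v w hv hw
    rw [H v w hv hw, key v w hv hw]
  · intro H v w hv hw
    rw [H v w hv hw, ← key v w hv hw]

/-- The matrix of a gauge transformation in the frame `toricASD`. -/
def IsToric.gaugeMatrix (h : IsToric P Θ) (hq : 0 < P.q)
    (u : P.contactMetric.GaugeTransformation) (q : R5) : Matrix (Fin 3) (Fin 3) ℝ :=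
  Matrix.of fun c a => toricCoeff Θ (fun y => u.toFun y (h.frame hq a y)) c q

lemma IsToric.contDiffAt_gaugeMatrix (h : IsToric P Θ) (hq : 0 < P.q)
    (u : P.contactMetric.GaugeTransformation) {q : R5} (hqt : q ∈ Θ.target) (c a : Fin 3) :
    ContDiffAt ℝ ∞ (fun q => h.gaugeMatrix hq u q c a) q :=
  h.contDiffAt_toricCoeff hqt (u.smooth _ _ (h.smoothFormAt_frame hq a hqt)) c

/-- Applying `u` to the derivative of a frame section with connection matrix `A` gives `U A`;
differentiating the image under `u` gives `∂U + A U`. Parallelism equates the two. -/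
theorem IsToric.fderiv_gaugeMatrix (h : IsToric P Θ) (hq : 0 < P.q)
    {u : P.contactMetric.GaugeTransformation} (hu : u.IsParallel) {q : R5} (hqt : q ∈ Θ.target)
    (i c a : Fin 3) :
    fderiv ℝ (fun q => h.gaugeMatrix hq u q c a) q (toricField i q)
      = (h.gaugeMatrix hq u q * P.toricConn i q - P.toricConn i q * h.gaugeMatrix hq u q) c a := by
  have hd := h.target hqt
  -- `β` is the covariant derivative of the `a`-th frame section, whose coefficients are constant
  -- near `q`.
  let β : P.contactMetric.asd (Θ.param q) := ∑ b, P.toricConn i q b a • h.frame hq b (Θ.param q)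
  have hev : ∀ c, toricCoeff Θ (h.frame hq a) c =ᶠ[𝓝 q] fun _ => if c = a then 1 else 0 := by
    intro c
    filter_upwards [Θ.open_target.mem_nhds hqt] with q' hq' using toricCoeff_frame h hq hq' a c
  have hcov : P.contactMetric.HasCovDerivAt (h.frame hq a) (Θ.push (toricField i)) (Θ.param q) β := by
    refine (h.hasCovDerivAt_iff hq hqt (fun c => ?_) i β).mpr fun v w _ _ => ?_
    · exact (differentiableAt_const _).congr_of_eventuallyEq (hev c)
    · have e : ∀ c, fderiv ℝ (toricCoeff Θ (h.frame hq a) c) q (toricField i q) = 0 := by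
        intro c
        rw [(hev c).fderiv_eq]; simp
      simp only [e, toricCoeff_frame h hq hqt, zero_add]
      have : β.1 ![Θ.dparam q v, Θ.dparam q w]
          = ∑ b, P.toricConn i q b a * (h.frame hq b (Θ.param q)).1 ![Θ.dparam q v, Θ.dparam q w] := by
        simp only [β, Fin.sum_univ_three]
        rfl
      rw [this]
      simp [h.frame_param hq _ hqt]
  have hcov' := hu (Θ.param q) _ _ β
    (LocalCoord.smoothFieldAt_push hqt (contDiffAt_toricField i q))
    (h.smoothFormAt_frame hq a hqt) hcov
  rw [h.hasCovDerivAt_iff hq hqt (α := fun y => u.toFun y (h.frame hq a y)) (fun c =>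
    (h.contDiffAt_gaugeMatrix hq u hqt c a).differentiableAt (by simp)) i] at hcov'
  have huβ : ∀ v w, (u.toFun (Θ.param q) β).1 ![Θ.dparam q v, Θ.dparam q w]
      = ∑ c, (∑ b, h.gaugeMatrix hq u q c b * P.toricConn i q b a) * P.toricASD c q v w := by
    intro v w
    have e : (u.toFun (Θ.param q) β).1 ![Θ.dparam q v, Θ.dparam q w]
        = ∑ b, P.toricConn i q b a *
          (u.toFun (Θ.param q) (h.frame hq b (Θ.param q))).1 ![Θ.dparam q v, Θ.dparam q w] := by
      simp only [β, Fin.sum_univ_three, map_add, map_smul]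
      rfl
    rw [e]
    have e2 : ∀ b, (u.toFun (Θ.param q) (h.frame hq b (Θ.param q))).1
        ![Θ.dparam q v, Θ.dparam q w] = ∑ c, h.gaugeMatrix hq u q c b * P.toricASD c q v w :=
      fun b => h.expand hq hqt (fun y => u.toFun y (h.frame hq b y)) v w
    simp only [e2, Fin.sum_univ_three]
    ring
  have hfin := toricASD_independent hd fun v w hv hw => (huβ v w).symm.trans (hcov' v w hv hw)
  have := congrFun hfin c
  rw [Matrix.sub_apply, Matrix.mul_apply, Matrix.mul_apply, this]
  simp only [IsToric.gaugeMatrix, Matrix.of_apply]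
  ring

end YParam

/-! ### Commutation with the curvature -/

/-- The entrywise derivative of a matrix-valued function in the direction `v`. -/
def mderiv (v : R5) (U : R5 → Matrix (Fin 3) (Fin 3) ℝ) (q : R5) : Matrix (Fin 3) (Fin 3) ℝ :=
  Matrix.of fun i j => fderiv ℝ (fun q => U q i j) q v

lemma mderiv_apply (v : R5) (U : R5 → Matrix (Fin 3) (Fin 3) ℝ) (q : R5) (i j : Fin 3) :
    mderiv v U q i j = fderiv ℝ (fun q => U q i j) q v := rfl

lemma mderiv_mul {U A : R5 → Matrix (Fin 3) (Fin 3) ℝ} {q : R5} (v : R5)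
    (hU : ∀ i j, DifferentiableAt ℝ (fun q => U q i j) q)
    (hA : ∀ i j, DifferentiableAt ℝ (fun q => A q i j) q) :
    (∀ i j, DifferentiableAt ℝ (fun q => (U q * A q) i j) q) ∧
    mderiv v (fun q => U q * A q) q = mderiv v U q * A q + U q * mderiv v A q := by
  have h : ∀ i j, HasFDerivAt (fun q => (U q * A q) i j)
      (∑ k, (U q i k • fderiv ℝ (fun q => A q k j) q + A q k j • fderiv ℝ (fun q => U q i k) q)) q := by
    intro i j
    simp only [Matrix.mul_apply]
    exact HasFDerivAt.fun_sum fun k _ => (hU i k).hasFDerivAt.mul (hA k j).hasFDerivAt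
  refine ⟨fun i j => (h i j).differentiableAt, ?_⟩
  ext i j
  rw [mderiv_apply, (h i j).fderiv, Matrix.add_apply, Matrix.mul_apply, Matrix.mul_apply]
  simp only [mderiv_apply, Fin.sum_univ_three]
  simp
  ring

lemma mderiv_sub {U A : R5 → Matrix (Fin 3) (Fin 3) ℝ} {q : R5} (v : R5)
    (hU : ∀ i j, DifferentiableAt ℝ (fun q => U q i j) q)
    (hA : ∀ i j, DifferentiableAt ℝ (fun q => A q i j) q) :
    mderiv v (fun q => U q - A q) q = mderiv v U q - mderiv v A q := by
  ext i j
  have h : HasFDerivAt (fun q => (U q - A q) i j) _ q := (hU i j).hasFDerivAt.sub (hA i j).hasFDerivAt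
  rw [mderiv_apply, h.fderiv]
  rfl

lemma fderiv_fderiv_apply {g : R5 → ℝ} {X : R5 → R5} {q : R5} (hg : ContDiffAt ℝ ∞ g q)
    (hX : DifferentiableAt ℝ X q) (v : R5) :
    fderiv ℝ (fun q => fderiv ℝ g q (X q)) q v
      = fderiv ℝ (fderiv ℝ g) q v (X q) + fderiv ℝ g q (fderiv ℝ X q v) := by
  have h1 : DifferentiableAt ℝ (fderiv ℝ g) q :=
    (hg.fderiv_right (m := 1) (by norm_cast)).differentiableAt (by simp)
  rw [(h1.hasFDerivAt.clm_apply hX.hasFDerivAt).fderiv]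
  simp [add_comm]

/-- If `U` is parallel for the connection with matrices `A`, `B` in the directions of the commuting
fields `X`, `Y`, then `U` commutes with the curvature. -/
theorem commute_curvature {U A B : R5 → Matrix (Fin 3) (Fin 3) ℝ} {X Y : R5 → R5} {q : R5}
    (hU : ∀ i j, ContDiffAt ℝ ∞ (fun q => U q i j) q)
    (hA : ∀ i j, DifferentiableAt ℝ (fun q => A q i j) q)
    (hB : ∀ i j, DifferentiableAt ℝ (fun q => B q i j) q)
    (hX : DifferentiableAt ℝ X q) (hY : DifferentiableAt ℝ Y q)
    (hXY : fderiv ℝ X q (Y q) = fderiv ℝ Y q (X q))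
    (hUX : ∀ᶠ q' in 𝓝 q, mderiv (X q') U q' = U q' * A q' - A q' * U q')
    (hUY : ∀ᶠ q' in 𝓝 q, mderiv (Y q') U q' = U q' * B q' - B q' * U q') :
    U q * (B q * A q - A q * B q + mderiv (Y q) A q - mderiv (X q) B q)
      = (B q * A q - A q * B q + mderiv (Y q) A q - mderiv (X q) B q) * U q := by
  have hU' : ∀ i j, DifferentiableAt ℝ (fun q => U q i j) q := fun i j =>
    (hU i j).differentiableAt (by simp)
  -- Second derivatives are symmetric and `X`, `Y` commute, so the iterated derivatives of `U` in
  -- the two orders agree.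
  have hsymm : mderiv (Y q) (fun q' => mderiv (X q') U q') q
      = mderiv (X q) (fun q' => mderiv (Y q') U q') q := by
    ext i j
    simp only [mderiv_apply]
    rw [fderiv_fderiv_apply (hU i j) hX, fderiv_fderiv_apply (hU i j) hY, hXY]
    congr 1
    exact (hU i j).isSymmSndFDerivAt (by
      rw [minSmoothness_of_isRCLikeNormedField]; exact WithTop.coe_le_coe.mpr le_top) (Y q) (X q)
  have e : ∀ {Z : R5 → R5} {D : R5 → Matrix (Fin 3) (Fin 3) ℝ} (v : R5),
      (∀ i j, DifferentiableAt ℝ (fun q => D q i j) q) →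
      (∀ᶠ q' in 𝓝 q, mderiv (Z q') U q' = U q' * D q' - D q' * U q') →
      mderiv v (fun q' => mderiv (Z q') U q') q = mderiv v U q * D q + U q * mderiv v D q
        - (mderiv v D q * U q + D q * mderiv v U q) := by
    intro Z D v hD hZ
    obtain ⟨d1, e1⟩ := mderiv_mul v hU' hD
    obtain ⟨d2, e2⟩ := mderiv_mul v hD hU'
    rw [← e1, ← e2, ← mderiv_sub v d1 d2]
    ext i j
    simp only [mderiv_apply]
    rw [Filter.EventuallyEq.fderiv_eq]
    filter_upwards [hZ] with q' hq'
    rw [← hq', mderiv_apply]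
  -- Inserting `∂_X U = [U, A]` and `∂_Y U = [U, B]`, the terms quadratic in `A, B` combine, as in
  -- the Jacobi identity, to the commutator of `U` with `[B, A]`.
  rw [e (Y q) hA hUX, e (X q) hB hUY, hUX.self_of_nhds, hUY.self_of_nhds] at hsymm
  have : ∀ M N : Matrix (Fin 3) (Fin 3) ℝ, M - N = 0 → M = N := fun M N => sub_eq_zero.mp
  apply this
  have h2 := sub_eq_zero.mpr hsymm
  rw [← h2]
  noncomm_ring

/-! ### The curvature in toric coordinates and the pointwise conclusion -/

namespace YParam

variable {P : YParam} {Θ : LocalCoord E5 R5 P.Y}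

lemma differentiableAt_kder {q : R5} (h : q ∈ P.toricDom) :
    DifferentiableAt ℝ (fun q : R5 => P.kder (q 2)) q := by
  have h1 := (toricDom_pos h).1.ne'
  have hk : ContDiffAt ℝ ∞ P.kfun (q 2) := by
    unfold kfun
    fun_prop (disch := assumption)
  have h2 : DifferentiableAt ℝ P.kder (q 2) := by
    have : P.kder = fun y => fderiv ℝ P.kfun y 1 := by funext y; exact fderiv_apply_one_eq_deriv.symm
    rw [this]
    exact ((hk.fderiv_right (m := 1) (by norm_cast)).differentiableAt (by simp)).clm_apply
      (differentiableAt_const _)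
  exact h2.comp q (pr 2).differentiableAt

lemma differentiableAt_toricConn {q : R5} (h : q ∈ P.toricDom) (l i j : Fin 3) :
    DifferentiableAt ℝ (fun q => P.toricConn l q i j) q := by
  obtain ⟨h1, h2, h3, h4, h5⟩ := toricDom_pos h
  have hk0 := (kfun_pos h).ne'
  have h1' := h1.ne'
  have h2' := h2.ne'
  have hk := (contDiffAt_kfun h).differentiableAt (by simp)
  have hk' := differentiableAt_kder h
  fin_cases l <;> fin_cases i <;> fin_cases j <;> simp [toricConn] <;>
    fun_prop (disch := simp [*])

lemma fderiv_eq_zero_of_line {f : R5 → ℝ} {q u : R5} (h : ∀ s : ℝ, f (q + s • u) = f q) :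
    fderiv ℝ f q u = 0 := by
  by_cases hf : DifferentiableAt ℝ f q
  · have hl : HasDerivAt (fun s : ℝ => q + s • u) u 0 := by
      simpa using ((hasDerivAt_id (0 : ℝ)).smul_const u).const_add q
    have h1 : HasDerivAt (fun s : ℝ => f (q + s • u)) (fderiv ℝ f q u) 0 :=
      HasFDerivAt.comp_hasDerivAt (x := (0 : ℝ)) (l := f) (l' := fderiv ℝ f q)
        (by simpa using hf.hasFDerivAt) hl
    simp only [h] at h1
    exact h1.unique (hasDerivAt_const _ _)
  -- Without differentiability `fderiv` takes the default value zero, so the claim still holds.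
  · rw [fderiv_zero_of_not_differentiableAt hf]; rfl

/-- The factor `(1 - y)² (k/(1 - y))'`, which vanishes where the curvature degenerates. -/
def curvFactor (P : YParam) (y : ℝ) : ℝ := P.kder y * (1 - y) + P.kfun y

/-- `k/(1 - y)` has derivative `curvFactor/(1 - y)²`, and `k'/k + 1/(1 - y) = curvFactor/(k (1 -
y))`; hence every entry contains `curvFactor`. The opposite signs of the two non-zero entries show
an infinitesimal rotation in the plane of the frame forms `0` and `1`, up to their unequal lengths.
-/
lemma curvature_xy {q : R5} (h : q ∈ P.toricDom) :
    P.toricConn 1 q * P.toricConn 0 q - P.toricConn 0 q * P.toricConn 1 q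
        + mderiv (toricField 1 q) (P.toricConn 0) q - mderiv (toricField 0 q) (P.toricConn 1) q
      = !![0, P.curvFactor (q 2) / (4 * (1 - q 2) ^ 2), 0;
          -(P.curvFactor (q 2) / (6 * P.kfun (q 2) * (1 - q 2) * (1 - q 0 ^ 2))), 0, 0;
          0, 0, 0] := by
  obtain ⟨h1, h2, h3, h4, h5⟩ := toricDom_pos h
  have hk0 := (kfun_pos h).ne'
  have h1' := h1.ne'
  have h2' := h2.ne'
  have e1 : mderiv (toricField 0 q) (P.toricConn 1) q = 0 := by
    ext i j
    rw [mderiv_apply]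
    exact fderiv_eq_zero_of_line fun s => by simp [toricConn, toricField]
  have e2 : mderiv (toricField 1 q) (P.toricConn 0) q
      = !![0, P.curvFactor (q 2) / (2 * (1 - q 2) ^ 2), 0; 0, 0, 0; 0, 0, 0] := by
    have z : ∀ i j, (i ≠ 0 ∨ j ≠ 1) → mderiv (toricField 1 q) (P.toricConn 0) q i j = 0 := by
      intro i j hij
      rw [mderiv_apply]
      refine fderiv_eq_zero_of_line fun s => ?_
      fin_cases i <;> fin_cases j <;> simp [toricConn, toricField] at hij ⊢
    have nz : mderiv (toricField 1 q) (P.toricConn 0) q 0 1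
        = P.curvFactor (q 2) / (2 * (1 - q 2) ^ 2) := by
      rw [mderiv_apply]
      have hy : HasFDerivAt (fun q : R5 => q 2) (pr 2) q := (pr 2).hasFDerivAt
      have hd : HasDerivAt (fun y => P.kfun y / (2 * (1 - y)))
          (P.curvFactor (q 2) / (2 * (1 - q 2) ^ 2)) (q 2) := by
        refine ((hasDerivAt_kfun (P := P) h1').div
          (((hasDerivAt_id (q 2)).const_sub 1).const_mul 2) (by simpa using h1')).congr_deriv ?_
        simp only [curvFactor, id]
        field_simp
        ring
      have hc : HasFDerivAt (fun q : R5 => P.toricConn 0 q 0 1)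
          ((P.curvFactor (q 2) / (2 * (1 - q 2) ^ 2)) • pr 2) q :=
        HasDerivAt.comp_hasFDerivAt (f := fun q : R5 => q 2) q hd hy
      rw [hc.fderiv]
      simp [toricField]
    ext i j
    fin_cases i <;> fin_cases j <;>
      first | exact nz | exact z _ _ (by simp)
  rw [e1, e2]
  ext i j
  fin_cases i <;> fin_cases j <;>
    simp [toricConn, curvFactor] <;> field_simp <;> ring

/-- `toricConn 0` does not depend on `β`, `ψ`, and `toricConn 2` does not depend on `x`, so only the
commutator contributes. It is a rotation in the plane of the frame forms `0` and `2`. -/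
lemma curvature_xbeta {q : R5} (h : q ∈ P.toricDom) :
    P.toricConn 2 q * P.toricConn 0 q - P.toricConn 0 q * P.toricConn 2 q
        + mderiv (toricField 2 q) (P.toricConn 0) q - mderiv (toricField 0 q) (P.toricConn 2) q
      = !![0, 0, P.curvFactor (q 2) * P.kfun (q 2) / (24 * (1 - q 2) ^ 2);
          0, 0, 0;
          -(P.curvFactor (q 2) / (36 * (1 - q 2) * (1 - q 0 ^ 2))), 0, 0] := by
  obtain ⟨h1, h2, h3, h4, h5⟩ := toricDom_pos h
  have hk0 := (kfun_pos h).ne'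
  have h1' := h1.ne'
  have h2' := h2.ne'
  have e1 : mderiv (toricField 0 q) (P.toricConn 2) q = 0 := by
    ext i j
    rw [mderiv_apply]
    exact fderiv_eq_zero_of_line fun s => by simp [toricConn, toricField]
  have e2 : mderiv (toricField 2 q) (P.toricConn 0) q = 0 := by
    ext i j
    rw [mderiv_apply]
    exact fderiv_eq_zero_of_line fun s => by simp [toricConn, toricField]
  rw [e1, e2]
  ext i j
  fin_cases i <;> fin_cases j <;>
    simp [toricConn, curvFactor] <;> field_simp <;> ring

/-- `U` preserves kernel and image of both matrices, that is, the axes `2` and `1` and the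
coordinate planes `0, 1` and `0, 2`; so it is diagonal. The entries `a` and `c` then identify the
diagonal values. -/
lemma eq_scalar_of_commute {U : Matrix (Fin 3) (Fin 3) ℝ} {a b c d : ℝ} (ha : a ≠ 0) (hb : b ≠ 0)
    (hc : c ≠ 0) (hd : d ≠ 0)
    (h1 : U * !![0, a, 0; b, 0, 0; 0, 0, 0] = !![0, a, 0; b, 0, 0; 0, 0, 0] * U)
    (h2 : U * !![0, 0, c; 0, 0, 0; d, 0, 0] = !![0, 0, c; 0, 0, 0; d, 0, 0] * U) (i j : Fin 3) :
    U i j = if i = j then U 0 0 else 0 := by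
  have k1 := fun i j => congrFun (congrFun h1 i) j
  have k2 := fun i j => congrFun (congrFun h2 i) j
  have a20 := k1 2 0
  have a21 := k1 2 1
  have a02 := k1 0 2
  have a12 := k1 1 2
  have a01 := k1 0 1
  have b12 := k2 1 2
  have b21 := k2 2 1
  have b02 := k2 0 2
  simp [Matrix.mul_apply, Fin.sum_univ_three, ha, hb, hc, hd] at a20 a21 a02 a12 a01 b12 b21 b02
  fin_cases i <;> fin_cases j <;> simp [*] <;> grind

lemma fderiv_toricField_zero (q v : R5) : fderiv ℝ (toricField 0) q v = 0 := by
  have : toricField 0 = fun _ => ![1, 0, 0, 0, 0] := rfl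
  rw [this]; simp

/-- None of the fields has coefficients depending on `x`, so `∂/∂x` commutes with all of them and no
bracket term appears in the curvature. -/
lemma fderiv_toricField_comm (i : Fin 3) (q : R5) :
    fderiv ℝ (toricField 0) q (toricField i q) = fderiv ℝ (toricField i) q (toricField 0 q) := by
  rw [fderiv_toricField_zero]
  have hd := ((contDiffAt_toricField i q).differentiableAt (by simp)).hasFDerivAt
  funext j
  have hj : HasFDerivAt (fun q => toricField i q j) ((pr j).comp (fderiv ℝ (toricField i) q)) q :=
    (pr j).hasFDerivAt.comp q hd
  have : fderiv ℝ (fun q => toricField i q j) q (toricField 0 q) = 0 :=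
    fderiv_eq_zero_of_line fun s => by
      fin_cases i <;> fin_cases j <;> simp [toricField]
  rw [hj.fderiv] at this
  exact this.symm

/-- A parallel gauge transformation is trivial at the points with toric coordinates where the
curvature does not degenerate. -/
theorem IsToric.gauge_eq (h : IsToric P Θ) (hq : 0 < P.q)
    {u : P.contactMetric.GaugeTransformation} (hu : u.IsParallel) {q : R5} (hqt : q ∈ Θ.target)
    (hc : P.curvFactor (q 2) ≠ 0) (α : P.contactMetric.asd (Θ.param q)) :
    u.toFun (Θ.param q) α = α := by
  have hd := h.target hqt
  obtain ⟨h1, h2, h3, h4, h5⟩ := toricDom_pos hd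
  have hk0 := (kfun_pos hd).ne'
  have h1' := h1.ne'
  have h2' := h2.ne'
  have hpar : ∀ i, ∀ᶠ q' in 𝓝 q, mderiv (toricField i q') (h.gaugeMatrix hq u) q'
      = h.gaugeMatrix hq u q' * P.toricConn i q' - P.toricConn i q' * h.gaugeMatrix hq u q' := by
    intro i
    filter_upwards [Θ.open_target.mem_nhds hqt] with q' hq'
    ext c a
    exact h.fderiv_gaugeMatrix hq hu hq' i c a
  have hcomm := fun i => commute_curvature (h.contDiffAt_gaugeMatrix hq u hqt)
    (differentiableAt_toricConn hd 0) (differentiableAt_toricConn hd i)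
    ((contDiffAt_toricField 0 q).differentiableAt (by simp))
    ((contDiffAt_toricField i q).differentiableAt (by simp)) (fderiv_toricField_comm i q)
    (hpar 0) (hpar i)
  have c1 := hcomm 1
  have c2 := hcomm 2
  rw [curvature_xy hd] at c1
  rw [curvature_xbeta hd] at c2
  have hs := eq_scalar_of_commute (by positivity) (neg_ne_zero.mpr (by positivity)) (by positivity)
    (neg_ne_zero.mpr (by positivity)) c1 c2
  obtain ⟨s, hsdef⟩ : ∃ s, s = h.gaugeMatrix hq u q 0 0 := ⟨_, rfl⟩
  rw [← hsdef] at hs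
  have hframe : ∀ a v w, (u.toFun (Θ.param q) (h.frame hq a (Θ.param q))).1
      ![Θ.dparam q v, Θ.dparam q w] = s * P.toricASD a q v w := by
    intro a v w
    have e : (u.toFun (Θ.param q) (h.frame hq a (Θ.param q))).1 ![Θ.dparam q v, Θ.dparam q w]
        = ∑ c, h.gaugeMatrix hq u q c a * P.toricASD c q v w :=
      h.expand hq hqt (fun y => u.toFun y (h.frame hq a y)) v w
    rw [e]
    simp [hs]
  have hscal : u.toFun (Θ.param q) = s • LinearMap.id := by
    refine LinearMap.ext fun β => ?_
    obtain ⟨t, ht⟩ := h.exists_coeff hq hqt β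
    have hβ : β = ∑ c, t c • h.frame hq c (Θ.param q) := by
      refine ext_asd hqt fun v w => ?_
      have e : (∑ c, t c • h.frame hq c (Θ.param q)).1 ![Θ.dparam q v, Θ.dparam q w]
          = ∑ c, t c * (h.frame hq c (Θ.param q)).1 ![Θ.dparam q v, Θ.dparam q w] := by
        simp only [Fin.sum_univ_three]
        rfl
      rw [ht, e]
      simp only [h.frame_param hq _ hqt]
    refine ext_asd hqt fun v w => ?_
    have e : (u.toFun (Θ.param q) β).1 ![Θ.dparam q v, Θ.dparam q w]
        = ∑ c, t c * (u.toFun (Θ.param q) (h.frame hq c (Θ.param q))).1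
          ![Θ.dparam q v, Θ.dparam q w] := by
      conv_lhs => rw [hβ]
      simp only [Fin.sum_univ_three, map_add, map_smul]
      rfl
    have e2 : ((s • LinearMap.id : P.contactMetric.asd (Θ.param q) →ₗ[ℝ] _) β).1
        ![Θ.dparam q v, Θ.dparam q w] = s * β.1 ![Θ.dparam q v, Θ.dparam q w] := rfl
    rw [e, e2, ht]
    simp only [hframe, Fin.sum_univ_three]
    ring
  obtain ⟨b, hb⟩ := (h.isCoframeExpr hq).coframe q hqt
  have hfree : Module.Free ℝ (P.contactMetric.asd (Θ.param q)) := Module.Free.of_equiv hb.asdEquiv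
  -- The fibre has dimension three, so the scalar satisfies `s³ = 1`, and `s` is real. In even rank
  -- the sign `-1` would survive.
  have hdet := u.det_eq_one (Θ.param q)
  rw [hscal, LinearMap.det_smul, LinearMap.det_id, mul_one, hb.finrank_asd] at hdet
  have hs1 : s = 1 := by
    nlinarith [sq_nonneg (s - 1), sq_nonneg (s + 1), sq_nonneg s]
  rw [hscal, hs1, one_smul, LinearMap.id_apply]

end YParam

namespace YParam

variable {P : YParam}

/-! ### Density of the points where the curvature does not degenerate -/

/-- As `a = -2 y₁ y₂ y₃`, the right-hand side is `4((1 - y)³ - (1 - a))`. The lower-order terms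
cancel because the roots have sum `3/2` and vanishing second symmetric function. -/
lemma one_sub_mul_curvFactor {y : ℝ} (hy : 1 - y ≠ 0) :
    (1 - y) * P.curvFactor y = 4 * ((1 - y) ^ 3 - 1 - 2 * (P.y₁ * P.y₂ * P.y₃)) := by
  have i := hasDerivAt_id y
  have hd := ((((i.sub_const P.y₁).const_mul 4).mul (i.const_sub P.y₂)).mul
    (i.const_sub P.y₃)).div (i.const_sub 1) hy
  have hk : P.kder y = _ := (hasDerivAt_kfun hy).unique (hd : HasDerivAt P.kfun _ y)
  rw [curvFactor, hk, kfun]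
  have h1 := P.y_sum
  have h2 := P.y_rel
  simp only [id, Pi.mul_apply]
  field_simp
  grind

/-- A zero of the factor prescribes `(1 - y)³`, and the real cube is injective. -/
lemma eq_of_curvFactor_eq_zero {y y' : ℝ} (hy : 1 - y ≠ 0) (hy' : 1 - y' ≠ 0)
    (h : P.curvFactor y = 0) (h' : P.curvFactor y' = 0) : y = y' := by
  have e := one_sub_mul_curvFactor (P := P) hy
  have e' := one_sub_mul_curvFactor (P := P) hy'
  rw [h, mul_zero] at e
  rw [h', mul_zero] at e'
  have : (1 - y) ^ 3 = (1 - y') ^ 3 := by linarith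
  have := (Odd.strictMono_pow (R := ℝ) (n := 3) (by decide)).injective this
  linarith

lemma polar_norm_sq_arg (z : ℂ) : polar (‖z‖ ^ 2) z.arg = z := by
  rw [polar, Real.sqrt_sq (norm_nonneg z), Complex.norm_mul_exp_arg_mul_I]

lemma exp_zpow_mul_polar (s r t : ℝ) (n : ℤ) :
    (Circle.exp s : ℂ) ^ n * polar r t = polar r (t + n * s) := by
  rw [polar, polar, Circle.coe_exp, ← Complex.exp_int_mul, mul_left_comm, ← Complex.exp_add]
  congr 2
  push_cast
  ring

/-- Every point of `S³ × S³` with non-vanishing coordinates lies on the orbit of a point with toric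
coordinates. -/
lemma exists_toric (hq : 0 < P.q) {z : C4} (hz : z ∈ spheres) (h1 : ∀ k, z.1 k ≠ 0)
    (h2 : ∀ k, z.2 k ≠ 0) : ∃ q ∈ P.toricDom, q 2 = P.yFun z ∧
      ∃ ζ : Circle, P.act ζ (P.toric q) = z := by
  have hΔ := y_sub_pos hq
  have hΔ0 := hΔ.ne'
  have hy1 := (P.y₁_neg hq).ne
  have hy2 := (P.y₂_pos hq).ne'
  have hp := P.p_pos'.ne'
  have n0 := sq_pos_of_pos (norm_pos_iff.mpr (h1 0))
  have n1 := sq_pos_of_pos (norm_pos_iff.mpr (h1 1))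
  have n2 := sq_pos_of_pos (norm_pos_iff.mpr (h2 0))
  have n3 := sq_pos_of_pos (norm_pos_iff.mpr (h2 1))
  obtain ⟨hz1, hz2⟩ := hz
  have m2 := mul_pos hΔ n2
  have m3 := mul_pos hΔ n3
  have r2 : P.yFun z - P.y₁ = (P.y₂ - P.y₁) * ‖z.2 0‖ ^ 2 := by
    unfold yFun; linear_combination P.y₁ * hz2
  have r3 : P.y₂ - P.yFun z = (P.y₂ - P.y₁) * ‖z.2 1‖ ^ 2 := by
    unfold yFun; linear_combination -P.y₂ * hz2
  -- Acting on `z` by the inverse of `exp(is)` makes the arguments of `z₀` and `z₁` opposite, as in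
  -- `toric`; `A` and `B` are the resulting arguments of `z₂` and `z₃`, from which `β` and `ψ = A +
  -- B` are solved.
  obtain ⟨s, hs⟩ : ∃ s, s = ((z.1 0).arg + (z.1 1).arg) / (2 * P.p) := ⟨_, rfl⟩
  obtain ⟨A, hA⟩ : ∃ A, A = (z.2 0).arg + P.wt 0 * s := ⟨_, rfl⟩
  obtain ⟨B, hB⟩ : ∃ B, B = (z.2 1).arg + P.wt 1 * s := ⟨_, rfl⟩
  refine ⟨![‖z.1 1‖ ^ 2 - ‖z.1 0‖ ^ 2, (z.1 0).arg - (z.1 1).arg, P.yFun z,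
    ((P.y₂ - P.y₁) * B - P.y₂ * (A + B)) / (P.y₁ * P.y₂), A + B], ⟨?_, ?_, ?_, ?_⟩, rfl,
    Circle.exp s, ?_⟩
  · simp; linarith
  · simp; linarith
  · simp; linarith
  · simp; linarith
  have key : ∀ {w : ℂ} {r t : ℝ}, ‖w‖ ^ 2 = r → w.arg = t → polar r t = w := by
    rintro w _ _ rfl rfl
    exact polar_norm_sq_arg w
  refine Prod.ext ?_ ?_ <;> funext k <;> fin_cases k <;>
    simp only [act, toric, Fin.zero_eta, Fin.mk_one, Matrix.cons_val_zero, Matrix.cons_val_one] <;>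
    rw [exp_zpow_mul_polar] <;> refine key ?_ ?_
  · linarith
  · rw [hs]; push_cast; field_simp; ring
  · linarith
  · rw [hs]; push_cast; field_simp; ring
  · simp [r2]; field_simp
  · simp [argTwo]; field_simp; rw [hA]; ring
  · simp [r3]; field_simp
  · simp [argThree]; field_simp; rw [hB]; ring

/-- A parallel gauge transformation is trivial at the points with non-vanishing coordinates where the
curvature does not degenerate. -/
lemma gauge_proj_eq (hq : 0 < P.q) {u : P.contactMetric.GaugeTransformation} (hu : u.IsParallel)
    (z : S3S3) (h1 : ∀ k, z.1.1 k ≠ 0) (h2 : ∀ k, z.1.2 k ≠ 0)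
    (hc : P.curvFactor (P.yFun z.1) ≠ 0) (α : P.contactMetric.asd (P.proj z)) :
    u.toFun (P.proj z) α = α := by
  obtain ⟨q, hqd, hqy, ζ, hζ⟩ := exists_toric hq z.2 h1 h2
  obtain ⟨Θ, hΘ, hqt⟩ := exists_isToric hq hqd
  obtain ⟨hm, hpar⟩ := hΘ.param q hqt
  have e : P.proj z = Θ.param q := by
    rw [hpar]
    exact (Quotient.sound (s := P.orbitSetoid) ⟨ζ, hζ⟩).symm
  have key : ∀ m, m = Θ.param q → ∀ α : P.contactMetric.asd m, u.toFun m α = α := by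
    rintro _ rfl α
    exact hΘ.gauge_eq hq hu hqt (by rwa [hqy]) α
  exact key _ e α

/-- A nearby complex number that grows in norm with `s`. -/
def grow (b : ℂ) (s : ℝ) : ℂ := b + s * (if b = 0 then 1 else b)

lemma continuous_grow (b : ℂ) : Continuous (grow b) := by
  unfold grow; fun_prop

lemma grow_zero (b : ℂ) : grow b 0 = b := by simp [grow]

lemma norm_grow (b : ℂ) {s : ℝ} (hs : 0 < s) :
    ‖grow b s‖ = if b = 0 then s else (1 + s) * ‖b‖ := by
  unfold grow
  split_ifs with h
  · simp [h, abs_of_pos hs]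
  · have : b + s * b = ((1 + s : ℝ) : ℂ) * b := by push_cast; ring
    rw [this, norm_mul, Complex.norm_real, Real.norm_eq_abs, abs_of_pos (by linarith)]

lemma grow_ne_zero (b : ℂ) {s : ℝ} (hs : 0 < s) : grow b s ≠ 0 := by
  rw [← norm_ne_zero_iff, norm_grow b hs]
  split_ifs with h
  · exact hs.ne'
  · have := norm_pos_iff.mpr h
    positivity

lemma norm_grow_injOn (b : ℂ) : InjOn (fun s => ‖grow b s‖) (Ioi 0) := by
  intro s hs t ht h
  simp only [norm_grow b hs, norm_grow b ht] at h
  split_ifs at h with hb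
  · exact h
  · have := mul_right_cancel₀ (norm_ne_zero_iff.mpr hb) h
    linarith

lemma slice_fst_ne_zero (κ : ChartIndex) {x : E5} (hx : x.1 ≠ 0) (k : Fin 2) :
    (P.slice κ x).1 k ≠ 0 := by
  simp only [slice]
  refine div_ne_zero ?_ (by exact_mod_cast (sqrt_pos' _).ne')
  split_ifs <;> simp [hx]

lemma slice_snd_ne_zero (κ : ChartIndex) {x : E5} (hx : x.2.1 ≠ 0) (k : Fin 2) :
    (P.slice κ x).2 k ≠ 0 := by
  simp only [slice]
  refine div_ne_zero ?_ (by exact_mod_cast (sqrt_pos' _).ne')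
  split_ifs <;> simp [hx, angle_ne]

lemma norm_snd_slice (κ : ChartIndex) (x : E5) :
    ‖(P.slice κ x).2 κ.j‖ ^ 2 = 1 / (1 + ‖x.2.1‖ ^ 2) := by
  have hp : 0 ≤ 1 + ‖x.2.1‖ ^ 2 := by positivity
  simp only [slice, if_true, norm_div, norm_angle, div_pow, Complex.norm_real, Real.norm_eq_abs,
    sq_abs, Real.sq_sqrt hp, one_pow]

/-- On the spheres `y` is a non-constant affine function of `|z₂|²` because `y₁ ≠ y₂`; in the slice
that modulus determines the norm of the second coordinate. -/
lemma norm_eq_of_yFun_slice_eq (hq : 0 < P.q) {κ : ChartIndex} {x x' : E5}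
    (h : P.yFun (P.slice κ x) = P.yFun (P.slice κ x')) : ‖x.2.1‖ = ‖x'.2.1‖ := by
  have hΔ := (y_sub_pos hq).ne'
  have m := (P.slice_mem κ x).2
  have m' := (P.slice_mem κ x').2
  have e : ‖(P.slice κ x).2 κ.j‖ ^ 2 = ‖(P.slice κ x').2 κ.j‖ ^ 2 := by
    have e0 : ‖(P.slice κ x).2 0‖ ^ 2 = ‖(P.slice κ x').2 0‖ ^ 2 := by
      unfold yFun at h
      apply mul_left_cancel₀ hΔ
      linear_combination h - P.y₁ * m + P.y₁ * m'
    have hj : ∀ j : Fin 2, ‖(P.slice κ x).2 j‖ ^ 2 = ‖(P.slice κ x').2 j‖ ^ 2 := by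
      intro j
      fin_cases j
      · exact e0
      · simp only [Fin.mk_one]; linarith
    exact hj _
  rw [norm_snd_slice, norm_snd_slice] at e
  have e2 : ‖x.2.1‖ ^ 2 = ‖x'.2.1‖ ^ 2 := by
    have p1 : 0 < 1 + ‖x.2.1‖ ^ 2 := by positivity
    have p2 : 0 < 1 + ‖x'.2.1‖ ^ 2 := by positivity
    rw [div_eq_div_iff p1.ne' p2.ne'] at e
    linarith
  exact (sq_eq_sq₀ (norm_nonneg _) (norm_nonneg _)).mp e2

/-- Points near `x` where no coordinate vanishes. -/
def nearby (x : E5) (s : ℝ) : E5 := (grow x.1 s, grow x.2.1 s, x.2.2)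

lemma tendsto_nearby (x : E5) : Filter.Tendsto (nearby x) (𝓝[>] 0) (𝓝 x) := by
  have hc : Continuous (nearby x) :=
    (continuous_grow _).prodMk ((continuous_grow _).prodMk continuous_const)
  have h0 : nearby x 0 = x := by simp [nearby, grow_zero]
  have := hc.tendsto 0
  rw [h0] at this
  exact this.mono_left nhdsWithin_le_nhds

/-- The factor vanishes for at most one value of `y`, and `y` takes each value at most once along
the curve `nearby x`. Hence at most one positive parameter is excluded. -/
lemma eventually_curvFactor_ne_zero (hq : 0 < P.q) (κ : ChartIndex) (x : E5) :
    ∀ᶠ s in 𝓝[>] (0 : ℝ), P.curvFactor (P.yFun (P.slice κ (nearby x s))) ≠ 0 := by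
  by_cases h : ∃ s, 0 < s ∧ P.curvFactor (P.yFun (P.slice κ (nearby x s))) = 0
  · obtain ⟨s₀, hs₀, h0⟩ := h
    filter_upwards [Ioo_mem_nhdsGT hs₀] with s hs h1
    have hy := fun s => (P.one_sub_yFun_pos (z := P.slice κ (nearby x s)) (P.slice_mem κ _)).ne'
    have e := norm_eq_of_yFun_slice_eq hq (eq_of_curvFactor_eq_zero (hy s) (hy s₀) h1 h0)
    exact hs.2.ne (norm_grow_injOn x.2.1 hs.1 hs₀ e)
  · push Not at h
    filter_upwards [self_mem_nhdsWithin] with s hs using h s hs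

/-- A gauge transformation that is trivial at points arbitrarily close to a point is trivial
there. -/
lemma gauge_eq_of_frequently (hq : 0 < P.q) (u : P.contactMetric.GaugeTransformation)
    {κ : ChartIndex} {x : E5} (hx : x ∈ tgt)
    {l : Filter E5} [l.NeBot] (hl : l ≤ 𝓝 x)
    (h : ∀ᶠ x' in l, ∀ α : P.contactMetric.asd ((P.chartCoord κ).param x'),
      u.toFun ((P.chartCoord κ).param x') α = α)
    (α : P.contactMetric.asd ((P.chartCoord κ).param x)) :
    u.toFun ((P.chartCoord κ).param x) α = α := by
  have hxt : x ∈ (P.chartCoord κ).target := hx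
  -- The form at the limit point is extended to a smooth local section `σ` with constant
  -- coefficients in the chart coframe. Both `σ` and `u σ` are smooth and agree along the filter, so
  -- their values agree in the limit.
  obtain ⟨t, rfl⟩ := (isCoframeExpr_chartCoord hq κ).exists_toSection_eq
    (LocalCoord.param_mem hxt) α
  obtain ⟨σ, hσ⟩ : ∃ σ, σ = (isCoframeExpr_chartCoord hq κ).toSection fun _ => t := ⟨_, rfl⟩
  rw [← hσ]
  have hs : P.contactMetric.SmoothFormAt σ ((P.chartCoord κ).param x) :=
    hσ ▸ (isCoframeExpr_chartCoord hq κ).smoothFormAt_toSection hxt contDiffAt_const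
  refine ext_asd hxt fun v w => ?_
  have hcont : ∀ σ : ∀ m, P.contactMetric.asd m,
      P.contactMetric.SmoothFormAt σ ((P.chartCoord κ).param x) →
      Filter.Tendsto (fun x' => (σ ((P.chartCoord κ).param x')).1
        ![(P.chartCoord κ).dparam x' v, (P.chartCoord κ).dparam x' w]) l
        (𝓝 ((σ ((P.chartCoord κ).param x)).1
          ![(P.chartCoord κ).dparam x v, (P.chartCoord κ).dparam x w])) := by
    intro σ hσ
    have h1 := hσ _ _ (LocalCoord.smoothFieldAt_push hxt (contDiffAt_const (c := v)))
      (LocalCoord.smoothFieldAt_push hxt (contDiffAt_const (c := w)))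
    have h2 : ContDiffAt ℝ ∞ (fun x' => (σ ((P.chartCoord κ).param x')).1
        ![(P.chartCoord κ).dparam x' v, (P.chartCoord κ).dparam x' w]) x := by
      refine (LocalCoord.contDiffAt_comp_param hxt h1).congr_of_eventuallyEq ?_
      filter_upwards [(P.chartCoord κ).open_target.mem_nhds hxt] with x' hx'
      simp only [Function.comp, LocalCoord.push_param hx']
    exact h2.continuousAt.tendsto.mono_left hl
  refine tendsto_nhds_unique (hcont _ (u.smooth σ _ hs)) ((hcont σ hs).congr' ?_)
  filter_upwards [h] with x' hx'
  rw [hx']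

theorem transverseLCIrreducible (hq : 0 < P.q) : P.contactMetric.TransverseLCIrreducible := by
  intro u hu m
  obtain ⟨κ, hκ⟩ := P.exists_chart m
  have hm : (P.chartCoord κ).param ((P.chart κ) m) = m := (P.chart κ).left_inv hκ
  have hx : (P.chart κ) m ∈ tgt := (P.chart κ).map_source hκ
  rw [← hm]
  refine gauge_eq_of_frequently hq u hx (l := Filter.map (nearby ((P.chart κ) m)) (𝓝[>] 0))
    (tendsto_nearby _) ?_
  rw [Filter.eventually_map]
  filter_upwards [eventually_curvFactor_ne_zero hq κ _, self_mem_nhdsWithin] with s hs hs0 α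
  exact gauge_proj_eq hq hu (P.sliceS κ _)
    (slice_fst_ne_zero κ (grow_ne_zero _ hs0))
    (slice_snd_ne_zero κ (grow_ne_zero _ hs0)) hs α

end YParam

end

theorem mainTheorem12 (p q : ℕ) (hqp : q < p) (hcop : Nat.Coprime p q) (hne : (p, q) ≠ (1, 0)) :
    (YParam.contactMetric ⟨p, q, hqp, hcop⟩).TransverseLCIrreducible := by
  -- If `q = 0`, coprimality forces `p = 1`, the excluded pair.
  refine YParam.transverseLCIrreducible (P := ⟨p, q, hqp, hcop⟩) (Nat.pos_of_ne_zero fun h => hne ?_)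
  simp only at h
  subst h
  rw [Nat.coprime_zero_right] at hcop
  rw [hcop]
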